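/- **Setting.** Let $D=(V,A)$ be a finite directed graph with $n$ nodes and $m$ arcs, arc capacities $u_a>0$, transit times $\tau_a\ge 0$ and real arc costs $c_a$ such that no cycle has negative cost. Let $b\in\mathbb R^V$ with $\sum_v b_v=0$; the sources are $S^+=\{v: b_v>0\}$, the sinks are $S^-=\{v: b_v<0\}$, and $k=|S^+\cup S^-|$. Paths are directed and may visit nodes repeatedly. A *transshipment over time* with time horizon $\theta\ge 0$ consists of Lebesgue measurable inflow rates $f_a:[0,\theta-\tau_a)\to[0,u_a]$, $a\in A$. Put $f_a=0$ outside this interval. For $0\le\xi\le\theta$, let $$\mathrm{ex}_f(v,\xi)=\sum_{a\text{ entering }v}\int_{[0,\xi-\tau_a)}f_a-\sum_{a\text{ leaving }v}\int_{[0,\xi)}f_a .$$ It is required that $\mathrm{ex}_f(v,\xi)\ge 0$ for all $v\notin S^+$ and $\xi\in[0,\theta]$, and that $\mathrm{ex}_f(v,\theta)=-b_v$ for all $v\in V$. Its cost is $\sum_a c_a\int_{[0,\theta-\tau_a)} f_a$. One fixes in advance whether storage at intermediate nodes is allowed (if not, $\mathrm{ex}_f(v,\xi)=0$ is required whenever $b_v=0$),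 and whether a source may temporarily send more than its supply (if not, $\mathrm{ex}_f(s,\xi)\ge -b_s$ is required for $s\in S^+$); the theorem holds for each of the four resulting models. A *quickest* transshipment is one of minimum time horizon. A *minimum cost* transshipment is one of minimum cost among all time horizons. A *quickest minimum cost* transshipment is a minimum cost transshipment whose time horizon is minimum among all minimum cost transshipments. Assume that there is a transshipment over time in $D$. **Algorithm.** 1. For all $(s,t)\in S^+\times S^-$, decide whether there is an $s$-$t$-path in $D$, and if so compute the cost $\bar c_{st}$ of a cheapest one. 2. Determine an optimal solution $y^*$ of the dual of the transportation problem: maximize $\sum_{s\in S^+}b_sy_s+\sum_{t\in S^-}b_ty_t$ subject to $y_s-y_t\le\bar c_{st}$ for all $(s,t)\in S^+\times S^-$ for which there is an $s$-$t$-path. 3. Let $\tilde D$ arise from $D$ by adding a super-source $\tilde s$ with arcs $\tilde ss$ of cost $-y^*_s$ for $s\in S^+$, and a super-sink $\tilde t$ with arcs $t\tilde t$ of cost $y^*_t$ for $t\in S^-$. Find the set $A'\subseteq A$ of all arcs of $D$ that lie on some cheapest $\tilde s$-$\tilde t$-path in $\tilde D$. 4. Compute a quickest transshipment in $D'=(V,A')$.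 **Theorem.** (Correctness.) For every optimal dual solution $y^*$, there is a transshipment over time in $D'$; every transshipment over time in $D'$ is (after extension by zero) a minimum cost transshipment in $D$; for every minimum cost transshipment in $D$ there is a transshipment in $D'$ with the same time horizon; and every quickest transshipment in $D'$ is a quickest minimum cost transshipment in $D$. (Running time.) The running time is dominated by the quickest transshipment computation in Step 4, for which $\tilde O(m^2k^5+m^3k^3+m^3n)$ is the best known worst case bound: there are a constant $C$ and fixed programs for Steps 1, 2 and 3 that, run one after the other on any instance as above, compute the path costs $\bar c_{st}$, an optimal dual solution $y^*$ and the corresponding set $A'$ in at most $C\,(m^2k^5+m^3k^3+m^3n+1)$ steps in total, so that the whole algorithm takes at most this many steps in addition to those of Step 4. Here programs run on a real random access machine with arrays of natural numbers (indices; addition, truncated subtraction, comparison) and arrays of real numbers (the four arithmetic operations, comparison), where each assignment and each test counts as one step. -/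

import Mathlib

open MeasureTheory Set

/-! ### Directed graphs, paths, cheapest paths -/

/-- A directed graph with node set `V` and arc set `A` (parallel arcs are allowed). -/
structure ArcGraph (V A : Type*) where
  tail : A → V
  head : A → V

namespace ArcGraph

variable {V A : Type*}

/-- `G.IsPath v w p`: the list of arcs `p` is a directed path from `v` to `w`.
Nodes may be visited repeatedly. -/
def IsPath (G : ArcGraph V A) : V → V → List A → Prop
  | v, w, [] => v = w
  | v, w, a :: p => G.tail a = v ∧ G.IsPath (G.head a) w p

/-- The total cost `c(P)` of a path. -/
def pathCost (c : A → ℝ) (p : List A) : ℝ := (p.map c).sum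

/-- `p` is a cheapest `v`-`w`-path. -/
def IsCheapestPath (G : ArcGraph V A) (c : A → ℝ) (v w : V) (p : List A) : Prop :=
  G.IsPath v w p ∧ ∀ q, G.IsPath v w q → pathCost c p ≤ pathCost c q

/-- `x` is the cost of a cheapest `v`-`w`-path. -/
def IsCheapestCost (G : ArcGraph V A) (c : A → ℝ) (v w : V) (x : ℝ) : Prop :=
  ∃ p, G.IsCheapestPath c v w p ∧ pathCost c p = x

/-- Arc costs are conservative: there is no cycle of negative cost. -/
def Conservative (G : ArcGraph V A) (c : A → ℝ) : Prop :=
  ∀ v p, G.IsPath v v p → 0 ≤ pathCost c p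

/-- The subgraph with the same node set and with arc set `S`. -/
def restrict (G : ArcGraph V A) (S : Finset A) : ArcGraph V S where
  tail a := G.tail a
  head a := G.head a

theorem IsPath.of_restrict {G : ArcGraph V A} {S : Finset A} {w : V} :
    ∀ {p : List S} {v : V}, (G.restrict S).IsPath v w p → G.IsPath v w (p.map Subtype.val)
  | [], _, h => h
  | _ :: _, _, h => ⟨h.1, IsPath.of_restrict h.2⟩

end ArcGraph

/-! ### Networks -/

/-- An instance of the transshipment problem: a directed graph with positive arc capacities,
non-negative transit times, conservative arc costs, and a function `b` on the nodes with total
sum zero. The sources are the nodes with `b v > 0` (the supply), the sinks are the nodes with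
`b v < 0` (the demand is `-b v`), and `b v = 0` for all other nodes. -/
structure Network (V A : Type*) [Fintype V] extends ArcGraph V A where
  cap : A → ℝ
  transit : A → ℝ
  cost : A → ℝ
  b : V → ℝ
  cap_pos : ∀ a, 0 < cap a
  transit_nonneg : ∀ a, 0 ≤ transit a
  conservative : toArcGraph.Conservative cost
  balanced : ∑ v, b v = 0

/-- The two modelling choices for flows over time. `storage`: flow may be stored temporarily at
intermediate nodes. `overdraft`: the net amount of flow that has left a source up to some point
in time before the time horizon may exceed its supply. -/
structure FlowModel where
  storage : Bool
  overdraft : Bool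

namespace Network

variable {V A : Type*} [Fintype V]

/-- The subnetwork with the same node set and with arc set `S`. -/
def restrict (N : Network V A) (S : Finset A) : Network V S where
  toArcGraph := N.toArcGraph.restrict S
  cap a := N.cap a
  transit a := N.transit a
  cost a := N.cost a
  b := N.b
  cap_pos a := N.cap_pos a
  transit_nonneg a := N.transit_nonneg a
  conservative v p hp := by
    have h := N.conservative v _ hp.of_restrict
    simpa [ArcGraph.pathCost, Function.comp_def] using h
  balanced := N.balanced

/-- The number `k` of sources and sinks. -/
noncomputable def numTerminals (N : Network V A) : ℕ := {v | N.b v ≠ 0}.ncard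

/-! ### Transshipments over time -/

open Classical in
/-- The net amount of flow that has accumulated at node `v` up to time `ξ`: flow that entered
arc `a` at time `t` arrives at the head of `a` at time `t + transit a`. -/
noncomputable def excess [Fintype A] (N : Network V A) (f : A → ℝ → ℝ) (v : V) (ξ : ℝ) : ℝ :=
  (∑ a, if N.head a = v then ∫ t in Ico 0 (ξ - N.transit a), f a t else 0) -
    ∑ a, if N.tail a = v then ∫ t in Ico 0 ξ, f a t else 0

/-- `f` is a transshipment over time with time horizon `θ`; `f a t` is the rate at which flow
enters arc `a` at time `t`. The function `f a` lives on `[0, θ - transit a)`; it is represented by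
a function on `ℝ` that vanishes elsewhere. -/
structure IsTransshipment [Fintype A] (N : Network V A) (M : FlowModel) (θ : ℝ)
    (f : A → ℝ → ℝ) : Prop where
  horizon_nonneg : 0 ≤ θ
  measurable : ∀ a, AEMeasurable (f a) (volume.restrict (Ico 0 (θ - N.transit a)))
  zero_outside : ∀ a, ∀ t, t ∉ Ico 0 (θ - N.transit a) → f a t = 0
  nonneg : ∀ a, ∀ t ∈ Ico 0 (θ - N.transit a), 0 ≤ f a t
  le_cap : ∀ a, ∀ t ∈ Ico 0 (θ - N.transit a), f a t ≤ N.cap a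
  no_deficit : ∀ v, N.b v ≤ 0 → ∀ ξ ∈ Icc 0 θ, 0 ≤ N.excess f v ξ
  no_storage : M.storage = false → ∀ v, N.b v = 0 → ∀ ξ ∈ Icc 0 θ, N.excess f v ξ = 0
  no_overdraft : M.overdraft = false → ∀ v, 0 < N.b v → ∀ ξ ∈ Icc 0 θ, -N.b v ≤ N.excess f v ξ
  balance : ∀ v, N.excess f v θ = -N.b v

/-- There is a transshipment over time, for some time horizon. -/
def Feasible [Fintype A] (N : Network V A) (M : FlowModel) : Prop :=
  ∃ θ f, N.IsTransshipment M θ f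

/-- The total cost of a flow over time with time horizon `θ`. -/
noncomputable def flowCost [Fintype A] (N : Network V A) (θ : ℝ) (f : A → ℝ → ℝ) : ℝ :=
  ∑ a, N.cost a * ∫ t in Ico 0 (θ - N.transit a), f a t

/-- A quickest transshipment: one of minimum time horizon. -/
def IsQuickest [Fintype A] (N : Network V A) (M : FlowModel) (θ : ℝ) (f : A → ℝ → ℝ) : Prop :=
  N.IsTransshipment M θ f ∧ ∀ θ' f', N.IsTransshipment M θ' f' → θ ≤ θ'

/-- A minimum cost transshipment over time, among all time horizons. -/
def IsMinCost [Fintype A] (N : Network V A) (M : FlowModel) (θ : ℝ) (f : A → ℝ → ℝ) : Prop :=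
  N.IsTransshipment M θ f ∧
    ∀ θ' f', N.IsTransshipment M θ' f' → N.flowCost θ f ≤ N.flowCost θ' f'

/-- A quickest minimum cost transshipment: a minimum cost transshipment over time whose time
horizon is minimum among all minimum cost transshipments over time. -/
def IsQuickestMinCost [Fintype A] (N : Network V A) (M : FlowModel) (θ : ℝ)
    (f : A → ℝ → ℝ) : Prop :=
  N.IsMinCost M θ f ∧ ∀ θ' f', N.IsMinCost M θ' f' → θ ≤ θ'

open Classical in
/-- A flow over time in the subnetwork with arc set `S`, seen as a flow over time in the whole
network. -/
noncomputable def extendFlow (S : Finset A) (f : S → ℝ → ℝ) : A → ℝ → ℝ :=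
  fun a t => if h : a ∈ S then f ⟨a, h⟩ t else 0

/-! ### The dual of the bipartite transportation problem -/

/-- Feasibility for the dual of the transportation problem: `y s - y t` is at most the cost of a
cheapest `s`-`t`-path, for each source `s` and sink `t` such that there is an `s`-`t`-path.
(Only the entries of `y` at sources and sinks matter.) -/
def IsDualFeasible (N : Network V A) (y : V → ℝ) : Prop :=
  ∀ s t x, 0 < N.b s → N.b t < 0 → N.IsCheapestCost N.cost s t x → y s - y t ≤ x

open Classical in
/-- The dual objective function. -/
noncomputable def dualValue (N : Network V A) (y : V → ℝ) : ℝ :=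
  (∑ s with 0 < N.b s, N.b s * y s) + ∑ t with N.b t < 0, N.b t * y t

/-- `y` is an optimal solution to the dual of the transportation problem. -/
def IsOptimalDual (N : Network V A) (y : V → ℝ) : Prop :=
  N.IsDualFeasible y ∧ ∀ y', N.IsDualFeasible y' → N.dualValue y' ≤ N.dualValue y

/-! ### The extended network -/

end Network

/-- Nodes of the extended network. -/
inductive ExtNode (V : Type*) where
  | superSource
  | node (v : V)
  | superSink

/-- Arcs of the extended network; `src` and `snk` are the sets of sources and sinks. -/
inductive ExtArc {V : Type*} (A : Type*) (src snk : Set V) where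
  | arc (a : A)
  | fromSuperSource (s : src)
  | toSuperSink (t : snk)

namespace Network

variable {V A : Type*} [Fintype V]

def sources (N : Network V A) : Set V := {v | 0 < N.b v}

def sinks (N : Network V A) : Set V := {v | N.b v < 0}

/-- The extended network: the super-source is joined to all sources, all sinks are joined to the
super-sink. -/
def extGraph (N : Network V A) : ArcGraph (ExtNode V) (ExtArc A N.sources N.sinks) where
  tail
    | .arc a => .node (N.tail a)
    | .fromSuperSource _ => .superSource
    | .toSuperSink t => .node t
  head
    | .arc a => .node (N.head a)
    | .fromSuperSource s => .node s
    | .toSuperSink _ => .superSink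

/-- Arc costs in the extended network. -/
def extCost (N : Network V A) (y : V → ℝ) : ExtArc A N.sources N.sinks → ℝ
  | .arc a => N.cost a
  | .fromSuperSource s => -y s
  | .toSuperSink t => y t

open Classical in
/-- The set `A'` of arcs that lie on a cheapest path from the super-source to the super-sink. -/
noncomputable def cheapestArcs [Fintype A] (N : Network V A) (y : V → ℝ) : Finset A :=
  {a | ∃ p, N.extGraph.IsCheapestPath (N.extCost y) .superSource .superSink p ∧ .arc a ∈ p}

end Network

/-! ### A real random access machine

Programs of a while-language whose memory consists of two-dimensional arrays of natural numbers
(used for indices and for control) and two-dimensional arrays of real numbers. The arrays are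
numbered. Every assignment and every evaluation of a test counts as one step. -/

namespace RealRAM

structure Mem where
  nat : ℕ → ℕ → ℕ → ℕ
  real : ℕ → ℕ → ℕ → ℝ

/-- Index expressions; subtraction is truncated. -/
inductive NExpr where
  | lit (k : ℕ)
  | get (x : ℕ) (i j : NExpr)
  | add (d e : NExpr)
  | sub (d e : NExpr)

def NExpr.eval (σ : Mem) : NExpr → ℕ
  | lit k => k
  | get x i j => σ.nat x (i.eval σ) (j.eval σ)
  | add d e => d.eval σ + e.eval σ
  | sub d e => d.eval σ - e.eval σ

/-- Real expressions: rational constants and the four arithmetic operations. -/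
inductive RExpr where
  | lit (q : ℚ)
  | get (x : ℕ) (i j : NExpr)
  | add (d e : RExpr)
  | sub (d e : RExpr)
  | mul (d e : RExpr)
  | div (d e : RExpr)

noncomputable def RExpr.eval (σ : Mem) : RExpr → ℝ
  | lit q => q
  | get x i j => σ.real x (i.eval σ) (j.eval σ)
  | add d e => d.eval σ + e.eval σ
  | sub d e => d.eval σ - e.eval σ
  | mul d e => d.eval σ * e.eval σ
  | div d e => d.eval σ / e.eval σ

/-- Tests. -/
inductive Test where
  | natLe (d e : NExpr)
  | realLe (d e : RExpr)
  | not (T : Test)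
  | and (T U : Test)

def Test.Holds (σ : Mem) : Test → Prop
  | natLe d e => d.eval σ ≤ e.eval σ
  | realLe d e => d.eval σ ≤ e.eval σ
  | not T => ¬ T.Holds σ
  | and T U => T.Holds σ ∧ U.Holds σ

inductive Program where
  | setNat (x : ℕ) (i j e : NExpr)
  | setReal (x : ℕ) (i j : NExpr) (e : RExpr)
  | seq (P Q : Program)
  | cond (T : Test) (P Q : Program)
  | loop (T : Test) (P : Program)

/-- Overwrite entry `(i, j)` of the array with number `x`. -/
def update {α : Type*} (g : ℕ → ℕ → ℕ → α) (x i j : ℕ) (r : α) : ℕ → ℕ → ℕ → α :=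
  fun x' i' j' => if x' = x ∧ i' = i ∧ j' = j then r else g x' i' j'

/-- `Exec P σ σ' t`: program `P`, started in memory `σ`, halts after `t` steps in memory `σ'`. -/
inductive Exec : Program → Mem → Mem → ℕ → Prop where
  | setNat (x : ℕ) (i j e : NExpr) (σ : Mem) :
      Exec (.setNat x i j e) σ
        { σ with nat := update σ.nat x (i.eval σ) (j.eval σ) (e.eval σ) } 1
  | setReal (x : ℕ) (i j : NExpr) (e : RExpr) (σ : Mem) :
      Exec (.setReal x i j e) σ
        { σ with real := update σ.real x (i.eval σ) (j.eval σ) (e.eval σ) } 1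
  | seq {P Q : Program} {σ σ' σ'' : Mem} {t t' : ℕ} :
      Exec P σ σ' t → Exec Q σ' σ'' t' → Exec (.seq P Q) σ σ'' (t + t')
  | condTrue {T : Test} {P Q : Program} {σ σ' : Mem} {t : ℕ} :
      T.Holds σ → Exec P σ σ' t → Exec (.cond T P Q) σ σ' (t + 1)
  | condFalse {T : Test} {P Q : Program} {σ σ' : Mem} {t : ℕ} :
      ¬ T.Holds σ → Exec Q σ σ' t → Exec (.cond T P Q) σ σ' (t + 1)
  | loopDone {T : Test} {P : Program} {σ : Mem} :
      ¬ T.Holds σ → Exec (.loop T P) σ σ 1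
  | loopStep {T : Test} {P : Program} {σ σ' σ'' : Mem} {t t' : ℕ} :
      T.Holds σ → Exec P σ σ' t → Exec (.loop T P) σ' σ'' t' → Exec (.loop T P) σ σ'' (t + t' + 1)

end RealRAM

/-! ### Input and output of the algorithm in memory -/

namespace Network

open RealRAM

variable {n m : ℕ}

/-- The memory holds the instance `N`: the numbers of nodes and arcs, tail and head of each arc,
capacity, transit time and cost of each arc, and the supplies and demands. The remaining memory is
arbitrary. -/
structure StoredIn (N : Network (Fin n) (Fin m)) (σ : Mem) : Prop where
  numNodes : σ.nat 0 0 0 = n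
  numArcs : σ.nat 0 0 1 = m
  tail : ∀ a : Fin m, σ.nat 1 a 0 = N.tail a
  head : ∀ a : Fin m, σ.nat 1 a 1 = N.head a
  cap : ∀ a : Fin m, σ.real 0 a 0 = N.cap a
  transit : ∀ a : Fin m, σ.real 0 a 1 = N.transit a
  cost : ∀ a : Fin m, σ.real 0 a 2 = N.cost a
  b : ∀ v : Fin n, σ.real 1 v 0 = N.b v

/-- The memory holds, for each source `s` and sink `t`, whether there is an `s`-`t`-path, and in
that case the cost of a cheapest one. -/
def PathCostsStoredIn (N : Network (Fin n) (Fin m)) (σ : Mem) : Prop :=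
  ∀ s t, 0 < N.b s → N.b t < 0 →
    ((∃ p, N.IsPath s t p) → σ.nat 2 s t = 1 ∧ N.IsCheapestCost N.cost s t (σ.real 2 s t)) ∧
    ((¬ ∃ p, N.IsPath s t p) → σ.nat 2 s t = 0)

/-- The vector indexed by the nodes that is held in the memory. -/
def storedVector (n : ℕ) (σ : Mem) : Fin n → ℝ := fun v => σ.real 3 v 0

/-- The memory holds the arc set `S`, as a 0-1-vector indexed by the arcs. -/
def ArcSetStoredIn (S : Finset (Fin m)) (σ : Mem) : Prop :=
  ∀ a : Fin m, σ.nat 3 a 0 = if a ∈ S then 1 else 0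

end Network

/-- The worst case running time `m² k⁵ + m³ k³ + m³ n` (up to polylogarithmic factors) of the
fastest known quickest transshipment algorithm on networks with `n` nodes, `m` arcs and `k`
sources and sinks. -/
def quickestTransshipmentBound (n m k : ℕ) : ℕ := m ^ 2 * k ^ 5 + m ^ 3 * k ^ 3 + m ^ 3 * n

/-! Correctness is linear programming duality. Integrating the inflow rates of a transshipment over
time gives a static flow with net outflow `b` and the same cost, so costs can be treated statically.
A feasible dual solution extends to a node potential with nonnegative reduced arc costs without
lowering the dual objective (`IsDualFeasible.exists_potential`). Summation by parts then bounds all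
costs from below by the dual value (`IsDualFeasible.value_le`). If the dual solution is optimal, the
potential agrees with it on the terminals, and every arc of `A'` has reduced cost zero
(`IsOptimalDual.tight_of_mem_cheapestArcs`), so each transshipment in `D'` attains the bound. One
exists: strong duality (`IsOptimalDual.exists_transport`) gives a transportation plan on tight
pairs, and the plan can be routed along cheapest paths at a small constant rate
(`feasible_of_paths`).

Conversely, a minimum cost transshipment uses arcs of reduced cost zero only. Some of these may lie
outside `A'`: flow can appear from nothing on a cycle of zero cost and zero transit time. But no
flow enters or leaves the set of nodes that are reachable from a source by tight arcs, nor the set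
of nodes that reach a sink by tight arcs (`no_inflow_of_no_outflow`). Hence the flow outside `A'`
can be dropped without affecting the excess at any node of both sets, and the time horizon is kept
(`IsOptimalDual.exists_restrict`). The claim on quickest transshipments follows.

Running time: Step 1 is one Bellman-Ford computation per source. Step 3 is two such computations,
one from the sources and one backwards from the sinks; since a cheapest path in the extended network
has cost zero, an arc is on one if and only if the two labels and the arc cost add up to at most
zero (`IsOptimalDual.mem_cheapestArcs_iff`).

Step 2 must be strongly polynomial. It maximizes over a system of difference constraints indexed by
the `k` terminals and eliminates one index per phase. With `B` the maximum absolute supply, a phase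
sends flow in units of `Δ = B / (k² + k)` along tight constraints by primal-dual augmentation, until
the total rounding error is at most `kΔ` (`sum_excess_le`). Then some pair carries at least `k`
units (`exists_large_flow`). This exceeds what rounding can account for, so the search for an
optimum can be restricted to solutions for which that constraint is tight (`exists_tight`), and one
of its two indices is contracted into the other (`Reduction.contract`). When all supplies vanish,
the current potentials are optimal. The `k` phases take `O(k⁶)` steps each, and `k ≤ 2m`
(`Feasible.numTerminals_le`) turns the total into `O(m²k⁵)`, up to an additive constant
(`steps_le`). -/

/-! ### Paths, cycle removal and potentials -/

namespace ArcGraph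

variable {V A : Type*} {G : ArcGraph V A} {c : A → ℝ}

@[simp] theorem pathCost_nil : pathCost c [] = 0 := rfl

@[simp] theorem pathCost_cons (a : A) (p : List A) : pathCost c (a :: p) = c a + pathCost c p := by
  simp [pathCost]

@[simp] theorem pathCost_append (p q : List A) :
    pathCost c (p ++ q) = pathCost c p + pathCost c q := by
  simp [pathCost]

theorem isPath_append {p q : List A} :
    ∀ {v w : V}, G.IsPath v w (p ++ q) ↔ ∃ u, G.IsPath v u p ∧ G.IsPath u w q := by
  induction p with
  | nil => intro v w; simp [IsPath]
  | cons a p ih => intro v w; simp [IsPath, ih, and_assoc]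

theorem IsPath.append {p q : List A} {u v w : V} (hp : G.IsPath u v p) (hq : G.IsPath v w q) :
    G.IsPath u w (p ++ q) := isPath_append.2 ⟨v, hp, hq⟩

theorem isPath_singleton (a : A) : G.IsPath (G.tail a) (G.head a) [a] := ⟨rfl, rfl⟩

theorem IsPath.end_unique {p : List A} : ∀ {v w w' : V}, G.IsPath v w p → G.IsPath v w' p → w = w' := by
  induction p with
  | nil => intro v w w' h h'; exact h.symm.trans h'
  | cons a p ih => intro v w w' h h'; exact ih h.2 h'.2

/-- The graph with all arcs reversed. -/
def rev (G : ArcGraph V A) : ArcGraph V A := ⟨G.head, G.tail⟩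

theorem IsPath.reverse {p : List A} :
    ∀ {v w : V}, G.IsPath v w p → G.rev.IsPath w v p.reverse := by
  induction p with
  | nil => intro v w h; exact Eq.symm h
  | cons a p ih =>
    intro v w h
    rw [List.reverse_cons]
    obtain ⟨rfl, h⟩ := h
    exact (ih h).append (isPath_singleton (G := G.rev) a)

theorem pathCost_reverse (p : List A) : pathCost c p.reverse = pathCost c p := by
  simp [pathCost, List.sum_reverse]

theorem Conservative.rev (h : G.Conservative c) : G.rev.Conservative c := by
  intro v p hp
  have := h v p.reverse (IsPath.reverse (G := G.rev) hp)
  rwa [pathCost_reverse] at this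

/-- A path with more arcs than nodes visits some node twice; cutting out the cycle in between does
not increase the cost, and induction on the length finishes. This makes minima over paths finite and
justifies `n` rounds of Bellman-Ford. -/
theorem Conservative.exists_short [Fintype V] (h : G.Conservative c) {v w : V} {p : List A}
    (hp : G.IsPath v w p) :
    ∃ q, G.IsPath v w q ∧ q.length ≤ Fintype.card V ∧ pathCost c q ≤ pathCost c p := by
  induction hn : p.length using Nat.strong_induction_on generalizing p with
  | _ n ih =>
    by_cases hlen : p.length ≤ Fintype.card V
    · exact ⟨p, hp, hlen, le_rfl⟩
    have key : ∀ i : ℕ, ∃ u, G.IsPath v u (p.take i) ∧ G.IsPath u w (p.drop i) := fun i =>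
      isPath_append.1 (by rwa [List.take_append_drop])
    choose u hu1 hu2 using key
    -- The start nodes of the arcs alone outnumber the nodes, so the end node of the path is not
    -- needed for the pigeonhole argument.
    obtain ⟨i, j, hij, huij⟩ := Fintype.exists_ne_map_eq_of_card_lt
      (fun i : Fin p.length => u i) (by simpa using hlen)
    wlog hlt : i < j generalizing i j
    · exact this j i hij.symm huij.symm (lt_of_le_of_ne (not_lt.1 hlt) hij.symm)
    have hlt' : (i : ℕ) < j := hlt
    have hj := j.2
    have e1 : p.take j = p.take i ++ (p.take j).drop i := by
      conv_lhs => rw [← List.take_append_drop i (p.take j)]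
      rw [List.take_take, min_eq_left hlt'.le]
    obtain ⟨z, hz1, hz2⟩ := isPath_append.1 (e1 ▸ hu1 j)
    have hzi : z = u i := hz1.end_unique (hu1 i)
    have hcyc : 0 ≤ pathCost c ((p.take j).drop i) := by
      apply h (u i)
      have : u j = u i := huij.symm
      rw [hzi, this] at hz2
      exact hz2
    have hcost : pathCost c p = pathCost c (p.take i) + pathCost c ((p.take j).drop i)
        + pathCost c (p.drop j) := by
      rw [← pathCost_append, ← e1, ← pathCost_append, List.take_append_drop]
    have hq : G.IsPath v w (p.take i ++ p.drop j) := by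
      refine (hu1 i).append ?_
      have : u j = u i := huij.symm
      rw [← this]
      exact hu2 j
    obtain ⟨q, h1, h2, h3⟩ := ih _ (by simp; omega) hq rfl
    exact ⟨q, h1, h2, by rw [pathCost_append] at h3; linarith⟩

/-- `π v` is the distance from `v` to the nearest target, where stopping at `w` costs `Y w`. The
minimum is attained because only the finitely many short paths matter. Prepending an arc shows that
such distances have nonnegative reduced costs. -/
theorem Conservative.exists_potential [Fintype V] [Finite A] (h : G.Conservative c) (Y : V → ℝ) :
    ∃ π : V → ℝ, (∀ v, ∃ w q, G.IsPath v w q ∧ π v = pathCost c q + Y w) ∧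
      ∀ v w q, G.IsPath v w q → π v ≤ pathCost c q + Y w := by
  have key : ∀ v, ∃ x : ℝ, (∃ w q, G.IsPath v w q ∧ x = pathCost c q + Y w) ∧
      ∀ w q, G.IsPath v w q → x ≤ pathCost c q + Y w := by
    intro v
    let S : Set (V × List A) := {z | G.IsPath v z.1 z.2 ∧ z.2.length ≤ Fintype.card V}
    have hS : S.Finite := by
      refine (Set.Finite.prod (Set.finite_univ (α := V))
        (List.finite_length_le A (Fintype.card V))).subset ?_
      rintro ⟨w, q⟩ ⟨-, hq⟩
      exact ⟨mem_univ _, hq⟩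
    obtain ⟨⟨w, q⟩, hwq, hmin⟩ := Set.exists_min_image S (fun z => pathCost c z.2 + Y z.1) hS
      ⟨(v, []), rfl, by simp⟩
    refine ⟨_, ⟨w, q, hwq.1, rfl⟩, fun w' q' hq' => ?_⟩
    obtain ⟨r, h1, h2, h3⟩ := h.exists_short hq'
    have := hmin (w', r) ⟨h1, h2⟩
    simp only at this
    linarith
  choose π h1 h2 using key
  exact ⟨π, h1, h2⟩

theorem Conservative.exists_isCheapestPath [Fintype V] [Finite A] (h : G.Conservative c) {v w : V}
    (hp : ∃ p, G.IsPath v w p) : ∃ p, G.IsCheapestPath c v w p := by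
  let S : Set (List A) := {q | G.IsPath v w q ∧ q.length ≤ Fintype.card V}
  have hS : S.Finite := (List.finite_length_le A (Fintype.card V)).subset fun q hq => hq.2
  obtain ⟨p, hp⟩ := hp
  obtain ⟨q₀, h1, h2, -⟩ := h.exists_short hp
  obtain ⟨q, hq, hmin⟩ := Set.exists_min_image S (pathCost c) hS ⟨q₀, h1, h2⟩
  refine ⟨q, hq.1, fun r hr => ?_⟩
  obtain ⟨r', h1, h2, h3⟩ := h.exists_short hr
  exact (hmin r' ⟨h1, h2⟩).trans h3

/-- The potential differences telescope along the path. -/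
theorem pathCost_ge_of_potential {π : V → ℝ} (hπ : ∀ a, π (G.tail a) - π (G.head a) ≤ c a)
    {p : List A} : ∀ {v w : V}, G.IsPath v w p → π v - π w ≤ pathCost c p := by
  induction p with
  | nil => intro v w h; cases h; simp
  | cons a p ih =>
    rintro v w ⟨rfl, h⟩
    have := ih h
    have := hπ a
    rw [pathCost_cons]
    linarith

theorem IsPath.exists_lift {S : Finset A} {p : List A} (hS : ∀ a ∈ p, a ∈ S) :
    ∀ {v w : V}, G.IsPath v w p →
      ∃ q : List S, (G.restrict S).IsPath v w q ∧ q.map Subtype.val = p := by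
  induction p with
  | nil => intro v w h; exact ⟨[], h, rfl⟩
  | cons a p ih =>
    rintro v w ⟨rfl, h⟩
    obtain ⟨q, h1, h2⟩ := ih (fun b hb => hS b (List.mem_cons_of_mem _ hb)) h
    exact ⟨⟨a, hS a (by simp)⟩ :: q, ⟨rfl, h1⟩, by simp [h2]⟩

end ArcGraph

/-! ### Bipartite transportation by least squares -/

open Classical in
/-- A Farkas-type theorem for bipartite transportation: if `b` is nonpositive on every vector that
does not decrease along the pairs in `R`, then `b` is the net outflow of a nonnegative flow on the
pairs in `R`. -/
theorem exists_transport_flow {V : Type*} [Fintype V] (R : V → V → Prop)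
    (hR : ∀ u v w, R u v → ¬ R v w) (b : V → ℝ)
    (hb : ∀ r : V → ℝ, (∀ s t, R s t → r s - r t ≤ 0) → ∑ v, b v * r v ≤ 0) :
    ∃ x : V → V → ℝ, (∀ s t, 0 ≤ x s t) ∧ (∀ s t, 0 < x s t → R s t) ∧
      ∀ v, ∑ t, x v t - ∑ s, x s v = b v := by
  let L : (V → V → ℝ) → V → ℝ := fun x v =>
    ∑ t, (if R v t then x v t else 0) - ∑ s, (if R s v then x s v else 0)
  have hLlin : ∀ (x e : V → V → ℝ) (ε : ℝ) (v : V),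
      L (fun s t => x s t + ε * e s t) v = L x v + ε * L e v := by
    intro x e ε v
    simp only [L, mul_sub, Finset.mul_sum]
    rw [sub_add_sub_comm, ← Finset.sum_add_distrib, ← Finset.sum_add_distrib]
    congr 1 <;> refine Finset.sum_congr rfl fun t _ => ?_ <;> split_ifs <;> simp
  -- The squared distance of the net outflow from `b` is minimized over a compact box. The residual
  -- `r` of a minimizer is the candidate for a separating vector, and the hypothesis on `b` forces
  -- it to vanish.
  let f : (V → V → ℝ) → ℝ := fun x => ∑ v, (b v - L x v) ^ 2
  have hf : Continuous f := by
    refine continuous_finsetSum _ fun v _ => (continuous_const.sub ?_).pow 2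
    refine (continuous_finsetSum _ fun t _ => ?_).sub (continuous_finsetSum _ fun t _ => ?_) <;>
    split_ifs <;> fun_prop
  set m : ℝ := 1 + ∑ v, b v ^ 2 with hm
  have hm1 : 1 ≤ m := by
    have : 0 ≤ ∑ v, b v ^ 2 := Finset.sum_nonneg fun v _ => sq_nonneg _
    linarith
  let K : Set (V → V → ℝ) := Set.pi univ fun _ => Set.pi univ fun _ => Icc 0 (2 * m)
  have hK : IsCompact K := isCompact_univ_pi fun _ => isCompact_univ_pi fun _ => isCompact_Icc
  have h0 : (fun _ _ => 0 : V → V → ℝ) ∈ K := fun s _ t _ => ⟨le_rfl, by linarith⟩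
  obtain ⟨x, hxK, hmin⟩ := hK.exists_isMinOn ⟨_, h0⟩ hf.continuousOn
  have hx : ∀ s t, 0 ≤ x s t := fun s t => (hxK s trivial t trivial).1
  set r : V → ℝ := fun v => b v - L x v with hr
  have habs : ∀ (g : V → ℝ) v, ∑ v, g v ^ 2 ≤ m - 1 → |g v| < m := by
    intro g v h
    have h1 : g v ^ 2 ≤ ∑ v, g v ^ 2 :=
      Finset.single_le_sum (f := fun v => g v ^ 2) (fun i _ => sq_nonneg _) (Finset.mem_univ v)
    refine abs_lt_of_sq_lt_sq (by nlinarith) (by linarith)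
  have hfx : ∑ v, r v ^ 2 ≤ m - 1 := by
    have h1 : f x ≤ f (fun _ _ => 0) := hmin h0
    have h2 : f (fun _ _ => 0) = ∑ v, b v ^ 2 := by simp [f, L]
    have h3 : f x = ∑ v, r v ^ 2 := rfl
    linarith
  -- The upper bound of the box is never active on pairs in `R`. No pair enters `s`, so `x s t` is
  -- at most the net outflow `b s - r s`, and both terms are smaller than `m` in absolute value.
  have hlt : ∀ s t, R s t → x s t < 2 * m := by
    intro s t hst
    have h1 : x s t ≤ L x s := by
      have e : ∑ u, (if R u s then x u s else 0) = 0 :=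
        Finset.sum_eq_zero fun u _ => if_neg fun h => hR _ _ _ h hst
      have := Finset.single_le_sum (f := fun t => if R s t then x s t else 0)
        (fun i _ => by split_ifs <;> simp [hx]) (Finset.mem_univ t)
      simp only [hst, if_true] at this
      simp only [L, e, sub_zero]
      exact this
    have h2 := abs_lt.1 (habs r s hfx)
    have h3 := abs_lt.1 (habs b s (by linarith))
    have h4 : r s = b s - L x s := rfl
    linarith [h2.1, h3.2]
  -- Changing the single coordinate `(s, t)` changes `f` by a quadratic in `ε` with linear
  -- coefficient `-2 (r s - r t)`. Small positive `ε` gives `hle`; small negative `ε`, allowed where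
  -- `x s t > 0`, gives `hge`.
  have hquad : ∀ s t, R s t → ∃ D : ℝ, ∀ ε : ℝ, 0 ≤ x s t + ε → x s t + ε ≤ 2 * m →
      0 ≤ -2 * ε * (r s - r t) + ε ^ 2 * D := by
    intro s t hst
    have hne : s ≠ t := by rintro rfl; exact hR _ _ _ hst hst
    let e : V → V → ℝ := fun u v => if u = s ∧ v = t then 1 else 0
    refine ⟨∑ v, L e v ^ 2, fun ε h1 h2 => ?_⟩
    have hmem : (fun u v => x u v + ε * e u v) ∈ K := by
      intro u _ v _
      by_cases huv : u = s ∧ v = t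
      · obtain ⟨rfl, rfl⟩ := huv
        simp only [e, and_self, if_true, mul_one]
        exact ⟨h1, h2⟩
      · simp only [e, huv, if_false, mul_zero, add_zero]
        exact hxK u trivial v trivial
    have h3 : f x ≤ f (fun u v => x u v + ε * e u v) := hmin hmem
    have h4 : f (fun u v => x u v + ε * e u v) =
        f x - 2 * ε * (∑ v, r v * L e v) + ε ^ 2 * ∑ v, L e v ^ 2 := by
      simp only [f, hLlin, Finset.mul_sum, ← Finset.sum_sub_distrib, ← Finset.sum_add_distrib]
      refine Finset.sum_congr rfl fun v _ => ?_
      simp only [hr]; ring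
    have h5 : ∑ v, r v * L e v = r s - r t := by
      have : ∀ v, L e v = (if v = s then 1 else 0) - (if v = t then 1 else 0) := by
        intro v
        simp only [L, e]
        congr 1
        · by_cases hv : v = s
          · subst hv
            rw [Finset.sum_eq_single t] <;> simp +contextual [hst]
          · simp [hv]
        · by_cases hv : v = t
          · subst hv
            rw [Finset.sum_eq_single s] <;> simp +contextual [hst]
          · simp [hv]
      simp [this, mul_sub]
    rw [h4, h5] at h3
    linarith
  have hle : ∀ s t, R s t → r s - r t ≤ 0 := by
    intro s t hst
    obtain ⟨D, hD⟩ := hquad s t hst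
    by_contra! hpos
    have hgap : 0 < 2 * m - x s t := by linarith [hlt s t hst]
    have hD' : 0 < |D| + 1 := by positivity
    set ε := min (2 * m - x s t) ((r s - r t) / (|D| + 1)) with hε
    have hε0 : 0 < ε := lt_min hgap (div_pos hpos hD')
    have hε1 : ε ≤ 2 * m - x s t := min_le_left _ _
    have h1 := hD ε (by linarith [hx s t]) (by linarith)
    have h2 : ε * (|D| + 1) ≤ r s - r t :=
      (le_div_iff₀ hD').1 (min_le_right _ _)
    have h3 : ε * (ε * D) ≤ ε * (r s - r t) :=
      mul_le_mul_of_nonneg_left (by nlinarith [le_abs_self D]) hε0.le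
    nlinarith
  have hge : ∀ s t, R s t → 0 < x s t → 0 ≤ r s - r t := by
    intro s t hst hpos
    obtain ⟨D, hD⟩ := hquad s t hst
    by_contra! hneg
    have hD' : 0 < |D| + 1 := by positivity
    set ε := min (x s t) ((r t - r s) / (|D| + 1)) with hε
    have hε0 : 0 < ε := lt_min hpos (div_pos (by linarith) hD')
    have hε1 : ε ≤ x s t := min_le_left _ _
    have h1 := hD (-ε) (by linarith) (by linarith [hlt s t hst])
    have h2 : ε * (|D| + 1) ≤ r t - r s :=
      (le_div_iff₀ hD').1 (min_le_right _ _)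
    have h3 : ε * (ε * D) ≤ ε * (r t - r s) :=
      mul_le_mul_of_nonneg_left (by nlinarith [le_abs_self D]) hε0.le
    nlinarith
  have hLr : ∑ v, L x v * r v = 0 := by
    have e1 : ∑ v, L x v * r v = ∑ s, ∑ t, (if R s t then x s t else 0) * (r s - r t) := by
      simp only [L, sub_mul, mul_sub, Finset.sum_sub_distrib, Finset.sum_mul]
      congr 1
      exact Finset.sum_comm
    rw [e1]
    refine Finset.sum_eq_zero fun s _ => Finset.sum_eq_zero fun t _ => ?_
    by_cases hst : R s t
    · rcases (hx s t).eq_or_lt with h | h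
      · simp [← h]
      · rw [le_antisymm (hle s t hst) (hge s t hst h), mul_zero]
    · simp [hst]
  -- Complementary slackness makes `r` orthogonal to `L x = b - r`, so `∑ b r = ∑ r²`, which is
  -- nonpositive by `hb`.
  have hr0 : ∀ v, r v = 0 := by
    have h1 := hb r hle
    have h2 : ∑ v, b v * r v = ∑ v, r v ^ 2 + ∑ v, L x v * r v := by
      rw [← Finset.sum_add_distrib]
      refine Finset.sum_congr rfl fun v _ => ?_
      simp only [hr]; ring
    have h3 : ∑ v, r v ^ 2 = 0 :=
      le_antisymm (by linarith) (Finset.sum_nonneg fun v _ => sq_nonneg _)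
    intro v
    have := (Finset.sum_eq_zero_iff_of_nonneg fun v _ => sq_nonneg _).1 h3 v (Finset.mem_univ v)
    exact pow_eq_zero_iff (two_ne_zero) |>.1 this
  refine ⟨fun s t => if R s t then x s t else 0, fun s t => ?_, fun s t h => ?_, fun v => ?_⟩
  · dsimp only; split_ifs
    · exact hx s t
    · exact le_rfl
  · by_contra hst
    simp [hst] at h
  · have := hr0 v
    simp only [hr, L] at this
    linarith

namespace Network

variable {V A : Type*} [Fintype V] {N : Network V A} {y : V → ℝ}

open ArcGraph

/-! ### Static flows and the dual of the transportation problem -/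

open Classical in
/-- The net amount of a static flow `X` that leaves the node `v`. -/
noncomputable def outflow [Fintype A] (N : Network V A) (X : A → ℝ) (v : V) : ℝ :=
  (∑ a, if N.tail a = v then X a else 0) - ∑ a, if N.head a = v then X a else 0

/-- Summation by parts, the identity behind all duality arguments for static flows below. -/
theorem sum_mul_outflow [Fintype A] (X : A → ℝ) (π : V → ℝ) :
    ∑ v, N.outflow X v * π v = ∑ a, X a * (π (N.tail a) - π (N.head a)) := by
  classical
  simp only [outflow, sub_mul, mul_sub, Finset.sum_sub_distrib, Finset.sum_mul, ite_mul, zero_mul]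
  congr 1 <;> rw [Finset.sum_comm] <;> refine Finset.sum_congr rfl fun a _ => ?_ <;> simp

theorem dualValue_eq_sum (N : Network V A) (y : V → ℝ) : N.dualValue y = ∑ v, N.b v * y v := by
  classical
  have : ∀ v, N.b v * y v =
      (if 0 < N.b v then N.b v * y v else 0) + if N.b v < 0 then N.b v * y v else 0 := by
    intro v
    rcases lt_trichotomy (N.b v) 0 with h | h | h
    · simp [h, h.not_gt]
    · simp [h]
    · simp [h, h.not_gt]
  rw [dualValue, Finset.sum_filter, Finset.sum_filter, ← Finset.sum_add_distrib]
  exact Finset.sum_congr rfl fun v _ => (this v).symm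

theorem IsDualFeasible.le_pathCost [Finite A] (hy : N.IsDualFeasible y) {s t : V} {p : List A}
    (hs : 0 < N.b s) (ht : N.b t < 0) (hp : N.IsPath s t p) : y s - y t ≤ pathCost N.cost p := by
  obtain ⟨q, hq⟩ := N.conservative.exists_isCheapestPath ⟨p, hp⟩
  exact (hy s t _ hs ht ⟨q, hq, rfl⟩).trans (hq.2 p hp)

theorem isDualFeasible_of_potential {π : V → ℝ}
    (hπ : ∀ a, π (N.tail a) - π (N.head a) ≤ N.cost a) : N.IsDualFeasible π := by
  rintro s t x - - ⟨p, hp, rfl⟩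
  exact pathCost_ge_of_potential hπ hp.1

/-- A feasible dual solution extends to a potential on all nodes that is at least as good. -/
theorem IsDualFeasible.exists_potential [Finite A] (hy : N.IsDualFeasible y) :
    ∃ π : V → ℝ, (∀ a, π (N.tail a) - π (N.head a) ≤ N.cost a) ∧
      (∀ v, 0 < N.b v → y v ≤ π v) ∧ ∀ v, N.b v < 0 → π v ≤ y v := by
  classical
  obtain ⟨ρ, -, hρ⟩ := N.conservative.exists_potential (fun _ => 0)
  -- `ρ` bounds the cost of all paths from a node from below. Hence stopping at a node that is not a
  -- sink, at price `M`, is never cheaper than `y s`, and nodes that reach no sink still get a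
  -- finite potential. Stopping at a sink is covered by dual feasibility.
  set M : ℝ := ∑ v, |y v| + ∑ v, |ρ v|
  obtain ⟨π, h1, h2⟩ := N.conservative.exists_potential (fun v => if N.b v < 0 then y v else M)
  refine ⟨π, fun a => ?_, fun s hs => ?_, fun t ht => ?_⟩
  · obtain ⟨w, q, hq, e⟩ := h1 (N.head a)
    have := h2 (N.tail a) w (a :: q) ⟨rfl, hq⟩
    rw [pathCost_cons] at this
    linarith
  · obtain ⟨w, q, hq, e⟩ := h1 s
    rw [e]
    split_ifs with hw
    · linarith [hy.le_pathCost hs hw hq]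
    · have h3 := hρ s w q hq
      have h4 := Finset.single_le_sum (f := fun v => |y v|) (fun i _ => abs_nonneg _)
        (Finset.mem_univ s)
      have h5 := Finset.single_le_sum (f := fun v => |ρ v|) (fun i _ => abs_nonneg _)
        (Finset.mem_univ s)
      have h6 := le_abs_self (y s)
      have h7 := neg_abs_le (ρ s)
      simp only [M]
      linarith
  · have := h2 t t [] rfl
    simpa [ht] using this

/-- Weak duality: replace `y` by a potential that is no worse, sum by parts, and use that reduced
costs are nonnegative. -/
theorem IsDualFeasible.value_le [Fintype A] (hy : N.IsDualFeasible y) {X : A → ℝ}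
    (hX : ∀ a, 0 ≤ X a) (hb : ∀ v, N.outflow X v = N.b v) :
    N.dualValue y ≤ ∑ a, N.cost a * X a := by
  obtain ⟨π, h1, h2, h3⟩ := hy.exists_potential
  calc N.dualValue y = ∑ v, N.b v * y v := N.dualValue_eq_sum y
    _ ≤ ∑ v, N.b v * π v := by
        refine Finset.sum_le_sum fun v _ => ?_
        rcases lt_trichotomy (N.b v) 0 with h | h | h
        · exact mul_le_mul_of_nonpos_left (h3 v h) h.le
        · simp [h]
        · exact mul_le_mul_of_nonneg_left (h2 v h) h.le
    _ = ∑ a, X a * (π (N.tail a) - π (N.head a)) := by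
        rw [← sum_mul_outflow]; exact Finset.sum_congr rfl fun v _ => by rw [hb]
    _ ≤ ∑ a, N.cost a * X a := by
        refine Finset.sum_le_sum fun a _ => ?_
        rw [mul_comm]
        exact mul_le_mul_of_nonneg_right (h1 a) (hX a)

/-- The potential from `IsDualFeasible.exists_potential` is itself dual feasible and at least as
good in every term of the objective. Optimality of `y` forces equality term by term. -/
theorem IsOptimalDual.exists_potential [Finite A] (hy : N.IsOptimalDual y) :
    ∃ π : V → ℝ, (∀ a, π (N.tail a) - π (N.head a) ≤ N.cost a) ∧
      ∀ v, N.b v ≠ 0 → π v = y v := by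
  obtain ⟨π, h1, h2, h3⟩ := hy.1.exists_potential
  refine ⟨π, h1, ?_⟩
  have h4 := hy.2 π (isDualFeasible_of_potential h1)
  rw [dualValue_eq_sum, dualValue_eq_sum] at h4
  have h5 : ∀ v ∈ Finset.univ, N.b v * y v ≤ N.b v * π v := by
    intro v _
    rcases lt_trichotomy (N.b v) 0 with h | h | h
    · exact mul_le_mul_of_nonpos_left (h3 v h) h.le
    · simp [h]
    · exact mul_le_mul_of_nonneg_left (h2 v h) h.le
  intro v hv
  have h6 := (Finset.sum_eq_sum_iff_of_le h5).1 (le_antisymm (Finset.sum_le_sum h5) h4) v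
    (Finset.mem_univ v)
  exact (mul_left_cancel₀ hv h6).symm

/-- Strong duality for the transportation problem: there is a transportation plan on tight pairs. -/
theorem IsOptimalDual.exists_transport (hy : N.IsOptimalDual y) :
    ∃ x : V → V → ℝ, (∀ s t, 0 ≤ x s t) ∧
      (∀ s t, 0 < x s t → 0 < N.b s ∧ N.b t < 0 ∧ N.IsCheapestCost N.cost s t (y s - y t)) ∧
      ∀ v, ∑ t, x v t - ∑ s, x s v = N.b v := by
  refine exists_transport_flow
    (fun s t => 0 < N.b s ∧ N.b t < 0 ∧ N.IsCheapestCost N.cost s t (y s - y t))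
    (fun u v w h h' => h.2.1.not_gt h'.1) N.b fun r hr => ?_
  -- A direction `r` that does not increase along tight pairs can be followed a little way: tight
  -- pairs are harmless by the choice of `r`, and the other pairs have slack. There are finitely
  -- many pairs, so a common `ε` exists, and optimality bounds the gain along `r`.
  have key : ∀ s t, ∀ᶠ ε in nhdsWithin (0 : ℝ) (Ioi 0), 0 < N.b s → N.b t < 0 →
      ∀ x, N.IsCheapestCost N.cost s t x → (y s + ε * r s) - (y t + ε * r t) ≤ x := by
    intro s t
    by_cases h : 0 < N.b s ∧ N.b t < 0 ∧ ∃ x, N.IsCheapestCost N.cost s t x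
    swap
    · exact Filter.Eventually.of_forall fun ε hs ht x hx => absurd ⟨hs, ht, x, hx⟩ h
    obtain ⟨hs, ht, x, hx⟩ := h
    have huniq : ∀ x', N.IsCheapestCost N.cost s t x' → x' = x := by
      rintro x' ⟨p', hp', rfl⟩
      obtain ⟨p, hp, rfl⟩ := hx
      exact le_antisymm (hp'.2 p hp.1) (hp.2 p' hp'.1)
    have hle := hy.1 s t x hs ht hx
    rcases hle.eq_or_lt with h | h
    · have h1 := hr s t ⟨hs, ht, by rwa [h]⟩
      filter_upwards [self_mem_nhdsWithin] with ε hε _ _ x' hx'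
      rw [huniq x' hx']
      have : ε * (r s - r t) ≤ 0 := mul_nonpos_of_nonneg_of_nonpos (le_of_lt hε) h1
      linarith
    · have hc : Filter.Tendsto (fun ε : ℝ => (y s + ε * r s) - (y t + ε * r t))
          (nhdsWithin 0 (Ioi 0)) (nhds ((y s + 0 * r s) - (y t + 0 * r t))) := by
        refine Filter.Tendsto.mono_left (Continuous.tendsto (by fun_prop) 0) nhdsWithin_le_nhds
      have h2 := hc.eventually (gt_mem_nhds (by simpa using h))
      filter_upwards [h2] with ε hε _ _ x' hx'
      rw [huniq x' hx']
      exact hε.le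
  have key' := Filter.eventually_all.2 fun s => Filter.eventually_all.2 (key s)
  obtain ⟨ε, hε, hpos⟩ := (key'.and self_mem_nhdsWithin).exists
  have h1 := hy.2 (fun v => y v + ε * r v) fun s t x hs ht hx => hε s t hs ht x hx
  rw [dualValue_eq_sum, dualValue_eq_sum] at h1
  have h2 : ∑ v, N.b v * (y v + ε * r v) = ∑ v, N.b v * y v + ε * ∑ v, N.b v * r v := by
    rw [Finset.mul_sum, ← Finset.sum_add_distrib]
    exact Finset.sum_congr rfl fun v _ => by ring
  have h3 : ε * ∑ v, N.b v * r v ≤ 0 := by linarith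
  exact nonpos_of_mul_nonpos_right h3 hpos

/-- The transportation plan ships a positive amount out of every source, and does so on tight pairs
only. -/
theorem IsOptimalDual.exists_tight_path (hy : N.IsOptimalDual y) {s : V} (hs : 0 < N.b s) :
    ∃ t p, N.b t < 0 ∧ N.IsPath s t p ∧ pathCost N.cost p = y s - y t := by
  obtain ⟨x, h0, h1, h2⟩ := hy.exists_transport
  by_contra! hcon
  have hz : ∀ t, x s t = 0 := fun t => by
    by_contra hne
    obtain ⟨-, ht, p, hp, e⟩ := h1 s t (lt_of_le_of_ne (h0 s t) (Ne.symm hne))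
    exact hcon t p ht hp.1 e
  have := h2 s
  simp only [hz, Finset.sum_const_zero, zero_sub] at this
  have h3 : 0 ≤ ∑ u, x u s := Finset.sum_nonneg fun u _ => h0 u s
  linarith

/-! ### Paths in the extended network -/

theorem pathCost_map_arc (p : List A) :
    pathCost (N.extCost y) (p.map .arc) = pathCost N.cost p := by
  simp [pathCost, Function.comp_def, extCost]

theorem isPath_map_arc {p : List A} :
    ∀ {v w : V}, N.IsPath v w p → N.extGraph.IsPath (.node v) (.node w) (p.map .arc) := by
  induction p with
  | nil => intro v w h; cases h; rfl
  | cons a p ih => rintro v w ⟨rfl, h⟩; exact ⟨rfl, ih h⟩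

/-- No arc enters the super-source and none leaves the super-sink, so a path can use an artificial
arc only at its two ends. -/
theorem exists_of_extPath_node {q : List (ExtArc A N.sources N.sinks)} :
    ∀ {v : V}, N.extGraph.IsPath (.node v) .superSink q →
      ∃ (t : N.sinks) (p : List A), N.IsPath v t p ∧ q = p.map .arc ++ [.toSuperSink t] := by
  induction q with
  | nil => intro v h; cases h
  | cons e q ih =>
    rintro v ⟨h1, h2⟩
    cases e with
    | arc a =>
      cases h1
      obtain ⟨t, p, hp, rfl⟩ := ih h2
      exact ⟨t, a :: p, ⟨rfl, hp⟩, rfl⟩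
    | fromSuperSource s => cases h1
    | toSuperSink t =>
      cases h1
      cases q with
      | nil => exact ⟨t, [], rfl, rfl⟩
      | cons e q =>
        have h3 := h2.1
        cases e <;> cases h3

theorem exists_of_extPath {q : List (ExtArc A N.sources N.sinks)}
    (hq : N.extGraph.IsPath .superSource .superSink q) :
    ∃ (s : N.sources) (t : N.sinks) (p : List A), N.IsPath s t p ∧
      q = .fromSuperSource s :: (p.map .arc ++ [.toSuperSink t]) := by
  cases q with
  | nil => cases hq
  | cons e q =>
    obtain ⟨h1, h2⟩ := hq
    cases e with
    | arc a => cases h1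
    | toSuperSink t => cases h1
    | fromSuperSource s =>
      obtain ⟨t, p, hp, rfl⟩ := exists_of_extPath_node h2
      exact ⟨s, t, p, hp, rfl⟩

theorem extPath_of_isPath {s : N.sources} {t : N.sinks} {p : List A} (hp : N.IsPath s t p) :
    N.extGraph.IsPath .superSource .superSink
      (.fromSuperSource s :: (p.map .arc ++ [.toSuperSink t])) :=
  ⟨rfl, (isPath_map_arc hp).append ⟨rfl, rfl⟩⟩

theorem pathCost_extPath (s : N.sources) (t : N.sinks) (p : List A) :
    pathCost (N.extCost y) (.fromSuperSource s :: (p.map .arc ++ [.toSuperSink t])) =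
      -y s + pathCost N.cost p + y t := by
  rw [pathCost_cons, pathCost_append, pathCost_map_arc]
  simp [extCost]
  ring

theorem IsDualFeasible.extCost_nonneg [Finite A] (hy : N.IsDualFeasible y)
    {q : List (ExtArc A N.sources N.sinks)} (hq : N.extGraph.IsPath .superSource .superSink q) :
    0 ≤ pathCost (N.extCost y) q := by
  obtain ⟨s, t, p, hp, rfl⟩ := exists_of_extPath hq
  rw [pathCost_extPath]
  linarith [hy.le_pathCost s.2 t.2 hp]

/-- All paths in the extended network cost at least zero, so one of cost at most zero is cheapest.
-/
theorem IsDualFeasible.mem_cheapestArcs [Fintype A] (hy : N.IsDualFeasible y) {a : A} {s t : V}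
    {p : List A} (hs : 0 < N.b s) (ht : N.b t < 0) (hp : N.IsPath s t p)
    (hle : pathCost N.cost p ≤ y s - y t) (ha : a ∈ p) : a ∈ N.cheapestArcs y := by
  classical
  rw [cheapestArcs, Finset.mem_filter]
  refine ⟨Finset.mem_univ _, _, ⟨extPath_of_isPath (s := ⟨s, hs⟩) (t := ⟨t, ht⟩) hp,
    fun q hq => ?_⟩, ?_⟩
  · rw [pathCost_extPath]
    have := hy.extCost_nonneg hq
    simp only
    linarith
  · simp [ha]

/-- Dual feasibility bounds the cost of paths in the extended network by zero from below, and
`IsOptimalDual.exists_tight_path` shows that zero is attained. Since paths may repeat nodes, any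
path to the tail can be joined with any path from the head, so the two parts can be minimized
separately. Step 3 evaluates exactly this test. -/
theorem IsOptimalDual.mem_cheapestArcs_iff [Fintype A] (hy : N.IsOptimalDual y) {a : A} :
    a ∈ N.cheapestArcs y ↔ ∃ s t p q, 0 < N.b s ∧ N.b t < 0 ∧ N.IsPath s (N.tail a) p ∧
      N.IsPath (N.head a) t q ∧
      (-y s + pathCost N.cost p) + N.cost a + (pathCost N.cost q + y t) ≤ 0 := by
  classical
  constructor
  · intro ha
    rw [cheapestArcs, Finset.mem_filter] at ha
    obtain ⟨-, q, ⟨hq, hmin⟩, haq⟩ := ha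
    obtain ⟨s, t, p, hp, rfl⟩ := exists_of_extPath hq
    have hap : a ∈ p := by simpa using haq
    obtain ⟨p₁, p₂, rfl⟩ := List.append_of_mem hap
    obtain ⟨u, h1, h2, h3⟩ := isPath_append.1 hp
    obtain rfl : N.tail a = u := h2
    obtain ⟨t', p', ht', hp', e⟩ := hy.exists_tight_path s.2
    have h4 := hmin _ (extPath_of_isPath (s := s) (t := ⟨t', ht'⟩) hp')
    rw [pathCost_extPath, pathCost_extPath, pathCost_append, pathCost_cons, e] at h4
    simp only at h4
    exact ⟨s, t, p₁, p₂, s.2, t.2, h1, h3, by linarith⟩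
  · rintro ⟨s, t, p, q, hs, ht, hp, hq, hle⟩
    refine hy.1.mem_cheapestArcs hs ht (hp.append (q := a :: q) ⟨rfl, hq⟩) ?_ (by simp)
    rw [pathCost_append, pathCost_cons]
    linarith

end Network

namespace Network

variable {V A : Type*} [Fintype V] {N : Network V A} {y : V → ℝ}

open ArcGraph

/-! ### The static flow of a transshipment over time -/

/-- The total amount of flow that enters an arc. -/
noncomputable def total (N : Network V A) (θ : ℝ) (f : A → ℝ → ℝ) (a : A) : ℝ :=
  ∫ t in Ico 0 (θ - N.transit a), f a t

section

variable [Fintype A] {M : FlowModel} {θ : ℝ} {f : A → ℝ → ℝ}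

theorem IsTransshipment.nonneg' (hf : N.IsTransshipment M θ f) (a : A) (t : ℝ) : 0 ≤ f a t := by
  by_cases h : t ∈ Ico 0 (θ - N.transit a)
  · exact hf.nonneg a t h
  · rw [hf.zero_outside a t h]

theorem IsTransshipment.integrableOn (hf : N.IsTransshipment M θ f) (a : A) :
    IntegrableOn (f a) (Ico 0 (θ - N.transit a)) := by
  refine Integrable.of_bound (hf.measurable a).aestronglyMeasurable (N.cap a) ?_
  refine (ae_restrict_mem measurableSet_Ico).mono fun t ht => ?_
  rw [Real.norm_eq_abs, abs_of_nonneg (hf.nonneg a t ht)]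
  exact hf.le_cap a t ht

theorem IsTransshipment.integrable (hf : N.IsTransshipment M θ f) (a : A) :
    Integrable (f a) :=
  (integrableOn_iff_integrable_of_support_subset fun t ht => by
    by_contra h; exact ht (hf.zero_outside a t h)).1 (hf.integrableOn a)

theorem IsTransshipment.total_eq (hf : N.IsTransshipment M θ f) (a : A) :
    ∫ t in Ico 0 θ, f a t = N.total θ f a := by
  refine (setIntegral_eq_of_subset_of_forall_sdiff_eq_zero measurableSet_Ico
    (Ico_subset_Ico_right (by linarith [N.transit_nonneg a])) fun t ht => ?_)
  exact hf.zero_outside a t ht.2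

theorem IsTransshipment.total_nonneg (hf : N.IsTransshipment M θ f) (a : A) :
    0 ≤ N.total θ f a :=
  setIntegral_nonneg measurableSet_Ico fun t _ => hf.nonneg' a t

theorem IsTransshipment.outflow_total (hf : N.IsTransshipment M θ f) (v : V) :
    N.outflow (N.total θ f) v = N.b v := by
  classical
  have h := hf.balance v
  rw [excess] at h
  have e : ∀ a, (if N.tail a = v then ∫ t in Ico 0 θ, f a t else 0) =
      if N.tail a = v then N.total θ f a else 0 := fun a => by rw [hf.total_eq]
  simp only [e] at h
  rw [outflow]
  simp only [total] at *
  linarith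

theorem flowCost_eq (N : Network V A) (θ : ℝ) (f : A → ℝ → ℝ) :
    N.flowCost θ f = ∑ a, N.cost a * N.total θ f a := rfl

theorem IsTransshipment.dualValue_le (hf : N.IsTransshipment M θ f) (hy : N.IsDualFeasible y) :
    N.dualValue y ≤ N.flowCost θ f :=
  hy.value_le hf.total_nonneg hf.outflow_total

/-- An arc that carries no flow in total carries no flow up to any point in time. -/
theorem IsTransshipment.integral_eq_zero (hf : N.IsTransshipment M θ f) {a : A}
    (ha : N.total θ f a = 0) (ξ : ℝ) : ∫ t in Ico 0 ξ, f a t = 0 := by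
  refine le_antisymm ?_ (setIntegral_nonneg measurableSet_Ico fun t _ => hf.nonneg' a t)
  have h1 : ∫ t in Ico 0 ξ, f a t ≤ ∫ t, f a t :=
    setIntegral_le_integral (hf.integrable a) (Filter.Eventually.of_forall (hf.nonneg' a))
  have h2 : ∫ t, f a t = N.total θ f a :=
    (setIntegral_eq_integral_of_forall_compl_eq_zero fun t ht => hf.zero_outside a t ht).symm
  linarith

end

/-! ### Restriction and extension -/

theorem sum_restrict {A : Type*} [Fintype A] {S : Finset A} (g : A → ℝ) (h : ∀ a ∉ S, g a = 0) :
    ∑ a : S, g a = ∑ a, g a := by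
  rw [Finset.sum_coe_sort]
  exact Finset.sum_subset (Finset.subset_univ S) fun a _ ha => h a ha

theorem extendFlow_coe {S : Finset A} (f : S → ℝ → ℝ) (a : S) : extendFlow S f a = f a := by
  funext t
  simp [extendFlow]

theorem extendFlow_of_notMem {S : Finset A} (f : S → ℝ → ℝ) {a : A} (ha : a ∉ S) : extendFlow S f a = 0 := by
  funext t
  simp [extendFlow, ha]

section

variable [Fintype A] {M : FlowModel} {θ : ℝ} {S : Finset A}

/-- The hypothesis concerns only deleted arcs incident with `v`, because
`IsOptimalDual.exists_restrict` also deletes arcs that carry flow elsewhere. -/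
theorem excess_restrict (f : A → ℝ → ℝ) (v : V) (ξ : ℝ)
    (h : ∀ a ∉ S, N.head a = v ∨ N.tail a = v → ∀ ζ, ∫ t in Ico 0 ζ, f a t = 0) :
    (N.restrict S).excess (fun a => f a) v ξ = N.excess f v ξ := by
  classical
  simp only [excess, restrict, ArcGraph.restrict]
  congr 1
  · refine sum_restrict (fun a => if N.head a = v then ∫ t in Ico 0 (ξ - N.transit a), f a t else 0)
      fun a ha => ?_
    split_ifs with hv
    · exact h a ha (Or.inl hv) _
    · rfl
  · refine sum_restrict (fun a => if N.tail a = v then ∫ t in Ico 0 ξ, f a t else 0)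
      fun a ha => ?_
    split_ifs with hv
    · exact h a ha (Or.inr hv) _
    · rfl

theorem excess_extendFlow (f : S → ℝ → ℝ) (v : V) (ξ : ℝ) :
    N.excess (extendFlow S f) v ξ = (N.restrict S).excess f v ξ := by
  rw [← excess_restrict (S := S)]
  · simp only [extendFlow_coe]
  · intro a ha _ ζ
    simp [extendFlow_of_notMem f ha]

theorem IsTransshipment.extend {f : S → ℝ → ℝ} (hf : (N.restrict S).IsTransshipment M θ f) :
    N.IsTransshipment M θ (extendFlow S f) where
  horizon_nonneg := hf.horizon_nonneg
  measurable a := by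
    by_cases ha : a ∈ S
    · have := extendFlow_coe f ⟨a, ha⟩
      simp only at this
      rw [this]
      exact hf.measurable ⟨a, ha⟩
    · rw [extendFlow_of_notMem f ha]
      exact aemeasurable_const
  zero_outside a t ht := by
    by_cases ha : a ∈ S
    · have := extendFlow_coe f ⟨a, ha⟩
      simp only at this
      rw [this]
      exact hf.zero_outside ⟨a, ha⟩ t ht
    · rw [extendFlow_of_notMem f ha]; rfl
  nonneg a t ht := by
    by_cases ha : a ∈ S
    · have := extendFlow_coe f ⟨a, ha⟩
      simp only at this
      rw [this]
      exact hf.nonneg ⟨a, ha⟩ t ht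
    · rw [extendFlow_of_notMem f ha]; exact le_rfl
  le_cap a t ht := by
    by_cases ha : a ∈ S
    · have := extendFlow_coe f ⟨a, ha⟩
      simp only at this
      rw [this]
      exact hf.le_cap ⟨a, ha⟩ t ht
    · rw [extendFlow_of_notMem f ha]; exact (N.cap_pos a).le
  no_deficit v hv ξ hξ := by rw [excess_extendFlow]; exact hf.no_deficit v hv ξ hξ
  no_storage hM v hv ξ hξ := by rw [excess_extendFlow]; exact hf.no_storage hM v hv ξ hξ
  no_overdraft hM v hv ξ hξ := by rw [excess_extendFlow]; exact hf.no_overdraft hM v hv ξ hξ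
  balance v := by rw [excess_extendFlow]; exact hf.balance v

/-- The total cost of a flow over time is the dual objective value if flow travels on tight arcs
only. -/
theorem IsTransshipment.flowCost_eq_of_tight {f : A → ℝ → ℝ} (hf : N.IsTransshipment M θ f)
    {π : V → ℝ} (hπ : ∀ v, N.b v ≠ 0 → π v = y v)
    (h : ∀ a, 0 < N.total θ f a → π (N.tail a) - π (N.head a) = N.cost a) :
    N.flowCost θ f = N.dualValue y := by
  have e1 : N.dualValue y = ∑ v, N.outflow (N.total θ f) v * π v := by
    rw [dualValue_eq_sum]
    refine Finset.sum_congr rfl fun v _ => ?_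
    rw [hf.outflow_total]
    by_cases hv : N.b v = 0
    · simp [hv]
    · rw [hπ v hv]
  rw [e1, sum_mul_outflow, flowCost_eq]
  refine Finset.sum_congr rfl fun a _ => ?_
  rcases (hf.total_nonneg a).eq_or_lt with h0 | h0
  · simp [← h0]
  · rw [h a h0, mul_comm]

/-- Complementary slackness: equality in weak duality is equality in every summand, and the positive
flow value can be cancelled. -/
theorem IsTransshipment.tight_of_flowCost_le {f : A → ℝ → ℝ} (hf : N.IsTransshipment M θ f)
    {π : V → ℝ} (hfeas : ∀ a, π (N.tail a) - π (N.head a) ≤ N.cost a)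
    (hπ : ∀ v, N.b v ≠ 0 → π v = y v) (h : N.flowCost θ f ≤ N.dualValue y) {a : A}
    (ha : 0 < N.total θ f a) : π (N.tail a) - π (N.head a) = N.cost a := by
  have e1 : N.dualValue y = ∑ v, N.outflow (N.total θ f) v * π v := by
    rw [dualValue_eq_sum]
    refine Finset.sum_congr rfl fun v _ => ?_
    rw [hf.outflow_total]
    by_cases hv : N.b v = 0
    · simp [hv]
    · rw [hπ v hv]
  rw [e1, sum_mul_outflow, flowCost_eq] at h
  have h1 : ∀ a ∈ Finset.univ, N.total θ f a * (π (N.tail a) - π (N.head a)) ≤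
      N.cost a * N.total θ f a := fun a _ => by
    rw [mul_comm]; exact mul_le_mul_of_nonneg_right (hfeas a) (hf.total_nonneg a)
  have h2 := (Finset.sum_eq_sum_iff_of_le h1).1 (le_antisymm (Finset.sum_le_sum h1) h) a
    (Finset.mem_univ a)
  rw [mul_comm] at h2
  exact mul_right_cancel₀ ha.ne' h2

end

/-! ### Flows over time along paths -/

/-- Flow of rate `r` along a path, entering the path during the time interval `[σ, σ + T)`. -/
noncomputable def pathFlow [DecidableEq A] (N : Network V A) (r T : ℝ) :
    List A → ℝ → A → ℝ → ℝ
  | [], _, _, _ => 0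
  | a :: p, σ, a', t =>
      (if a' = a then (Ico σ (σ + T)).indicator (fun _ => r) t else 0) +
        N.pathFlow r T p (σ + N.transit a) a' t

/-- The amount of flow that has passed a point up to time `ξ`. -/
noncomputable def passed (r T σ ξ : ℝ) : ℝ :=
  ∫ t in Ico 0 ξ, (Ico σ (σ + T)).indicator (fun _ => r) t

theorem passed_eq {r T σ ξ : ℝ} (hσ : 0 ≤ σ) :
    passed r T σ ξ = max 0 (min ξ (σ + T) - σ) * r := by
  rw [passed, setIntegral_indicator measurableSet_Ico, Ico_inter_Ico, setIntegral_const,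
    smul_eq_mul, Real.volume_real_Ico, max_eq_right hσ, max_comm]

/-- What has entered an arc by time `ξ - τ` is what has left it by time `ξ`; this makes the excess
telescope along a path. -/
theorem passed_shift {r T σ ξ τ : ℝ} (hσ : 0 ≤ σ) (hτ : 0 ≤ τ) :
    passed r T σ (ξ - τ) = passed r T (σ + τ) ξ := by
  rw [passed_eq hσ, passed_eq (by linarith)]
  congr 2
  rw [show σ + τ + T = (σ + T) + τ by ring, ← sub_sub, ← min_sub_sub_right, sub_right_comm,
    ← min_sub_sub_right]
  rw [← min_sub_sub_right]
  congr 1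
  ring

theorem passed_nonneg {r T σ ξ : ℝ} (hσ : 0 ≤ σ) (hr : 0 ≤ r) : 0 ≤ passed r T σ ξ := by
  rw [passed_eq hσ]; positivity

theorem passed_le {r T σ ξ : ℝ} (hσ : 0 ≤ σ) (hr : 0 ≤ r) (hT : 0 ≤ T) :
    passed r T σ ξ ≤ T * r := by
  rw [passed_eq hσ]
  refine mul_le_mul_of_nonneg_right (max_le hT ?_) hr
  linarith [min_le_right ξ (σ + T)]

theorem passed_eq_of_le {r T σ ξ : ℝ} (hσ : 0 ≤ σ) (hT : 0 ≤ T) (h : σ + T ≤ ξ) :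
    passed r T σ ξ = T * r := by
  rw [passed_eq hσ, min_eq_right h, add_sub_cancel_left, max_eq_right hT]

/-- The total transit time of a path. -/
def pathTransit (N : Network V A) (p : List A) : ℝ := (p.map N.transit).sum

theorem pathTransit_nonneg (p : List A) : 0 ≤ N.pathTransit p :=
  List.sum_nonneg fun x hx => by
    obtain ⟨a, -, rfl⟩ := List.mem_map.1 hx
    exact N.transit_nonneg a

section

variable [DecidableEq A] {r T : ℝ}

theorem measurable_pathFlow (p : List A) : ∀ (σ : ℝ) (a : A),
    Measurable (N.pathFlow r T p σ a) := by
  induction p with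
  | nil => intro σ a; exact measurable_const
  | cons b p ih =>
    intro σ a
    refine Measurable.add ?_ (ih _ a)
    by_cases h : a = b
    · simp only [h, if_true]
      exact measurable_const.indicator measurableSet_Ico
    · simp only [h, if_false]
      exact measurable_const

theorem pathFlow_nonneg (hr : 0 ≤ r) (p : List A) : ∀ (σ : ℝ) (a : A) (t : ℝ),
    0 ≤ N.pathFlow r T p σ a t := by
  induction p with
  | nil => intro σ a t; exact le_rfl
  | cons b p ih =>
    intro σ a t
    refine add_nonneg ?_ (ih _ a t)
    split_ifs
    · exact indicator_nonneg (fun _ _ => hr) _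
    · exact le_rfl

/-- The factor `p.length` is needed since a path may use the same arc repeatedly, with overlapping
time intervals. -/
theorem pathFlow_le (hr : 0 ≤ r) (p : List A) : ∀ (σ : ℝ) (a : A) (t : ℝ),
    N.pathFlow r T p σ a t ≤ p.length * r := by
  induction p with
  | nil => intro σ a t; simp [pathFlow]
  | cons b p ih =>
    intro σ a t
    have h1 := ih (σ + N.transit b) a t
    have h2 : (if a = b then (Ico σ (σ + T)).indicator (fun _ => r) t else 0) ≤ r := by
      split_ifs
      · exact indicator_le_self' (fun _ _ => hr) t
      · exact hr
    simp only [pathFlow, List.length_cons, Nat.cast_add, Nat.cast_one]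
    linarith

theorem pathFlow_eq_zero {p : List A} : ∀ {σ θ : ℝ} {a : A} {t : ℝ}, 0 ≤ σ →
    σ + T + N.pathTransit p ≤ θ → t ∉ Ico 0 (θ - N.transit a) → N.pathFlow r T p σ a t = 0 := by
  induction p with
  | nil => intros; rfl
  | cons b p ih =>
    intro σ θ a t hσ hθ ht
    have hp := N.pathTransit_nonneg p
    have e : N.pathTransit (b :: p) = N.transit b + N.pathTransit p := by simp [pathTransit]
    rw [e] at hθ
    have h1 := ih (σ := σ + N.transit b) (by linarith [N.transit_nonneg b]) (by linarith) ht
    rw [pathFlow, h1, add_zero]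
    split_ifs with hab
    · subst hab
      refine indicator_of_notMem (fun hmem => ht ⟨hσ.trans hmem.1, ?_⟩) _
      linarith [hmem.2]
    · rfl

theorem integrableOn_pathFlow (hr : 0 ≤ r) (p : List A) (σ : ℝ) (a : A) (ξ : ℝ) :
    IntegrableOn (N.pathFlow r T p σ a) (Ico 0 ξ) := by
  refine Measure.integrableOn_of_bounded (M := p.length * r) (by simp)
    (measurable_pathFlow p σ a).aestronglyMeasurable ?_
  refine Filter.Eventually.of_forall fun t => ?_
  rw [Real.norm_eq_abs, abs_of_nonneg (pathFlow_nonneg hr p σ a t)]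
  exact pathFlow_le hr p σ a t

-- Flow that leaves an arc enters the next one at once, so the contributions at inner nodes cancel
-- by `passed_shift` and only the two ends of the path remain.
open Classical in
theorem excess_pathFlow [Fintype A] (hr : 0 ≤ r) (u : V) (ξ : ℝ) (p : List A) :
    ∀ {v w : V} {σ : ℝ}, 0 ≤ σ → N.IsPath v w p →
      N.excess (N.pathFlow r T p σ) u ξ =
        (if w = u then passed r T (σ + N.pathTransit p) ξ else 0) -
          if v = u then passed r T σ ξ else 0 := by
  induction p with
  | nil => intro v w σ hσ h; cases h; simp [excess, pathFlow, pathTransit]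
  | cons b p ih =>
    rintro v w σ hσ ⟨rfl, h⟩
    have e : N.pathTransit (b :: p) = N.transit b + N.pathTransit p := by simp [pathTransit]
    have hσ' : 0 ≤ σ + N.transit b := by linarith [N.transit_nonneg b]
    have hint : ∀ a ζ, ∫ t in Ico 0 ζ, N.pathFlow r T (b :: p) σ a t =
        (if a = b then passed r T σ ζ else 0) +
          ∫ t in Ico 0 ζ, N.pathFlow r T p (σ + N.transit b) a t := by
      intro a ζ
      simp only [pathFlow]
      rw [integral_add _ (integrableOn_pathFlow hr p _ a ζ)]
      · congr 1
        split_ifs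
        · rfl
        · simp
      · split_ifs
        · exact (integrableOn_const (by simp)).indicator measurableSet_Ico
        · exact integrableOn_zero
    have h1 := ih hσ' h
    rw [excess] at h1 ⊢
    simp only [hint]
    have split : ∀ (P : A → Prop) [DecidablePred P] (g k : A → ℝ),
        (∑ a, if P a then (if a = b then g a else 0) + k a else 0) =
          (if P b then g b else 0) + ∑ a, if P a then k a else 0 := by
      intro P _ g k
      have : ∀ a, (if P a then (if a = b then g a else 0) + k a else 0) =
          (if a = b then (if P a then g a else 0) else 0) + if P a then k a else 0 := by
        intro a; split_ifs <;> simp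
      simp only [this, Finset.sum_add_distrib, Finset.sum_ite_eq', Finset.mem_univ, if_true]
    rw [split (fun a => N.head a = u), split (fun a => N.tail a = u),
      passed_shift hσ (N.transit_nonneg b), e, ← add_assoc]
    linarith

end

end Network

/-! ### Correctness of the algorithm -/

namespace Network

variable {V A : Type*} [Fintype V] [Fintype A] {N : Network V A} {y : V → ℝ} {M : FlowModel}

open ArcGraph

theorem excess_sum {ι : Type*} (I : Finset ι) (g : ι → A → ℝ → ℝ)
    (hg : ∀ i ∈ I, ∀ a ξ, IntegrableOn (g i a) (Ico 0 ξ)) (v : V) (ξ : ℝ) :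
    N.excess (fun a t => ∑ i ∈ I, g i a t) v ξ = ∑ i ∈ I, N.excess (g i) v ξ := by
  classical
  have h : ∀ a ζ, ∫ t in Ico 0 ζ, ∑ i ∈ I, g i a t = ∑ i ∈ I, ∫ t in Ico 0 ζ, g i a t :=
    fun a ζ => integral_finsetSum I fun i hi => hg i hi a ζ
  simp only [excess, h, Finset.sum_sub_distrib]
  congr 1 <;> rw [Finset.sum_comm] <;> refine Finset.sum_congr rfl fun a _ => ?_ <;>
    split_ifs <;> simp

/-- Sending flow along paths at a small constant rate yields a transshipment over time. -/
theorem feasible_of_paths (x : V → V → ℝ) (P : V → V → List A) (hx : ∀ s t, 0 ≤ x s t)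
    (hP : ∀ s t, 0 < x s t → 0 < N.b s ∧ N.b t < 0 ∧ N.IsPath s t (P s t))
    (hb : ∀ v, ∑ t, x v t - ∑ s, x s v = N.b v) : N.Feasible M := by
  classical
  let I : Finset (V × V) := Finset.univ.filter fun z => 0 < x z.1 z.2
  have hI : ∀ z ∈ I, 0 < x z.1 z.2 := fun z hz => (Finset.mem_filter.1 hz).2
  let D : A → ℝ := fun a => (∑ z ∈ I, (P z.1 z.2).length * x z.1 z.2) / N.cap a
  have hD : ∀ a, 0 ≤ D a := fun a => div_nonneg
    (Finset.sum_nonneg fun z _ => mul_nonneg (Nat.cast_nonneg _) (hx _ _)) (N.cap_pos a).le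
  -- Spreading each shipment evenly over time `T` gives rates `x / T`. For `T ≥ D a` their worst
  -- case sum on arc `a`, counting every arc position of every path, respects the capacity.
  obtain ⟨T, hT, hTD⟩ : ∃ T : ℝ, 0 < T ∧ ∀ a, D a ≤ T :=
    ⟨1 + ∑ a, D a, by have := Finset.sum_nonneg fun a (_ : a ∈ Finset.univ) => hD a; linarith,
      fun a => by
        have := Finset.single_le_sum (fun a _ => hD a) (Finset.mem_univ a); linarith⟩
  -- A crude horizon suffices: the sum of all transit times exceeds that of each single path.
  set θ : ℝ := T + ∑ z ∈ I, N.pathTransit (P z.1 z.2) with hθ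
  have hθ' : ∀ z ∈ I, 0 + T + N.pathTransit (P z.1 z.2) ≤ θ := fun z hz => by
    have := Finset.single_le_sum (fun z _ => N.pathTransit_nonneg (P z.1 z.2)) hz
    linarith
  let g : V × V → A → ℝ → ℝ := fun z => N.pathFlow (x z.1 z.2 / T) T (P z.1 z.2) 0
  have hr : ∀ z : V × V, 0 ≤ x z.1 z.2 / T := fun z => div_nonneg (hx _ _) hT.le
  have hTr : ∀ z : V × V, T * (x z.1 z.2 / T) = x z.1 z.2 := fun z => mul_div_cancel₀ _ hT.ne'
  have hex : ∀ v ξ, N.excess (fun a t => ∑ z ∈ I, g z a t) v ξ = ∑ z ∈ I,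
      ((if z.2 = v then passed (x z.1 z.2 / T) T (0 + N.pathTransit (P z.1 z.2)) ξ else 0) -
        if z.1 = v then passed (x z.1 z.2 / T) T 0 ξ else 0) := by
    intro v ξ
    rw [excess_sum I g fun z _ a ξ => integrableOn_pathFlow (hr z) _ _ a ξ]
    refine Finset.sum_congr rfl fun z hz => ?_
    rw [excess_pathFlow (hr z) v ξ _ le_rfl (hP _ _ (hI z hz)).2.2]
  have hsum : ∀ F : V → V → ℝ, (∀ s t, x s t = 0 → F s t = 0) →
      ∑ z ∈ I, F z.1 z.2 = ∑ s, ∑ t, F s t := by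
    intro F hF
    rw [← Finset.sum_product', Finset.univ_product_univ]
    refine Finset.sum_subset (Finset.subset_univ I) fun z _ hz => hF _ _ ?_
    by_contra hne
    exact hz (Finset.mem_filter.2
      ⟨Finset.mem_univ _, lt_of_le_of_ne (hx _ _) (Ne.symm hne)⟩)
  have htau : ∀ z : V × V, 0 ≤ 0 + N.pathTransit (P z.1 z.2) := fun z => by
    rw [zero_add]; exact N.pathTransit_nonneg _
  -- No flow waits at an intermediate node, and no source ever sends more than its total shipment.
  -- The same flow therefore serves all four models.
  refine ⟨θ, fun a t => ∑ z ∈ I, g z a t, ?_, fun a => ?_, fun a t ht => ?_, fun a t _ => ?_,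
    fun a t _ => ?_, fun v hv ξ _ => ?_, fun _ v hv ξ _ => ?_, fun _ v hv ξ _ => ?_, fun v => ?_⟩
  · have := Finset.sum_nonneg fun z (_ : z ∈ I) => N.pathTransit_nonneg (P z.1 z.2)
    linarith
  · exact (Finset.measurable_sum I fun z _ => measurable_pathFlow _ _ a).aemeasurable
  · exact Finset.sum_eq_zero fun z hz => pathFlow_eq_zero le_rfl (hθ' z hz) ht
  · exact Finset.sum_nonneg fun z _ => pathFlow_nonneg (hr z) _ _ a t
  · calc ∑ z ∈ I, g z a t ≤ ∑ z ∈ I, (P z.1 z.2).length * (x z.1 z.2 / T) :=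
          Finset.sum_le_sum fun z _ => pathFlow_le (hr z) _ _ a t
      _ = D a * N.cap a / T := by
          rw [div_mul_cancel₀ _ (N.cap_pos a).ne', Finset.sum_div]
          exact Finset.sum_congr rfl fun z _ => by ring
      _ ≤ N.cap a := by
          rw [div_le_iff₀ hT, mul_comm]
          exact mul_le_mul_of_nonneg_left (hTD a) (N.cap_pos a).le
  · rw [hex]
    refine Finset.sum_nonneg fun z hz => ?_
    have h1 : z.1 ≠ v := by rintro rfl; exact hv.not_gt (hP _ _ (hI z hz)).1
    rw [if_neg h1, sub_zero]
    split_ifs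
    · exact passed_nonneg (htau z) (hr z)
    · exact le_rfl
  · rw [hex]
    refine Finset.sum_eq_zero fun z hz => ?_
    have h1 : z.1 ≠ v := by rintro rfl; exact (hP _ _ (hI z hz)).1.ne' hv
    have h2 : z.2 ≠ v := by rintro rfl; exact (hP _ _ (hI z hz)).2.1.ne hv
    rw [if_neg h1, if_neg h2, sub_zero]
  · rw [hex]
    have h0 : ∑ s, x s v = 0 := Finset.sum_eq_zero fun s _ => by
      by_contra hne
      exact (hP s v (lt_of_le_of_ne (hx _ _) (Ne.symm hne))).2.1.not_gt hv
    have h1 : N.b v = ∑ z ∈ I, if z.1 = v then x z.1 z.2 else 0 := by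
      rw [hsum (fun s t => if s = v then x s t else 0) fun s t h => by simp [h], ← hb v, h0,
        sub_zero]
      symm
      rw [Finset.sum_eq_single v]
      · simp
      · intro s _ hs; simp [hs]
      · simp
    rw [h1, ← Finset.sum_neg_distrib]
    refine Finset.sum_le_sum fun z hz => ?_
    have h2 : z.2 ≠ v := by rintro rfl; exact (hP _ _ (hI z hz)).2.1.not_gt hv
    rw [if_neg h2, zero_sub]
    split_ifs
    · have := passed_le (ξ := ξ) le_rfl (hr z) hT.le
      rw [hTr] at this
      linarith
    · exact le_rfl
  · rw [hex]
    have h1 : ∀ z ∈ I,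
      ((if z.2 = v then passed (x z.1 z.2 / T) T (0 + N.pathTransit (P z.1 z.2)) θ else 0) -
        if z.1 = v then passed (x z.1 z.2 / T) T 0 θ else 0) =
        (if z.2 = v then x z.1 z.2 else 0) - if z.1 = v then x z.1 z.2 else 0 := by
      intro z hz
      have := hθ' z hz
      have h2 := N.pathTransit_nonneg (P z.1 z.2)
      rw [passed_eq_of_le (htau z) hT.le (by linarith),
        passed_eq_of_le le_rfl hT.le (by linarith), hTr]
    rw [Finset.sum_congr rfl h1, hsum (fun s t => (if t = v then x s t else 0) -
      if s = v then x s t else 0) fun s t h => by simp [h], ← hb v]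
    simp only [Finset.sum_sub_distrib, Finset.sum_ite_eq', Finset.mem_univ, if_true]
    rw [neg_sub]
    congr 1
    rw [Finset.sum_eq_single v]
    · simp
    · intro s _ hs; simp [hs]
    · simp

theorem IsOptimalDual.feasible_restrict (hy : N.IsOptimalDual y) :
    (N.restrict (N.cheapestArcs y)).Feasible M := by
  obtain ⟨x, h0, h1, h2⟩ := hy.exists_transport
  have key : ∀ s t, ∃ p : List (N.cheapestArcs y), 0 < x s t → 0 < N.b s ∧ N.b t < 0 ∧
      (N.restrict (N.cheapestArcs y)).IsPath s t p := by
    intro s t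
    by_cases hx : 0 < x s t
    · obtain ⟨hs, ht, p, hp, e⟩ := h1 s t hx
      obtain ⟨q, hq, -⟩ := hp.1.exists_lift
        fun a ha => hy.1.mem_cheapestArcs hs ht hp.1 e.le ha
      exact ⟨q, fun _ => ⟨hs, ht, hq⟩⟩
    · exact ⟨[], fun h => absurd h hx⟩
  choose P hP using key
  exact feasible_of_paths x P h0 hP h2

/-- The two partial paths and the arc each cost at least their potential difference, and these
differences sum to `y s - y t`. Since the whole path costs no more than that, equality holds
throughout. -/
theorem IsOptimalDual.tight_of_mem_cheapestArcs (hy : N.IsOptimalDual y) {π : V → ℝ}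
    (hfeas : ∀ a, π (N.tail a) - π (N.head a) ≤ N.cost a)
    (hπ : ∀ v, N.b v ≠ 0 → π v = y v) {a : A} (ha : a ∈ N.cheapestArcs y) :
    π (N.tail a) - π (N.head a) = N.cost a := by
  obtain ⟨s, t, p, q, hs, ht, hp, hq, hle⟩ := hy.mem_cheapestArcs_iff.1 ha
  have h1 := pathCost_ge_of_potential hfeas hp
  have h2 := pathCost_ge_of_potential hfeas hq
  rw [hπ s hs.ne'] at h1
  rw [hπ t ht.ne] at h2
  linarith [hfeas a]

theorem IsOptimalDual.flowCost_extendFlow (hy : N.IsOptimalDual y) {θ : ℝ}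
    {f : N.cheapestArcs y → ℝ → ℝ} (hf : (N.restrict (N.cheapestArcs y)).IsTransshipment M θ f) :
    N.flowCost θ (extendFlow _ f) = N.dualValue y := by
  obtain ⟨π, h1, h2⟩ := hy.exists_potential
  refine hf.extend.flowCost_eq_of_tight h2 fun a ha => ?_
  refine hy.tight_of_mem_cheapestArcs h1 h2 ?_
  by_contra hna
  simp [total, extendFlow_of_notMem f hna] at ha

theorem IsOptimalDual.isMinCost_extendFlow (hy : N.IsOptimalDual y) {θ : ℝ}
    {f : N.cheapestArcs y → ℝ → ℝ} (hf : (N.restrict (N.cheapestArcs y)).IsTransshipment M θ f) :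
    N.IsMinCost M θ (extendFlow _ f) :=
  ⟨hf.extend, fun _ _ hf' => by
    rw [hy.flowCost_extendFlow hf]; exact hf'.dualValue_le hy.1⟩

/-- If no flow leaves the set `S` and the total supply of `S` is nonnegative, then no flow enters
`S`, and the total supply of `S` is zero. -/
theorem no_inflow_of_no_outflow {X : A → ℝ} (hX : ∀ a, 0 ≤ X a)
    (hb : ∀ v, N.outflow X v = N.b v) (S : Set V)
    [DecidablePred (· ∈ S)] (h1 : ∀ a, 0 < X a → N.tail a ∈ S → N.head a ∈ S)
    (h2 : 0 ≤ ∑ v, N.b v * if v ∈ S then 1 else 0) :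
    (∑ v, N.b v * if v ∈ S then 1 else 0) = 0 ∧
      ∀ a, 0 < X a → N.head a ∈ S → N.tail a ∈ S := by
  have e : (∑ v, N.b v * if v ∈ S then 1 else 0) = ∑ a, X a *
      ((if N.tail a ∈ S then 1 else 0) - if N.head a ∈ S then 1 else 0) := by
    rw [← sum_mul_outflow X fun v => if v ∈ S then (1 : ℝ) else 0]
    exact Finset.sum_congr rfl fun v _ => by rw [hb]
  have h3 : ∀ a ∈ Finset.univ, X a *
      ((if N.tail a ∈ S then 1 else 0) - if N.head a ∈ S then 1 else 0) ≤ 0 := by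
    intro a _
    rcases (hX a).eq_or_lt with h | h
    · simp [← h]
    · refine mul_nonpos_of_nonneg_of_nonpos h.le ?_
      by_cases ht : N.tail a ∈ S
      · simp [ht, h1 a h ht]
      · simp only [ht, if_false, zero_sub]
        split_ifs <;> norm_num
  have h4 := Finset.sum_nonpos h3
  refine ⟨le_antisymm (e ▸ h4) h2, fun a ha hh => ?_⟩
  have h5 := (Finset.sum_eq_zero_iff_of_nonpos h3).1 (le_antisymm h4 (e ▸ h2)) a
    (Finset.mem_univ a)
  by_contra ht
  simp [hh, ht, ha.ne'] at h5

/-- Optimality yields tight arcs only, which need not lie on a cheapest path from a source to a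
sink. The remaining flow lives away from `W ∩ W'`, where there is neither supply nor demand, and it
can be removed. -/
theorem IsOptimalDual.exists_restrict (hy : N.IsOptimalDual y) {θ : ℝ} {f : A → ℝ → ℝ}
    (hf : N.IsMinCost M θ f) :
    ∃ f', (N.restrict (N.cheapestArcs y)).IsTransshipment M θ f' := by
  classical
  obtain ⟨π, hfeas, hπ⟩ := hy.exists_potential
  have hle : N.flowCost θ f ≤ N.dualValue y := by
    obtain ⟨θ₀, f₀, h₀⟩ := hy.feasible_restrict (M := M)
    rw [← hy.flowCost_extendFlow h₀]
    exact hf.2 _ _ h₀.extend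
  replace hf := hf.1
  set X := N.total θ f with hX
  have htight : ∀ a, 0 < X a → π (N.tail a) - π (N.head a) = N.cost a := fun a ha =>
    hf.tight_of_flowCost_le hfeas hπ hle ha
  -- A path whose cost equals the potential difference of its ends consists of tight arcs. `W` holds
  -- the nodes reached from a source by such a path, `W'` the nodes that reach a sink by one.
  let W : Set V := {v | ∃ s p, 0 < N.b s ∧ N.IsPath s v p ∧ pathCost N.cost p = π s - π v}
  let W' : Set V := {v | ∃ t p, N.b t < 0 ∧ N.IsPath v t p ∧ pathCost N.cost p = π v - π t}
  have hW1 : ∀ a, 0 < X a → N.tail a ∈ W → N.head a ∈ W := by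
    rintro a ha ⟨s, p, hs, hp, e⟩
    refine ⟨s, p ++ [a], hs, hp.append (isPath_singleton a), ?_⟩
    rw [pathCost_append, pathCost_cons, pathCost_nil, ← htight a ha, e]
    ring
  have hW'1 : ∀ a, 0 < X a → N.tail a ∈ W'ᶜ → N.head a ∈ W'ᶜ := by
    rintro a ha ht ⟨t, p, hs, hp, e⟩
    refine ht ⟨t, a :: p, hs, ⟨rfl, hp⟩, ?_⟩
    rw [pathCost_cons, ← htight a ha, e]
    ring
  have hW2 : ∀ v, v ∉ W → N.b v ≤ 0 := fun v hv => by
    by_contra! h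
    exact hv ⟨v, [], h, rfl, by simp⟩
  have hW'2 : ∀ v, v ∉ W' → 0 ≤ N.b v := fun v hv => by
    by_contra! h
    exact hv ⟨v, [], h, rfl, by simp⟩
  have hW3 : ∀ v ∈ Finset.univ, N.b v ≤ N.b v * if v ∈ W then 1 else 0 := by
    intro v _
    split_ifs with h
    · simp
    · simpa using hW2 v h
  have hW'3 : ∀ v ∈ Finset.univ, 0 ≤ N.b v * if v ∈ W'ᶜ then 1 else 0 := by
    intro v _
    split_ifs with h
    · simpa using hW'2 v h
    · simp
  -- `W` contains all sources, so its total supply is at least the total balance zero. `W'` contains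
  -- all sinks, so its complement has nonnegative supply, and the same lemma applies to the
  -- complement.
  obtain ⟨hW4, hW5⟩ := no_inflow_of_no_outflow hf.total_nonneg hf.outflow_total W hW1
    (N.balanced.symm.le.trans (Finset.sum_le_sum hW3))
  obtain ⟨hW'4, hW'5⟩ := no_inflow_of_no_outflow hf.total_nonneg hf.outflow_total W'ᶜ hW'1
    (Finset.sum_nonneg hW'3)
  have hbW : ∀ v, v ∉ W → N.b v = 0 := fun v hv => by
    have := (Finset.sum_eq_sum_iff_of_le hW3).1 (N.balanced.trans hW4.symm) v (Finset.mem_univ v)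
    simpa [hv] using this
  have hbW' : ∀ v, v ∉ W' → N.b v = 0 := fun v hv => by
    have := (Finset.sum_eq_zero_iff_of_nonneg hW'3).1 hW'4 v (Finset.mem_univ v)
    simpa [hv] using this
  have hmem : ∀ a, 0 < X a → N.tail a ∈ W → N.head a ∈ W' → a ∈ N.cheapestArcs y := by
    rintro a ha ⟨s, p, hs, hp, e⟩ ⟨t, q, ht, hq, e'⟩
    refine hy.mem_cheapestArcs_iff.2 ⟨s, t, p, q, hs, ht, hp, hq, ?_⟩
    rw [e, e', ← htight a ha, hπ s hs.ne', hπ t ht.ne]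
    linarith
  have hzero : ∀ a, a ∉ N.cheapestArcs y → ∀ v, v ∈ W → v ∈ W' →
      N.head a = v ∨ N.tail a = v → ∀ ζ, ∫ t in Ico 0 ζ, f a t = 0 := by
    intro a ha v hv hv' hav ζ
    refine hf.integral_eq_zero ?_ ζ
    by_contra hne
    have hpos : 0 < X a := lt_of_le_of_ne (hf.total_nonneg a) (Ne.symm hne)
    refine ha (hmem a hpos ?_ ?_)
    · rcases hav with rfl | rfl
      · exact hW5 a hpos hv
      · exact hv
    · rcases hav with rfl | rfl
      · exact hv'
      · by_contra hh
        exact hW'5 a hpos hh hv'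
  -- Conversely, both ends of an arc of `A'` lie in `W ∩ W'`. The restricted flow thus has excess
  -- zero at all other nodes, and by `hzero` the old excess on `W ∩ W'`.
  have hout : ∀ a ∈ N.cheapestArcs y, ∀ v, (v ∉ W ∨ v ∉ W') →
      N.head a = v ∨ N.tail a = v → False := by
    intro a ha v hv hav
    have hta := hy.tight_of_mem_cheapestArcs hfeas hπ ha
    obtain ⟨s, t, p, q, hs, ht, hp, hq, hle⟩ := hy.mem_cheapestArcs_iff.1 ha
    have h1 := pathCost_ge_of_potential hfeas hp
    have h2 := pathCost_ge_of_potential hfeas hq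
    rw [← hπ s hs.ne', ← hπ t ht.ne] at hle
    have e1 : pathCost N.cost p = π s - π (N.tail a) := by linarith
    have e2 : pathCost N.cost q = π (N.head a) - π t := by linarith
    have m1 : N.tail a ∈ W := ⟨s, p, hs, hp, e1⟩
    have m2 : N.head a ∈ W := ⟨s, p ++ [a], hs, hp.append (isPath_singleton a), by
      rw [pathCost_append, pathCost_cons, pathCost_nil, ← hta, e1]; ring⟩
    have m3 : N.head a ∈ W' := ⟨t, q, ht, hq, e2⟩
    have m4 : N.tail a ∈ W' := ⟨t, a :: q, ht, ⟨rfl, hq⟩, by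
      rw [pathCost_cons, ← hta, e2]; ring⟩
    rcases hav with rfl | rfl <;> tauto
  have hex : ∀ v ξ, (N.restrict (N.cheapestArcs y)).excess (fun a => f a) v ξ =
      if v ∈ W ∧ v ∈ W' then N.excess f v ξ else 0 := by
    intro v ξ
    split_ifs with hv
    · exact excess_restrict f v ξ fun a ha hav => hzero a ha v hv.1 hv.2 hav
    · have hv' : v ∉ W ∨ v ∉ W' := by tauto
      rw [excess, Finset.sum_eq_zero, Finset.sum_eq_zero, sub_zero]
      · exact fun a _ => if_neg fun h => hout a a.2 v hv' (Or.inr h)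
      · exact fun a _ => if_neg fun h => hout a a.2 v hv' (Or.inl h)
  have hb0 : ∀ v, ¬ (v ∈ W ∧ v ∈ W') → N.b v = 0 := fun v hv => by
    by_cases h : v ∈ W
    · exact hbW' v fun h' => hv ⟨h, h'⟩
    · exact hbW v h
  refine ⟨fun a => f a, hf.horizon_nonneg, fun a => hf.measurable a, fun a => hf.zero_outside a,
    fun a => hf.nonneg a, fun a => hf.le_cap a, fun v hv ξ hξ => ?_, fun hM v hv ξ hξ => ?_,
    fun hM v hv ξ hξ => ?_, fun v => ?_⟩
  · rw [hex]; split_ifs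
    · exact hf.no_deficit v hv ξ hξ
    · exact le_rfl
  · rw [hex]; split_ifs
    · exact hf.no_storage hM v hv ξ hξ
    · rfl
  · rw [hex]; split_ifs with h
    · exact hf.no_overdraft hM v hv ξ hξ
    · have h1 : (0 : ℝ) < N.b v := hv
      rw [hb0 v h] at h1
      exact absurd h1 (lt_irrefl 0)
  · rw [hex]; split_ifs with h
    · exact hf.balance v
    · have h1 : (N.restrict (N.cheapestArcs y)).b v = N.b v := rfl
      rw [h1, hb0 v h, neg_zero]

theorem IsOptimalDual.isQuickestMinCost (hy : N.IsOptimalDual y) {θ : ℝ}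
    {f : N.cheapestArcs y → ℝ → ℝ} (hf : (N.restrict (N.cheapestArcs y)).IsQuickest M θ f) :
    N.IsQuickestMinCost M θ (extendFlow _ f) :=
  ⟨hy.isMinCost_extendFlow hf.1, fun θ' _ hf' =>
    let ⟨f'', h⟩ := hy.exists_restrict hf'
    hf.2 θ' f'' h⟩

/-! ### Terminals are incident to arcs -/

/-- A node without incident arcs always has excess zero, so it cannot be a terminal. This lets the
step count trade factors `k` for factors `m`. -/
theorem Feasible.numTerminals_le (hN : N.Feasible M) : N.numTerminals ≤ 2 * Fintype.card A := by
  classical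
  obtain ⟨θ, f, hf⟩ := hN
  have hsub : {v | N.b v ≠ 0} ⊆
      ((Finset.univ.image N.tail ∪ Finset.univ.image N.head : Finset V) : Set V) := by
    intro v hv
    by_contra hcon
    simp only [Finset.coe_union, Finset.coe_image, Finset.coe_univ, image_univ, mem_union,
      mem_range, not_or, not_exists] at hcon
    have h := hf.balance v
    simp only [excess, hcon.1, hcon.2, if_false, Finset.sum_const_zero, sub_zero] at h
    exact hv (by linarith)
  calc N.numTerminals ≤ _ := Set.ncard_le_ncard hsub (Finset.finite_toSet _)
    _ ≤ 2 * Fintype.card A := by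
      rw [Set.ncard_coe_finset]
      refine (Finset.card_union_le _ _).trans ?_
      have h1 := Finset.card_image_le (s := (Finset.univ : Finset A)) (f := N.tail)
      have h2 := Finset.card_image_le (s := (Finset.univ : Finset A)) (f := N.head)
      rw [Finset.card_univ] at h1 h2
      omega

end Network

namespace RealRAM

attribute [simp] NExpr.eval RExpr.eval Test.Holds

theorem update_apply {α : Type*} (g : ℕ → ℕ → ℕ → α) (x i j : ℕ) (r : α) (x' i' j' : ℕ) :
    update g x i j r x' i' j' = if x' = x ∧ i' = i ∧ j' = j then r else g x' i' j' := rfl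

/-! ### Frames: the arrays that a program does not write remain unchanged -/

/-- The arrays of natural numbers that a program may write. -/
def Program.natW : Program → List ℕ
  | setNat x _ _ _ => [x]
  | setReal _ _ _ _ => []
  | seq P Q => P.natW ++ Q.natW
  | cond _ P Q => P.natW ++ Q.natW
  | loop _ P => P.natW

/-- The arrays of real numbers that a program may write. -/
def Program.realW : Program → List ℕ
  | setNat _ _ _ _ => []
  | setReal x _ _ _ => [x]
  | seq P Q => P.realW ++ Q.realW
  | cond _ P Q => P.realW ++ Q.realW
  | loop _ P => P.realW

/-- The memories `σ` and `τ` agree on all arrays that `P` does not write. -/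
structure Frame (P : Program) (σ τ : Mem) : Prop where
  nat : ∀ x, x ∉ P.natW → τ.nat x = σ.nat x
  real : ∀ x, x ∉ P.realW → τ.real x = σ.real x

theorem Frame.refl (P : Program) (σ : Mem) : Frame P σ σ := ⟨fun _ _ => rfl, fun _ _ => rfl⟩

theorem Frame.trans {P : Program} {σ τ υ : Mem} (h : Frame P σ τ) (h' : Frame P τ υ) :
    Frame P σ υ :=
  ⟨fun x hx => (h'.nat x hx).trans (h.nat x hx), fun x hx => (h'.real x hx).trans (h.real x hx)⟩

theorem Frame.mono {P Q : Program} {σ τ : Mem} (h : Frame P σ τ) (hn : P.natW ⊆ Q.natW)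
    (hr : P.realW ⊆ Q.realW) : Frame Q σ τ :=
  ⟨fun x hx => h.nat x fun h' => hx (hn h'), fun x hx => h.real x fun h' => hx (hr h')⟩

theorem Exec.frame {P : Program} {σ τ : Mem} {t : ℕ} (h : Exec P σ τ t) : Frame P σ τ := by
  induction h with
  | setNat x i j e σ =>
    refine ⟨fun y hy => ?_, fun _ _ => rfl⟩
    have : y ≠ x := by simpa [Program.natW] using hy
    funext i' j'
    simp [update_apply, this]
  | setReal x i j e σ =>
    refine ⟨fun _ _ => rfl, fun y hy => ?_⟩
    have : y ≠ x := by simpa [Program.realW] using hy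
    funext i' j'
    simp [update_apply, this]
  | seq _ _ ih ih' =>
    exact (ih.mono (List.subset_append_left _ _) (List.subset_append_left _ _)).trans
      (ih'.mono (List.subset_append_right _ _) (List.subset_append_right _ _))
  | condTrue _ _ ih =>
    exact ih.mono (List.subset_append_left _ _) (List.subset_append_left _ _)
  | condFalse _ _ ih =>
    exact ih.mono (List.subset_append_right _ _) (List.subset_append_right _ _)
  | loopDone _ => exact Frame.refl _ _
  | loopStep _ _ _ ih ih' => exact Frame.trans ⟨ih.nat, ih.real⟩ ih'

/-! ### Total correctness with time bounds -/

/-- Program `P`, started in `σ`, halts after at most `B` steps in a memory satisfying `Q`. -/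
def Runs (P : Program) (σ : Mem) (B : ℕ) (Q : Mem → Prop) : Prop :=
  ∃ τ t, Exec P σ τ t ∧ t ≤ B ∧ Q τ

section

variable {P R : Program} {T : Test} {σ : Mem} {B B' : ℕ} {Q Q' : Mem → Prop}

/-- The frame comes for free with every execution, so specifications need to speak only of the
arrays that change. -/
theorem Runs.mono (h : Runs P σ B Q) (hB : B ≤ B') (hQ : ∀ τ, Frame P σ τ → Q τ → Q' τ) :
    Runs P σ B' Q' := by
  obtain ⟨τ, t, he, ht, hq⟩ := h
  exact ⟨τ, t, he, ht.trans hB, hQ τ he.frame hq⟩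

theorem Runs.seq (h : Runs P σ B Q) (h' : ∀ τ, Frame P σ τ → Q τ → Runs R τ B' Q') :
    Runs (.seq P R) σ (B + B') Q' := by
  obtain ⟨τ, t, he, ht, hq⟩ := h
  obtain ⟨υ, t', he', ht', hq'⟩ := h' τ he.frame hq
  exact ⟨υ, _, .seq he he', add_le_add ht ht', hq'⟩

theorem Runs.cond (h : T.Holds σ → Runs P σ B Q) (h' : ¬ T.Holds σ → Runs R σ B Q) :
    Runs (.cond T P R) σ (B + 1) Q := by
  by_cases hT : T.Holds σ
  · obtain ⟨τ, t, he, ht, hq⟩ := h hT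
    exact ⟨τ, _, .condTrue hT he, by omega, hq⟩
  · obtain ⟨τ, t, he, ht, hq⟩ := h' hT
    exact ⟨τ, _, .condFalse hT he, by omega, hq⟩

/-- The index of the invariant is a strictly decreasing variant and so bounds the number of
iterations. Each costs the body and one test; the final `+ 1` is the failing test. -/
theorem Runs.loop (I : ℕ → Mem → Prop) {r : ℕ} (h0 : I r σ)
    (hs : ∀ r τ, Frame P σ τ → I r τ → T.Holds τ → Runs P τ B fun υ => ∃ r' < r, I r' υ) :
    Runs (.loop T P) σ (r * (B + 1) + 1) fun τ => (∃ r' ≤ r, I r' τ) ∧ ¬ T.Holds τ := by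
  have key : ∀ r τ, Frame P σ τ → I r τ →
      Runs (.loop T P) τ (r * (B + 1) + 1) fun υ => (∃ r' ≤ r, I r' υ) ∧ ¬ T.Holds υ := by
    intro r
    induction r using Nat.strong_induction_on with
    | _ r ih =>
      intro τ hf hI
      by_cases hT : T.Holds τ
      · obtain ⟨υ, t, he, ht, r', hr', hI'⟩ := hs r τ hf hI hT
        obtain ⟨ω, t', he', ht', ⟨r'', hr'', hI''⟩, hT'⟩ := ih r' hr' υ (hf.trans he.frame) hI'
        refine ⟨ω, _, .loopStep hT he he', ?_, ⟨r'', hr''.trans hr'.le, hI''⟩, hT'⟩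
        have : (r' + 1) * (B + 1) ≤ r * (B + 1) := Nat.mul_le_mul_right _ hr'
        linarith
      · exact ⟨τ, 1, .loopDone hT, by omega, ⟨r, le_rfl, hI⟩, hT⟩
  exact key r σ (Frame.refl _ _) h0

/-- The weakest precondition of a program without loops. -/
@[simp] def Program.wp : Program → (Mem → Prop) → Mem → Prop
  | setNat x i j e, Q, σ =>
      Q { σ with nat := update σ.nat x (i.eval σ) (j.eval σ) (e.eval σ) }
  | setReal x i j e, Q, σ =>
      Q { σ with real := update σ.real x (i.eval σ) (j.eval σ) (e.eval σ) }
  | seq P R, Q, σ => P.wp (R.wp Q) σ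
  | cond T P R, Q, σ => (T.Holds σ → P.wp Q σ) ∧ (¬ T.Holds σ → R.wp Q σ)
  | loop _ _, _, _ => False

/-- The maximum number of steps of a program without loops. -/
def Program.maxSteps : Program → ℕ
  | setNat _ _ _ _ => 1
  | setReal _ _ _ _ => 1
  | seq P R => P.maxSteps + R.maxSteps
  | cond _ P R => max P.maxSteps R.maxSteps + 1
  | loop _ _ => 0

theorem Runs.of_wp' : ∀ {P : Program} {σ : Mem} {Q : Mem → Prop}, P.wp Q σ →
    Runs P σ P.maxSteps Q := by
  intro P
  induction P with
  | setNat x i j e => intro σ Q h; exact ⟨_, _, .setNat x i j e σ, le_rfl, h⟩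
  | setReal x i j e => intro σ Q h; exact ⟨_, _, .setReal x i j e σ, le_rfl, h⟩
  | seq P R ihP ihR => intro σ Q h; exact (ihP h).seq fun τ _ hτ => ihR hτ
  | cond T P R ihP ihR =>
    intro σ Q h
    exact Runs.cond (fun hT => (ihP (h.1 hT)).mono (le_max_left _ _) fun _ _ h => h)
      fun hT => (ihR (h.2 hT)).mono (le_max_right _ _) fun _ _ h => h
  | loop T P => intro σ Q h; exact h.elim

theorem Runs.of_wp (hB : P.maxSteps ≤ B) (h : P.wp Q σ) : Runs P σ B Q :=
  (Runs.of_wp' h).mono hB fun _ _ h => h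

end

/-! ### Counting loops -/

/-- The scalar variable number `x`. -/
@[simp] def NExpr.var (x : ℕ) : NExpr := .get x (.lit 0) (.lit 0)

/-- `for x = 0, 1, …, y - 1 do P`. -/
def Program.forUpTo (x y : ℕ) (P : Program) : Program :=
  .seq (.setNat x (.lit 0) (.lit 0) (.lit 0))
    (.loop (.not (.natLe (.var y) (.var x)))
      (.seq P (.setNat x (.lit 0) (.lit 0) (.add (.var x) (.lit 1)))))

/-- The memory after setting the scalar variable `x` to `c`. -/
def Mem.setVar (σ : Mem) (x c : ℕ) : Mem := { σ with nat := update σ.nat x 0 0 c }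

theorem Mem.setVar_nat_of_ne (σ : Mem) {x z : ℕ} (c : ℕ) (h : z ≠ x) :
    (σ.setVar x c).nat z = σ.nat z := by
  funext i j; simp [Mem.setVar, update_apply, h]

@[simp] theorem Mem.setVar_nat_self (σ : Mem) (x c : ℕ) : (σ.setVar x c).nat x 0 0 = c := by
  simp [Mem.setVar, update_apply]

@[simp] theorem Mem.setVar_real (σ : Mem) (x c : ℕ) : (σ.setVar x c).real = σ.real := rfl

/-- The counter is changed outside the body, so the invariant has to survive any assignment to it.
Each round costs `B` plus increment and test; the last `2` pays for the initialization and the final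
test. -/
theorem Runs.forUpTo {x y : ℕ} {P : Program} {σ : Mem} {N B : ℕ} (I : ℕ → Mem → Prop)
    (hy : σ.nat y 0 0 = N) (hxy : y ≠ x) (hxP : x ∉ P.natW) (hyP : y ∉ P.natW)
    (hI : ∀ i τ c, I i τ → I i (τ.setVar x c)) (h0 : I 0 σ)
    (hs : ∀ i < N, ∀ τ, Frame (.forUpTo x y P) σ τ → τ.nat x 0 0 = i → I i τ →
      Runs P τ B (I (i + 1))) :
    Runs (.forUpTo x y P) σ (N * (B + 2) + 2) (I N) := by
  have e1 : Runs (.setNat x (.lit 0) (.lit 0) (.lit 0)) σ 1 (fun τ => τ = σ.setVar x 0) :=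
    Runs.of_wp le_rfl rfl
  refine (e1.seq (B' := N * (B + 2) + 1) (Q' := I N) fun τ hf hτ => ?_).mono (by omega)
    fun _ _ h => h
  have hfr : Frame (.forUpTo x y P) σ τ :=
    hf.mono (List.subset_append_left _ _) (List.subset_append_left _ _)
  have hl := Runs.loop (P := .seq P (.setNat x (.lit 0) (.lit 0) (.add (.var x) (.lit 1))))
    (T := .not (.natLe (.var y) (.var x))) (σ := τ) (B := B + 1)
    (fun r υ => υ.nat y 0 0 = N ∧ υ.nat x 0 0 + r = N ∧ I (υ.nat x 0 0) υ) (r := N)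
    ⟨by rw [hτ, σ.setVar_nat_of_ne _ hxy, hy], by rw [hτ]; simp, by
      rw [hτ, Mem.setVar_nat_self]; exact hI _ _ _ h0⟩ ?_
  · refine hl.mono le_rfl ?_
    rintro υ - ⟨⟨r', -, h1, h2, h3⟩, hT⟩
    simp only [Test.Holds, NExpr.var, NExpr.eval, not_not] at hT
    rwa [show υ.nat x 0 0 = N by omega] at h3
  · rintro r υ hυ ⟨h1, h2, h3⟩ hT
    simp only [Test.Holds, NExpr.var, NExpr.eval, not_le] at hT
    have hfυ : Frame (.forUpTo x y P) σ υ :=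
      hfr.trans (hυ.mono (List.subset_append_right _ _) (List.subset_append_right _ _))
    refine (hs _ (by omega) υ hfυ rfl h3).seq (B' := 1) fun ω hω hIω => ?_
    refine Runs.of_wp le_rfl ⟨r - 1, by omega, ?_⟩
    have hx : ω.nat x 0 0 = υ.nat x 0 0 := by rw [hω.nat x hxP]
    have e2 := hI _ _ (υ.nat x 0 0 + 1) hIω
    refine ⟨?_, ?_, ?_⟩
    · simp [update_apply, hxy, hω.nat y hyP, h1]
    · simp [update_apply, hx]; omega
    · simp only [NExpr.eval, NExpr.var, hx]
      have e3 : update ω.nat x 0 0 (υ.nat x 0 0 + 1) x 0 0 = υ.nat x 0 0 + 1 := by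
        simp [update_apply]
      rw [e3]
      exact e2

/-- A double loop, with an invariant that depends on the set of pairs processed so far. -/
theorem Runs.forUpTo₂ {x x' y : ℕ} {P : Program} {σ : Mem} {N B : ℕ}
    (I : Set (ℕ × ℕ) → Mem → Prop)
    (hy : σ.nat y 0 0 = N) (hxy : y ≠ x) (hxy' : y ≠ x') (hxx' : x ≠ x') (hxP : x ∉ P.natW)
    (hxP' : x' ∉ P.natW) (hyP : y ∉ P.natW)
    (hI : ∀ S τ c, I S τ → I S (τ.setVar x c)) (hI' : ∀ S τ c, I S τ → I S (τ.setVar x' c))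
    (h0 : I ∅ σ)
    (hs : ∀ i < N, ∀ j < N, ∀ S τ, Frame (.forUpTo x y (.forUpTo x' y P)) σ τ →
      τ.nat x 0 0 = i → τ.nat x' 0 0 = j → I S τ → Runs P τ B (I (insert (i, j) S))) :
    Runs (.forUpTo x y (.forUpTo x' y P)) σ (N * ((N * (B + 2) + 2) + 2) + 2)
      (I {z | z.1 < N ∧ z.2 < N}) := by
  have hin : ∀ z, z ≠ x' → z ∉ P.natW → z ∉ (Program.forUpTo x' y P).natW := by
    intro z h1 h2; simp [Program.forUpTo, Program.natW, h1, h2]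
  have hyF : y ∉ (Program.forUpTo x y (.forUpTo x' y P)).natW := by
    simp [Program.forUpTo, Program.natW, hxy, hxy', hyP]
  refine (Runs.forUpTo (fun i τ => I {z | z.1 < i ∧ z.2 < N} τ) hy hxy (hin x hxx' hxP)
    (hin y hxy' hyP) (fun i τ c h => hI _ _ _ h) (by simpa using h0) ?_)
  intro i hi τ hτ hx hIτ
  refine (Runs.forUpTo (N := N) (B := B)
    (fun j υ => I ({z | z.1 < i ∧ z.2 < N} ∪ {z | z.1 = i ∧ z.2 < j}) υ)
    (by rw [hτ.nat y hyF, hy]) hxy' hxP' hyP (fun i τ c h => hI' _ _ _ h) (by simpa using hIτ)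
    ?_).mono le_rfl ?_
  · intro j hj υ hυ hx' hIυ
    have hυ' : Frame (.forUpTo x y (.forUpTo x' y P)) σ υ := hτ.trans
      (hυ.mono (by intro z; simp [Program.forUpTo, Program.natW]; tauto)
        (by intro z; simp [Program.forUpTo, Program.realW]))
    have hxυ : υ.nat x 0 0 = i := by rw [hυ.nat x (hin x hxx' hxP), hx]
    refine (hs i hi j hj _ υ hυ' hxυ hx' hIυ).mono le_rfl fun ω _ h => ?_
    have : insert (i, j) ({z : ℕ × ℕ | z.1 < i ∧ z.2 < N} ∪ {z | z.1 = i ∧ z.2 < j}) =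
        {z | z.1 < i ∧ z.2 < N} ∪ {z | z.1 = i ∧ z.2 < j + 1} := by
      ext ⟨a, b⟩
      simp only [mem_insert_iff, mem_union, mem_ofPred_eq, Prod.mk.injEq]
      omega
    rwa [this] at h
  · intro υ _ h
    have : ({z | z.1 < i ∧ z.2 < N} ∪ {z | z.1 = i ∧ z.2 < N} : Set (ℕ × ℕ)) =
        {z | z.1 < i + 1 ∧ z.2 < N} := by
      ext ⟨a, b⟩
      simp only [mem_union, mem_ofPred_eq]
      omega
    rwa [this] at h

end RealRAM

namespace RealRAM

open ArcGraph

/-! ### The Bellman-Ford algorithm -/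

/-- `fl` and `ds` are, for each node, reachability from the nodes in `F` and the minimum cost of a
path from a node in `F`, where starting from `u` costs `D u`. -/
def ShortestFrom {n m : ℕ} (G : ArcGraph (Fin n) (Fin m)) (c : Fin m → ℝ) (F : Fin n → Prop)
    (D : Fin n → ℝ) (fl : ℕ → ℕ) (ds : ℕ → ℝ) : Prop :=
  ∀ v : Fin n, (fl v = 0 ∧ ¬ ∃ u p, F u ∧ G.IsPath u v p) ∨
    (fl v = 1 ∧ (∃ u p, F u ∧ G.IsPath u v p ∧ ds v = D u + pathCost c p) ∧
      ∀ u p, F u → G.IsPath u v p → ds v ≤ D u + pathCost c p)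

/-- Update the label of the head of the current arc (variable 11), where labels are held in row
`x₉` of the arrays number 2, tails and heads in columns `tc` and `hc`. -/
def relax (tc hc : ℕ) : Program :=
  .cond (.and (.natLe (.lit 1) (.get 2 (.var 9) (.get 1 (.var 11) (.lit tc))))
      (.not (.and (.natLe (.lit 1) (.get 2 (.var 9) (.get 1 (.var 11) (.lit hc))))
        (.realLe (.get 2 (.var 9) (.get 1 (.var 11) (.lit hc)))
          (.add (.get 2 (.var 9) (.get 1 (.var 11) (.lit tc))) (.get 0 (.var 11) (.lit 2)))))))
    (.seq (.setReal 2 (.var 9) (.get 1 (.var 11) (.lit hc))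
        (.add (.get 2 (.var 9) (.get 1 (.var 11) (.lit tc))) (.get 0 (.var 11) (.lit 2))))
      (.setNat 2 (.var 9) (.get 1 (.var 11) (.lit hc)) (.lit 1)))
    (.setNat 99 (.lit 0) (.lit 0) (.lit 0))

/-- As many rounds as there are nodes (variable 5), each of which updates along all arcs (their
number is variable 6). -/
def bellmanFord (tc hc : ℕ) : Program := .forUpTo 10 5 (.forUpTo 11 6 (relax tc hc))

variable {n m : ℕ} {G : ArcGraph (Fin n) (Fin m)} {c : Fin m → ℝ} {F : Fin n → Prop}
  {D : Fin n → ℝ}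

theorem relax_natW (tc hc : ℕ) : (relax tc hc).natW = [2, 99] := rfl

theorem relax_realW (tc hc : ℕ) : (relax tc hc).realW = [2] := rfl

theorem bellmanFord_natW (tc hc : ℕ) : (bellmanFord tc hc).natW = [10, 11, 2, 99, 11, 10] := rfl

theorem bellmanFord_realW (tc hc : ℕ) : (bellmanFord tc hc).realW = [2] := rfl

/-- Labels are costs of paths, and they are optimal among paths with at most `r` arcs. -/
def LabelInv (G : ArcGraph (Fin n) (Fin m)) (c : Fin m → ℝ) (F : Fin n → Prop) (D : Fin n → ℝ)
    (r j : ℕ) (fl : ℕ → ℕ) (ds : ℕ → ℝ) : Prop :=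
  (∀ v : Fin n, fl v = 0 ∨ (fl v = 1 ∧ ∃ u p, F u ∧ G.IsPath u v p ∧ ds v = D u + pathCost c p)) ∧
    (∀ (u v : Fin n) p, F u → G.IsPath u v p → p.length ≤ r →
      fl v = 1 ∧ ds v ≤ D u + pathCost c p) ∧
    ∀ a : Fin m, (a : ℕ) < j → ∀ u p, F u → G.IsPath u (G.tail a) p → p.length ≤ r →
      fl (G.head a) = 1 ∧ ds (G.head a) ≤ D u + pathCost c p + c a

/-- The last clause of `LabelInv` records progress within a round. Once all arcs are processed,
splitting off the last arc of a path covers paths with `r + 1` arcs. -/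
theorem LabelInv.succ {r : ℕ} {fl : ℕ → ℕ} {ds : ℕ → ℝ} (h : LabelInv G c F D r m fl ds) :
    LabelInv G c F D (r + 1) 0 fl ds := by
  obtain ⟨h1, h2, h3⟩ := h
  refine ⟨h1, fun u v p hu hp hlen => ?_, fun a ha => absurd ha (Nat.not_lt_zero _)⟩
  rcases List.eq_nil_or_concat p with rfl | ⟨q, a, rfl⟩
  · exact h2 u v [] hu hp (Nat.zero_le _)
  · rw [List.concat_eq_append] at hp hlen ⊢
    obtain ⟨w, hq, rfl, rfl⟩ := isPath_append.1 hp
    simp only [List.length_append, List.length_cons, List.length_nil] at hlen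
    rw [pathCost_append, pathCost_cons, pathCost_nil, add_zero, ← add_assoc]
    exact h3 a a.2 u q hu hq (by omega)

theorem LabelInv.relax_skip {r : ℕ} {fl : ℕ → ℕ} {ds : ℕ → ℝ} {a : Fin m}
    (h : LabelInv G c F D r a fl ds)
    (ha : 1 ≤ fl (G.tail a) → 1 ≤ fl (G.head a) ∧ ds (G.head a) ≤ ds (G.tail a) + c a) :
    LabelInv G c F D r (a + 1) fl ds := by
  obtain ⟨h1, h2, h3⟩ := h
  refine ⟨h1, h2, fun a' ha' u p hu hp hlen => ?_⟩
  rcases Nat.lt_succ_iff_lt_or_eq.1 ha' with h | h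
  · exact h3 a' h u p hu hp hlen
  · obtain rfl : a' = a := Fin.ext h
    obtain ⟨h4, h5⟩ := h2 u _ p hu hp hlen
    obtain ⟨h6, h7⟩ := ha h4.ge
    refine ⟨?_, by linarith⟩
    rcases h1 (G.head a') with h | h
    · omega
    · exact h.1

/-- Labels never get worse, so all earlier bounds persist; the new label is realized by appending
the arc to the path behind the label of its tail. -/
theorem LabelInv.relax_update {r : ℕ} {fl fl' : ℕ → ℕ} {ds ds' : ℕ → ℝ} {a : Fin m}
    (h : LabelInv G c F D r a fl ds) (ht : 1 ≤ fl (G.tail a))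
    (hh : ¬ (1 ≤ fl (G.head a) ∧ ds (G.head a) ≤ ds (G.tail a) + c a))
    (hfl : ∀ v, fl' v = if v = G.head a then 1 else fl v)
    (hds : ∀ v, ds' v = if v = G.head a then ds (G.tail a) + c a else ds v) :
    LabelInv G c F D r (a + 1) fl' ds' := by
  obtain ⟨h1, h2, h3⟩ := h
  have key : ∀ (v : Fin n) (x : ℝ), fl v = 1 ∧ ds v ≤ x → fl' v = 1 ∧ ds' v ≤ x := by
    rintro v x ⟨hv, hx⟩
    rw [hfl, hds]
    split_ifs with e
    · have e' : v = G.head a := Fin.ext e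
      subst e'
      refine ⟨rfl, ?_⟩
      by_contra! hlt
      exact hh ⟨hv.ge, by linarith⟩
    · exact ⟨hv, hx⟩
  refine ⟨fun v => ?_, fun u v p hu hp hlen => key _ _ (h2 u v p hu hp hlen),
    fun a' ha' u p hu hp hlen => ?_⟩
  · rw [hfl, hds]
    split_ifs with e
    · have e' : v = G.head a := Fin.ext e
      subst e'
      rcases h1 (G.tail a) with h | ⟨-, u, p, hu, hp, e⟩
      · omega
      · refine Or.inr ⟨rfl, u, p ++ [a], hu, hp.append (isPath_singleton a), ?_⟩
        rw [e, pathCost_append, pathCost_cons, pathCost_nil]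
        ring
    · exact h1 v
  · rcases Nat.lt_succ_iff_lt_or_eq.1 ha' with h | h
    · exact key _ _ (h3 a' h u p hu hp hlen)
    · obtain rfl : a' = a := Fin.ext h
      obtain ⟨h4, h5⟩ := h2 u _ p hu hp hlen
      rw [hfl, hds, if_pos rfl, if_pos rfl]
      exact ⟨rfl, by linarith⟩

/-- The memory holds the data that the Bellman-Ford algorithm reads. -/
structure HoldsGraph (G : ArcGraph (Fin n) (Fin m)) (c : Fin m → ℝ) (tc hc row : ℕ) (σ : Mem) :
    Prop where
  numNodes : σ.nat 5 0 0 = n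
  numArcs : σ.nat 6 0 0 = m
  row : σ.nat 9 0 0 = row
  tail : ∀ a : Fin m, σ.nat 1 a tc = G.tail a
  head : ∀ a : Fin m, σ.nat 1 a hc = G.head a
  cost : ∀ a : Fin m, σ.real 0 a 2 = c a

theorem HoldsGraph.of_frame {tc hc row : ℕ} {σ τ : Mem} (h : HoldsGraph G c tc hc row σ)
    (hf : Frame (bellmanFord tc hc) σ τ) : HoldsGraph G c tc hc row τ := by
  have e : ∀ z, z ∉ [10, 11, 2, 99, 11, 10] → τ.nat z = σ.nat z := fun z hz => hf.nat z hz
  have e' : τ.real 0 = σ.real 0 := hf.real 0 (by rw [bellmanFord_realW]; decide)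
  constructor
  · rw [e 5 (by decide), h.numNodes]
  · rw [e 6 (by decide), h.numArcs]
  · rw [e 9 (by decide), h.row]
  · rw [e 1 (by decide)]; exact h.tail
  · rw [e 1 (by decide)]; exact h.head
  · rw [e']; exact h.cost

theorem runs_relax {tc hc row r : ℕ} {σ : Mem} {a : Fin m} (hσ : HoldsGraph G c tc hc row σ)
    (ha : σ.nat 11 0 0 = a) (hI : LabelInv G c F D r a (σ.nat 2 row) (σ.real 2 row)) :
    Runs (relax tc hc) σ 3 fun τ => LabelInv G c F D r (a + 1) (τ.nat 2 row) (τ.real 2 row) ∧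
      ∀ i ≠ row, τ.nat 2 i = σ.nat 2 i ∧ τ.real 2 i = σ.real 2 i := by
  refine Runs.of_wp le_rfl ?_
  simp only [relax, Program.wp, Test.Holds, NExpr.eval, RExpr.eval, NExpr.var, hσ.row, ha,
    hσ.tail, hσ.head, hσ.cost]
  refine ⟨fun h => ⟨hI.relax_update h.1 h.2 (fun v => ?_) (fun v => ?_), fun i hi => ⟨?_, ?_⟩⟩,
    fun h => ⟨?_, fun i _ => ⟨?_, trivial⟩⟩⟩
  · simp [update_apply]
  · simp [update_apply]
  · funext j; simp [update_apply, hi]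
  · funext j; simp [update_apply, hi]
  · have e : update σ.nat 99 0 0 0 2 row = σ.nat 2 row := by funext j; simp [update_apply]
    rw [e]
    refine hI.relax_skip fun h1 => ?_
    by_contra h2
    exact h ⟨h1, h2⟩
  · funext j; simp [update_apply]

/-- After `n` rounds the labels are optimal among paths with at most `n` arcs, hence among all paths
by `Conservative.exists_short`. The columns `tc`, `hc` are parameters so that swapping them treats
the reversed graph. -/
theorem runs_bellmanFord {tc hc row : ℕ} {σ : Mem} (hG : G.Conservative c)
    (hσ : HoldsGraph G c tc hc row σ)
    (hinit : ∀ v : Fin n, (σ.nat 2 row v = 0 ∧ ¬ F v) ∨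
      (σ.nat 2 row v = 1 ∧ F v ∧ σ.real 2 row v = D v)) :
    Runs (bellmanFord tc hc) σ (n * ((m * (3 + 2) + 2) + 2) + 2) fun τ =>
      ShortestFrom G c F D (τ.nat 2 row) (τ.real 2 row) ∧
      ∀ i ≠ row, τ.nat 2 i = σ.nat 2 i ∧ τ.real 2 i = σ.real 2 i := by
  have h0 : LabelInv G c F D 0 0 (σ.nat 2 row) (σ.real 2 row) := by
    refine ⟨fun v => ?_, fun u v p hu hp hlen => ?_, fun a ha => absurd ha (Nat.not_lt_zero _)⟩
    · rcases hinit v with h | ⟨h1, h2, h3⟩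
      · exact Or.inl h.1
      · exact Or.inr ⟨h1, v, [], h2, rfl, by simp [h3]⟩
    · obtain rfl := List.length_eq_zero_iff.1 (Nat.le_zero.1 hlen)
      cases hp
      rcases hinit u with h | ⟨h1, h2, h3⟩
      · exact absurd hu h.2
      · exact ⟨h1, by simp [h3]⟩
  have hmain := Runs.forUpTo (x := 10) (y := 5) (P := .forUpTo 11 6 (relax tc hc)) (σ := σ)
    (N := n) (B := m * (3 + 2) + 2)
    (fun r τ => LabelInv G c F D r 0 (τ.nat 2 row) (τ.real 2 row) ∧
      ∀ i ≠ row, τ.nat 2 i = σ.nat 2 i ∧ τ.real 2 i = σ.real 2 i)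
    hσ.numNodes (by decide) (by simp [Program.forUpTo, Program.natW, relax_natW])
    (by simp [Program.forUpTo, Program.natW, relax_natW])
    (fun i τ c h => by rwa [τ.setVar_nat_of_ne c (by decide), τ.setVar_real])
    ⟨h0, fun _ _ => ⟨rfl, rfl⟩⟩ ?_
  · refine hmain.mono le_rfl ?_
    rintro τ - ⟨⟨h1, h2, -⟩, h3⟩
    refine ⟨fun v => ?_, h3⟩
    have h2' : ∀ u p, F u → G.IsPath u v p → τ.nat 2 row v = 1 ∧
        τ.real 2 row v ≤ D u + pathCost c p := by
      intro u p hu hp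
      obtain ⟨q, hq, hlen, hle⟩ := hG.exists_short hp
      obtain ⟨h4, h5⟩ := h2 u v q hu hq (by simpa using hlen)
      exact ⟨h4, by linarith⟩
    rcases h1 v with h | ⟨h4, h5⟩
    · refine Or.inl ⟨h, ?_⟩
      rintro ⟨u, p, hu, hp⟩
      rw [(h2' u p hu hp).1] at h
      exact one_ne_zero h
    · exact Or.inr ⟨h4, h5, fun u p hu hp => (h2' u p hu hp).2⟩
  · rintro r hr τ hf - ⟨hI, ho⟩
    have hτ := hσ.of_frame hf
    refine (Runs.forUpTo (x := 11) (y := 6) (P := relax tc hc) (σ := τ) (N := m) (B := 3)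
      (fun j υ => LabelInv G c F D r j (υ.nat 2 row) (υ.real 2 row) ∧
        ∀ i ≠ row, υ.nat 2 i = σ.nat 2 i ∧ υ.real 2 i = σ.real 2 i)
      hτ.numArcs (by decide) (by simp [relax_natW]) (by simp [relax_natW])
      (fun i τ c h => by rwa [τ.setVar_nat_of_ne c (by decide), τ.setVar_real]) ⟨hI, ho⟩ ?_).mono
      le_rfl fun υ _ h => ⟨h.1.succ, h.2⟩
    rintro j hj υ hfυ hjυ ⟨hIυ, hoυ⟩
    have hυ := hτ.of_frame (hfυ.mono (by simp [Program.forUpTo, Program.natW, relax_natW,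
      bellmanFord_natW]) (by simp [Program.forUpTo, Program.realW, relax_realW, bellmanFord_realW]))
    refine (runs_relax (a := ⟨j, hj⟩) hυ hjυ hIυ).mono le_rfl fun ω _ h => ⟨h.1, fun i hi => ?_⟩
    rw [(h.2 i hi).1, (h.2 i hi).2]
    exact hoυ i hi

end RealRAM

namespace RealRAM

open ArcGraph

/-! ### Step 1: the terminals and the costs of cheapest paths between them -/

/-- A statement without relevant effect. -/
def skip : Program := .setNat 99 (.lit 0) (.lit 0) (.lit 0)

/-- Append the node `x₁₂` to the list of terminals (array 8, of length `x₇`) if it is one. -/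
def collectNode : Program :=
  .cond (.and (.realLe (.get 1 (.var 12) (.lit 0)) (.lit 0))
      (.realLe (.lit 0) (.get 1 (.var 12) (.lit 0))))
    skip
    (.seq (.setNat 8 (.var 7) (.lit 0) (.var 12))
      (.setNat 7 (.lit 0) (.lit 0) (.add (.var 7) (.lit 1))))

/-- Compute the list of terminals. -/
def collectTerminals : Program :=
  .seq (.seq (.setNat 5 (.lit 0) (.lit 0) (.get 0 (.lit 0) (.lit 0)))
      (.seq (.setNat 6 (.lit 0) (.lit 0) (.get 0 (.lit 0) (.lit 1)))
        (.setNat 7 (.lit 0) (.lit 0) (.lit 0))))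
    (.forUpTo 12 5 collectNode)

/-- Compute the costs of cheapest paths from the terminal with index `x₁₃` if it is a source. -/
def pathCostsFrom : Program :=
  .seq (.setNat 9 (.lit 0) (.lit 0) (.get 8 (.var 13) (.lit 0)))
    (.cond (.realLe (.get 1 (.var 9) (.lit 0)) (.lit 0)) skip
      (.seq (.forUpTo 14 5 (.setNat 2 (.var 9) (.var 14) (.lit 0)))
        (.seq (.seq (.setNat 2 (.var 9) (.var 9) (.lit 1)) (.setReal 2 (.var 9) (.var 9) (.lit 0)))
          (bellmanFord 0 1))))

/-- Step 1 of the algorithm. -/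
def computePathCosts : Program :=
  .cond (.natLe (.lit 1) (.get 0 (.lit 0) (.lit 1)))
    (.seq collectTerminals (.forUpTo 13 7 pathCostsFrom)) skip

end RealRAM

namespace Network

open RealRAM ArcGraph

variable {n m : ℕ} {N : Network (Fin n) (Fin m)} {σ τ : Mem}

/-- `T 0, …, T (k - 1)` are the terminals among the first `j` nodes. -/
structure ListsTerminals (N : Network (Fin n) (Fin m)) (j k : ℕ) (T : ℕ → ℕ) : Prop where
  exists_eq : ∀ i < k, ∃ v : Fin n, T i = v ∧ (v : ℕ) < j ∧ N.b v ≠ 0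
  inj : ∀ i < k, ∀ i' < k, T i = T i' → i = i'
  surj : ∀ v : Fin n, (v : ℕ) < j → N.b v ≠ 0 → ∃ i < k, T i = v

theorem StoredIn.of_eq (h : N.StoredIn σ) (h0 : τ.nat 0 = σ.nat 0) (h1 : τ.nat 1 = σ.nat 1)
    (h2 : τ.real 0 = σ.real 0) (h3 : τ.real 1 = σ.real 1) : N.StoredIn τ := by
  constructor
  · rw [h0]; exact h.numNodes
  · rw [h0]; exact h.numArcs
  · rw [h1]; exact h.tail
  · rw [h1]; exact h.head
  · rw [h2]; exact h.cap
  · rw [h2]; exact h.transit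
  · rw [h2]; exact h.cost
  · rw [h3]; exact h.b

theorem ListsTerminals.skip {j k : ℕ} {T : ℕ → ℕ} {v : Fin n} (h : N.ListsTerminals j k T)
    (hv : (v : ℕ) = j) (hb : N.b v = 0) : N.ListsTerminals (j + 1) k T := by
  refine ⟨fun i hi => ?_, h.inj, fun w hw hbw => ?_⟩
  · obtain ⟨w, h1, h2, h3⟩ := h.exists_eq i hi
    exact ⟨w, h1, by omega, h3⟩
  · rcases Nat.lt_succ_iff_lt_or_eq.1 hw with h' | h'
    · exact h.surj w h' hbw
    · obtain rfl : w = v := Fin.ext (by omega)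
      exact absurd hb hbw

theorem ListsTerminals.snoc {j k : ℕ} {T T' : ℕ → ℕ} {v : Fin n} (h : N.ListsTerminals j k T)
    (hv : (v : ℕ) = j) (hb : N.b v ≠ 0) (hT : ∀ i, T' i = if i = k then (v : ℕ) else T i) :
    N.ListsTerminals (j + 1) (k + 1) T' := by
  refine ⟨fun i hi => ?_, fun i hi i' hi' e => ?_, fun w hw hbw => ?_⟩
  · rw [hT]
    split_ifs with hik
    · exact ⟨v, rfl, by omega, hb⟩
    · obtain ⟨w, h1, h2, h3⟩ := h.exists_eq i (by omega)
      exact ⟨w, h1, by omega, h3⟩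
  · rw [hT, hT] at e
    split_ifs at e with h1 h2 h2
    · omega
    · obtain ⟨w, h3, h4, -⟩ := h.exists_eq i' (by omega)
      omega
    · obtain ⟨w, h3, h4, -⟩ := h.exists_eq i (by omega)
      omega
    · exact h.inj i (by omega) i' (by omega) e
  · rcases Nat.lt_succ_iff_lt_or_eq.1 hw with h' | h'
    · obtain ⟨i, hi, e⟩ := h.surj w h' hbw
      exact ⟨i, by omega, by rw [hT, if_neg (by omega), e]⟩
    · exact ⟨k, by omega, by rw [hT, if_pos rfl]; omega⟩

theorem ListsTerminals.numTerminals_eq {k : ℕ} {T : ℕ → ℕ} (h : N.ListsTerminals n k T) :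
    k = N.numTerminals := by
  rw [numTerminals, ← Set.ncard_coe_finset (Finset.range k) |>.trans (Finset.card_range k)]
  choose g hg using h.exists_eq
  refine Set.ncard_congr (fun i hi => g i (by simpa using hi)) (fun i hi => ?_)
    (fun i i' hi hi' e => ?_) fun v hv => ?_
  · exact (hg i (by simpa using hi)).2.2
  · have h1 := hg i (by simpa using hi)
    have h2 := hg i' (by simpa using hi')
    refine h.inj i (by simpa using hi) i' (by simpa using hi') ?_
    rw [h1.1, h2.1, e]
  · obtain ⟨i, hi, e⟩ := h.surj v v.2 hv
    refine ⟨i, by simpa using hi, Fin.ext ?_⟩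
    rw [← (hg i hi).1, e]

theorem runs_collectNode {j : ℕ} (hj : j < n) (hσ : N.StoredIn σ) (h12 : σ.nat 12 0 0 = j)
    (hI : N.ListsTerminals j (σ.nat 7 0 0) (fun i => σ.nat 8 i 0)) :
    Runs collectNode σ 3 fun τ =>
      N.ListsTerminals (j + 1) (τ.nat 7 0 0) (fun i => τ.nat 8 i 0) := by
  have hb : σ.real 1 j 0 = N.b ⟨j, hj⟩ := hσ.b ⟨j, hj⟩
  refine Runs.of_wp le_rfl ?_
  simp only [collectNode, RealRAM.skip, Program.wp, Test.Holds, NExpr.eval, RExpr.eval, NExpr.var,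
    h12, hb, Rat.cast_zero]
  refine ⟨fun h => ?_, fun h => ?_⟩
  · have := hI.skip (v := ⟨j, hj⟩) rfl (le_antisymm h.1 h.2)
    simpa [update_apply] using this
  · have := hI.snoc (v := ⟨j, hj⟩) (T' := fun i => if i = σ.nat 7 0 0 then j else σ.nat 8 i 0)
      rfl (fun h0 => h ⟨h0.le, h0.ge⟩) fun i => rfl
    simpa [update_apply] using this

theorem runs_collectTerminals (hσ : N.StoredIn σ) :
    Runs collectTerminals σ (n * (3 + 2) + 5) fun τ =>
      τ.nat 5 0 0 = n ∧ τ.nat 6 0 0 = m ∧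
        N.ListsTerminals n (τ.nat 7 0 0) (fun i => τ.nat 8 i 0) := by
  refine ((Runs.of_wp (B := 3) (Q := fun τ => τ.nat 5 0 0 = n ∧ τ.nat 6 0 0 = m ∧ τ.nat 7 0 0 = 0)
    le_rfl (by simp [update_apply, hσ.numNodes, hσ.numArcs])).seq (B' := n * (3 + 2) + 2)
    fun τ hf hτ => ?_).mono (by omega) fun _ _ h => h
  have hτs : N.StoredIn τ := hσ.of_eq (hf.nat 0 (by decide)) (hf.nat 1 (by decide))
    (hf.real 0 (by decide)) (hf.real 1 (by decide))
  refine (Runs.forUpTo (N := n) (B := 3) (fun j υ => N.ListsTerminals j (υ.nat 7 0 0)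
    fun i => υ.nat 8 i 0) hτ.1 (by decide) (by decide) (by decide) (fun j υ c h => ?_) ?_ ?_).mono
    le_rfl fun υ hυ h => ⟨?_, ?_, h⟩
  · rwa [υ.setVar_nat_of_ne c (by decide), υ.setVar_nat_of_ne c (by decide)]
  · rw [hτ.2.2]
    exact ⟨fun i hi => absurd hi (Nat.not_lt_zero _), fun i hi => absurd hi (Nat.not_lt_zero _),
      fun v hv => absurd hv (Nat.not_lt_zero _)⟩
  · intro j hj υ hυ h12 h
    exact runs_collectNode hj (hτs.of_eq (hυ.nat 0 (by decide)) (hυ.nat 1 (by decide))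
      (hυ.real 0 (by decide)) (hυ.real 1 (by decide))) h12 h
  · rw [hυ.nat 5 (by decide), hτ.1]
  · rw [hυ.nat 6 (by decide), hτ.2.1]

/-- The costs of cheapest paths from `s` are held in row `s` of the arrays number 2. -/
def HoldsCostsFrom (N : Network (Fin n) (Fin m)) (s : Fin n) (σ : Mem) : Prop :=
  ShortestFrom N.toArcGraph N.cost (fun u => u = s) (fun _ => 0) (σ.nat 2 s) (σ.real 2 s)

theorem HoldsCostsFrom.pathCosts {s t : Fin n} (h : N.HoldsCostsFrom s σ) :
    ((∃ p, N.IsPath s t p) → σ.nat 2 s t = 1 ∧ N.IsCheapestCost N.cost s t (σ.real 2 s t)) ∧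
      ((¬ ∃ p, N.IsPath s t p) → σ.nat 2 s t = 0) := by
  rcases h t with ⟨h1, h2⟩ | ⟨h1, ⟨u, p, rfl, hp, e⟩, h3⟩
  · exact ⟨fun ⟨p, hp⟩ => absurd ⟨s, p, rfl, hp⟩ h2, fun _ => h1⟩
  · refine ⟨fun _ => ⟨h1, p, ⟨hp, fun q hq => ?_⟩, by rw [e, zero_add]⟩, fun h => absurd ⟨p, hp⟩ h⟩
    have := h3 u q rfl hq
    linarith

/-- The memory after the terminals have been collected. -/
structure HoldsTerminals (N : Network (Fin n) (Fin m)) (σ : Mem) : Prop where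
  stored : N.StoredIn σ
  numNodes : σ.nat 5 0 0 = n
  numArcs : σ.nat 6 0 0 = m
  terminals : N.ListsTerminals n (σ.nat 7 0 0) fun i => σ.nat 8 i 0

theorem HoldsTerminals.of_frame {P : Program} (h : N.HoldsTerminals σ) (hf : Frame P σ τ)
    (hn : ∀ z ∈ [0, 1, 5, 6, 7, 8], z ∉ P.natW) (hr : ∀ z ∈ [0, 1], z ∉ P.realW) :
    N.HoldsTerminals τ where
  stored := h.stored.of_eq (hf.nat 0 (hn 0 (by decide))) (hf.nat 1 (hn 1 (by decide)))
    (hf.real 0 (hr 0 (by decide))) (hf.real 1 (hr 1 (by decide)))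
  numNodes := by rw [hf.nat 5 (hn 5 (by decide)), h.numNodes]
  numArcs := by rw [hf.nat 6 (hn 6 (by decide)), h.numArcs]
  terminals := by
    rw [hf.nat 7 (hn 7 (by decide)), hf.nat 8 (hn 8 (by decide))]; exact h.terminals

/-- Only row `s` is written, so the rows computed for other sources survive. -/
theorem runs_pathCostsFrom {i : ℕ} {s : Fin n} (hσ : N.HoldsTerminals σ)
    (h13 : σ.nat 13 0 0 = i) (hs : σ.nat 8 i 0 = s) :
    Runs pathCostsFrom σ (n * (m * 5 + 8) + 8) fun τ =>
      (0 < N.b s → N.HoldsCostsFrom s τ) ∧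
        ∀ i ≠ (s : ℕ), τ.nat 2 i = σ.nat 2 i ∧ τ.real 2 i = σ.real 2 i := by
  refine ((Runs.of_wp (B := 1) (Q := fun τ => τ.nat 9 0 0 = s) le_rfl
    (by simp [update_apply, h13, hs])).seq (B' := n * (m * 5 + 8) + 7) fun τ hf hτ => ?_).mono
    (by omega) fun _ _ h => h
  have hτ' := hσ.of_frame hf (by decide) (by decide)
  have e2 := hf.nat 2 (by decide)
  have e2' := hf.real 2 (by decide)
  rw [← e2, ← e2']
  refine Runs.cond (B := n * (m * 5 + 8) + 6) (fun hT => ?_) fun hT => ?_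
  · simp only [Test.Holds, RExpr.eval, NExpr.var, NExpr.eval, hτ, hτ'.stored.b, Rat.cast_zero] at hT
    refine Runs.of_wp (Nat.le_add_left 1 _) ⟨fun h => absurd h hT.not_gt, fun i _ => ⟨?_, rfl⟩⟩
    funext j
    simp [update_apply]
  have h1 : Runs (.forUpTo 14 5 (.setNat 2 (.var 9) (.var 14) (.lit 0))) τ (n * (1 + 2) + 2)
      fun υ => (∀ v < n, υ.nat 2 s v = 0) ∧ ∀ i ≠ (s : ℕ), υ.nat 2 i = τ.nat 2 i := by
    refine Runs.forUpTo (fun j υ => (∀ v < j, υ.nat 2 s v = 0) ∧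
      ∀ i ≠ (s : ℕ), υ.nat 2 i = τ.nat 2 i) hτ'.numNodes (by decide) (by decide) (by decide)
      (fun j υ c h => by rwa [υ.setVar_nat_of_ne c (by decide)])
      ⟨fun v hv => absurd hv (Nat.not_lt_zero _), fun _ _ => rfl⟩ ?_
    rintro j hj υ hυ h14 ⟨h, h'⟩
    have e9 : υ.nat 9 0 0 = s := by rw [hυ.nat 9 (by decide), hτ]
    refine Runs.of_wp le_rfl ⟨fun v hv => ?_, fun i hi => ?_⟩
    · simp only [NExpr.eval, NExpr.var, e9, h14, update_apply]
      split_ifs with hvj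
      · rfl
      · have hne : v ≠ j := by
          rintro rfl
          exact hvj (by simp)
        exact h v (by omega)
    · rw [← h' i hi]
      funext j'
      simp [update_apply, e9, hi]
  refine (h1.seq (B' := 2 + (n * ((m * (3 + 2) + 2) + 2) + 2)) fun υ hυ hυ2 => ?_).mono (by
    ring_nf; omega) fun _ _ h => h
  have e9 : υ.nat 9 0 0 = s := by rw [hυ.nat 9 (by decide), hτ]
  refine (Runs.of_wp (B := 2) (Q := fun ω => (∀ v : Fin n, (ω.nat 2 s v = 0 ∧ ¬ v = s) ∨
      (ω.nat 2 s v = 1 ∧ v = s ∧ ω.real 2 s v = 0)) ∧ ∀ i ≠ (s : ℕ),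
      ω.nat 2 i = τ.nat 2 i ∧ ω.real 2 i = τ.real 2 i) le_rfl ?_).seq fun ω hω hω2 => ?_
  · simp only [Program.wp, NExpr.eval, NExpr.var, e9, RExpr.eval, Rat.cast_zero]
    refine ⟨fun v => ?_, fun i hi => ⟨?_, ?_⟩⟩
    · by_cases hv : v = s
      · subst hv
        simp [update_apply, e9]
      · have hv' : (v : ℕ) ≠ s := fun h => hv (Fin.ext h)
        simp [update_apply, hv, hv', hυ2.1 v v.2]
    · rw [← hυ2.2 i hi]
      funext j
      simp [update_apply, hi]
    · rw [← hυ.real 2 (by decide)]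
      funext j
      simp [update_apply, e9, hi]
  · have hω' := (hτ'.of_frame hυ (by decide) (by decide)).of_frame hω (by decide) (by decide)
    have hG : HoldsGraph N.toArcGraph N.cost 0 1 s ω := ⟨hω'.numNodes, hω'.numArcs, by
      rw [hω.nat 9 (by decide), e9], hω'.stored.tail, hω'.stored.head, hω'.stored.cost⟩
    refine (runs_bellmanFord N.conservative hG hω2.1).mono le_rfl fun ρ _ hρ =>
      ⟨fun _ => hρ.1, fun i hi => ?_⟩
    rw [(hρ.2 i hi).1, (hρ.2 i hi).2]
    exact hω2.2 i hi

theorem runs_computePathCosts (hσ : N.StoredIn σ) (hm : 1 ≤ m) :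
    Runs computePathCosts σ (n * 5 + N.numTerminals * (n * (m * 5 + 8) + 10) + 8) fun τ =>
      N.HoldsTerminals τ ∧ ∀ s, 0 < N.b s → N.HoldsCostsFrom s τ := by
  refine (Runs.cond (B := (n * (3 + 2) + 5) + (N.numTerminals * (n * (m * 5 + 8) + 8 + 2) + 2))
    (fun _ => (runs_collectTerminals hσ).seq fun τ hf hτ => ?_) fun hT => ?_).mono
    (le_of_eq (by ring)) fun _ _ h => h
  · have hτ' : N.HoldsTerminals τ := ⟨hσ.of_eq (hf.nat 0 (by decide)) (hf.nat 1 (by decide))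
      (hf.real 0 (by decide)) (hf.real 1 (by decide)), hτ.1, hτ.2.1, hτ.2.2⟩
    have hk : τ.nat 7 0 0 = N.numTerminals := hτ'.terminals.numTerminals_eq
    refine (Runs.forUpTo (fun i υ => ∀ i' < i, ∀ s : Fin n, τ.nat 8 i' 0 = s → 0 < N.b s →
      N.HoldsCostsFrom s υ) hk (by decide) (by decide) (by decide) (fun i υ c h => ?_)
      (fun i' hi' => absurd hi' (Nat.not_lt_zero _)) ?_).mono le_rfl fun υ hυ h =>
      ⟨hτ'.of_frame hυ (by decide) (by decide), fun s hs => ?_⟩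
    · intro i' hi' s hs hb
      have := h i' hi' s hs hb
      rwa [HoldsCostsFrom, υ.setVar_nat_of_ne c (by decide), υ.setVar_real]
    · intro i hi υ hυ h13 h
      have hυ' := hτ'.of_frame hυ (by decide) (by decide)
      obtain ⟨s, hs, -, -⟩ := hτ'.terminals.exists_eq i (by omega)
      have e8 := hυ.nat 8 (by decide)
      refine (runs_pathCostsFrom (s := s) hυ' h13 (by rw [e8, hs])).mono le_rfl fun ω _ hω => ?_
      intro i' hi' s' hs' hb
      rcases eq_or_ne s' s with rfl | hne
      · exact hω.1 hb
      · have hii' : i' ≠ i := by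
          rintro rfl
          exact hne (Fin.ext (hs'.symm.trans hs))
        have h1 := h i' (by omega) s' hs' hb
        have hne' : (s' : ℕ) ≠ s := fun e => hne (Fin.ext e)
        rw [HoldsCostsFrom] at h1 ⊢
        rwa [(hω.2 s' hne').1, (hω.2 s' hne').2]
    · obtain ⟨i, hi, e⟩ := hτ'.terminals.surj s s.2 hs.ne'
      exact h i (by omega) s e hs
  · simp only [Test.Holds, NExpr.eval, hσ.numArcs] at hT
    omega

/-- Without arcs the required bound is a constant although `n` is arbitrary, so the program must
stop before looking at the nodes. All three programs start with this test. -/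
theorem runs_computePathCosts_of_isEmpty (hσ : N.StoredIn σ) (hm : m = 0) :
    Runs computePathCosts σ 2 fun τ => N.StoredIn τ := by
  refine Runs.cond (B := 1) (fun hT => ?_) fun _ => ?_
  · simp only [Test.Holds, NExpr.eval, hσ.numArcs] at hT
    omega
  · refine (Runs.of_wp (P := RealRAM.skip) (Q := fun _ => True) le_rfl trivial).mono le_rfl fun τ hf _ => ?_
    exact hσ.of_eq (hf.nat 0 (by decide)) (hf.nat 1 (by decide))
      (hf.real 0 (by decide)) (hf.real 1 (by decide))

end Network

namespace RealRAM

/-! ### Step 3: the arcs on cheapest paths -/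

/-- Initialize the labels for node `x₁₂` in rows `n` and `n + 1` of the arrays number 2. -/
def initLabels : Program :=
  .seq
    (.cond (.realLe (.get 1 (.var 12) (.lit 0)) (.lit 0))
      (.setNat 2 (.var 5) (.var 12) (.lit 0))
      (.seq (.setNat 2 (.var 5) (.var 12) (.lit 1))
        (.setReal 2 (.var 5) (.var 12) (.sub (.lit 0) (.get 3 (.var 12) (.lit 0))))))
    (.cond (.realLe (.lit 0) (.get 1 (.var 12) (.lit 0)))
      (.setNat 2 (.add (.var 5) (.lit 1)) (.var 12) (.lit 0))
      (.seq (.setNat 2 (.add (.var 5) (.lit 1)) (.var 12) (.lit 1))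
        (.setReal 2 (.add (.var 5) (.lit 1)) (.var 12) (.get 3 (.var 12) (.lit 0)))))

/-- Decide whether arc `x₁₁` lies on a cheapest path. -/
def markArc : Program :=
  .cond (.and (.and (.natLe (.lit 1) (.get 2 (.var 5) (.get 1 (.var 11) (.lit 0))))
      (.natLe (.lit 1) (.get 2 (.add (.var 5) (.lit 1)) (.get 1 (.var 11) (.lit 1)))))
      (.realLe (.add (.add (.get 2 (.var 5) (.get 1 (.var 11) (.lit 0))) (.get 0 (.var 11) (.lit 2)))
        (.get 2 (.add (.var 5) (.lit 1)) (.get 1 (.var 11) (.lit 1)))) (.lit 0)))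
    (.setNat 3 (.var 11) (.lit 0) (.lit 1)) (.setNat 3 (.var 11) (.lit 0) (.lit 0))

/-- Step 3 of the algorithm. -/
def computeCheapestArcs : Program :=
  .cond (.natLe (.lit 1) (.get 0 (.lit 0) (.lit 1)))
    (.seq (.forUpTo 12 5 initLabels)
      (.seq (.setNat 9 (.lit 0) (.lit 0) (.var 5))
        (.seq (bellmanFord 0 1)
          (.seq (.setNat 9 (.lit 0) (.lit 0) (.add (.var 5) (.lit 1)))
            (.seq (bellmanFord 1 0) (.forUpTo 11 6 markArc))))))
    skip

end RealRAM

namespace Network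

open RealRAM ArcGraph

variable {n m : ℕ} {N : Network (Fin n) (Fin m)} {σ τ : Mem}

/-- Row `row` of the arrays number 2 holds initial labels for the Bellman-Ford algorithm. -/
def HoldsLabels (F : Fin n → Prop) (D : Fin n → ℝ) (row : ℕ) (σ : Mem) : Prop :=
  ∀ v : Fin n, (σ.nat 2 row v = 0 ∧ ¬ F v) ∨ (σ.nat 2 row v = 1 ∧ F v ∧ σ.real 2 row v = D v)

/-- Rows `n` and `n + 1` are free, since Step 1 uses rows indexed by nodes. The initial labels stand
for the artificial arcs of the extended network, which is never built. -/
theorem runs_initLabels (hσ : N.HoldsTerminals σ) :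
    Runs (.forUpTo 12 5 initLabels) σ (n * 8 + 2) fun τ =>
      HoldsLabels (fun v => 0 < N.b v) (fun v => -storedVector n σ v) n τ ∧
      HoldsLabels (fun v => N.b v < 0) (fun v => storedVector n σ v) (n + 1) τ := by
  refine (Runs.forUpTo (B := 6) (fun j υ =>
    (∀ v : Fin n, (v : ℕ) < j → (υ.nat 2 n v = 0 ∧ ¬ 0 < N.b v) ∨
      (υ.nat 2 n v = 1 ∧ 0 < N.b v ∧ υ.real 2 n v = -storedVector n σ v)) ∧
    ∀ v : Fin n, (v : ℕ) < j → (υ.nat 2 (n + 1) v = 0 ∧ ¬ N.b v < 0) ∨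
      (υ.nat 2 (n + 1) v = 1 ∧ N.b v < 0 ∧ υ.real 2 (n + 1) v = storedVector n σ v))
    hσ.numNodes (by decide) (by decide) (by decide)
    (fun j υ c h => by rwa [υ.setVar_nat_of_ne c (by decide), υ.setVar_real])
    ⟨fun v hv => absurd hv (Nat.not_lt_zero _), fun v hv => absurd hv (Nat.not_lt_zero _)⟩
    ?_).mono le_rfl fun υ _ h => ⟨fun v => h.1 v v.2, fun v => h.2 v v.2⟩
  rintro j hj υ hυ h12 ⟨h, h'⟩
  have hυ' := hσ.of_frame hυ (by decide) (by decide)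
  have hb : υ.real 1 j 0 = N.b ⟨j, hj⟩ := hυ'.stored.b ⟨j, hj⟩
  have hy : υ.real 3 j 0 = storedVector n σ ⟨j, hj⟩ := by rw [hυ.real 3 (by decide)]; rfl
  have h5 := hυ'.numNodes
  have hv : ∀ v : Fin n, (v : ℕ) < j + 1 → (v : ℕ) < j ∨ v = ⟨j, hj⟩ := fun v hv => by
    rcases Nat.lt_succ_iff_lt_or_eq.1 hv with h | h
    · exact Or.inl h
    · exact Or.inr (Fin.ext h)
  refine Runs.of_wp (by decide) ?_
  simp only [initLabels, Program.wp, Test.Holds, NExpr.eval, RExpr.eval, NExpr.var, h12, hb, h5,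
    Rat.cast_zero, update_apply, not_le]
  refine ⟨fun hA => ⟨fun hB => ?_, fun hB => ?_⟩, fun hA => ⟨fun hB => ?_, fun hB => ?_⟩⟩ <;>
  simp [hb] at hB <;>
  refine ⟨fun v hlt => ?_, fun v hlt => ?_⟩ <;>
  rcases hv v hlt with hl | rfl
  all_goals first
    | (have h1 := h v hl; have hne := hl.ne; simpa [update_apply, hne, h5, h12] using h1)
    | (have h1 := h' v hl; have hne := hl.ne; simpa [update_apply, hne, h5, h12] using h1)
    | simp [hy, hA, hB]

/-- This is the test of `IsOptimalDual.mem_cheapestArcs_iff` with the minima in place of arbitrary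
paths. The second family of labels belongs to the reversed graph, so its paths have to be turned
around. -/
theorem runs_markArc {y : Fin n → ℝ} {a : Fin m} (hy : N.IsOptimalDual y) (hσ : N.HoldsTerminals σ)
    (h11 : σ.nat 11 0 0 = a)
    (h1 : ShortestFrom N.toArcGraph N.cost (fun v => 0 < N.b v) (fun v => -y v)
      (σ.nat 2 n) (σ.real 2 n))
    (h2 : ShortestFrom N.toArcGraph.rev N.cost (fun v => N.b v < 0) y
      (σ.nat 2 (n + 1)) (σ.real 2 (n + 1))) :
    Runs markArc σ 2 fun τ => (τ.nat 3 a 0 = if a ∈ N.cheapestArcs y then 1 else 0) ∧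
      ∀ i ≠ (a : ℕ), τ.nat 3 i 0 = σ.nat 3 i 0 := by
  have key : a ∈ N.cheapestArcs y ↔ (1 ≤ σ.nat 2 n (N.tail a) ∧ 1 ≤ σ.nat 2 (n + 1) (N.head a)) ∧
      σ.real 2 n (N.tail a) + N.cost a + σ.real 2 (n + 1) (N.head a) ≤ 0 := by
    rw [hy.mem_cheapestArcs_iff]
    constructor
    · rintro ⟨s, t, p, q, hs, ht, hp, hq, hle⟩
      rcases h1 (N.tail a) with ⟨-, h⟩ | ⟨h3, -, h4⟩
      · exact absurd ⟨s, p, hs, hp⟩ h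
      rcases h2 (N.head a) with ⟨-, h⟩ | ⟨h5, -, h6⟩
      · exact absurd ⟨t, _, ht, hq.reverse⟩ h
      refine ⟨⟨h3.ge, h5.ge⟩, ?_⟩
      have h7 := h4 s p hs hp
      have h8 := h6 t _ ht hq.reverse
      rw [pathCost_reverse] at h8
      linarith
    · rintro ⟨⟨h3, h4⟩, hle⟩
      rcases h1 (N.tail a) with ⟨h, -⟩ | ⟨-, ⟨s, p, hs, hp, e⟩, -⟩
      · omega
      rcases h2 (N.head a) with ⟨h, -⟩ | ⟨-, ⟨t, q, ht, hq, e'⟩, -⟩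
      · omega
      refine ⟨s, t, p, q.reverse, hs, ht, hp, IsPath.reverse (G := N.toArcGraph.rev) hq, ?_⟩
      rw [pathCost_reverse]
      linarith
  refine Runs.of_wp (by decide) ?_
  simp only [markArc, Program.wp, Test.Holds, NExpr.eval, RExpr.eval, NExpr.var, h11,
    hσ.numNodes, hσ.stored.tail, hσ.stored.head, hσ.stored.cost, Rat.cast_zero]
  rw [← key]
  exact ⟨fun h => ⟨by simp [update_apply, h], fun i hi => by simp [update_apply, hi]⟩,
    fun h => ⟨by simp [update_apply, h], fun i hi => by simp [update_apply, hi]⟩⟩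

theorem runs_computeCheapestArcs (hσ : N.HoldsTerminals σ) (hm : 1 ≤ m)
    (hy : N.IsOptimalDual (storedVector n σ)) :
    Runs computeCheapestArcs σ (n * (m * 10 + 16) + m * 4 + 11) fun τ =>
      N.StoredIn τ ∧ ArcSetStoredIn (N.cheapestArcs (storedVector n σ)) τ := by
  set y := storedVector n σ with hyσ
  have hbf : Runs (.seq (.forUpTo 12 5 initLabels) (.seq (.setNat 9 (.lit 0) (.lit 0) (.var 5))
        (.seq (bellmanFord 0 1)
          (.seq (.setNat 9 (.lit 0) (.lit 0) (.add (.var 5) (.lit 1)))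
            (.seq (bellmanFord 1 0) (.forUpTo 11 6 markArc)))))) σ
      ((n * 8 + 2) + (1 + ((n * ((m * (3 + 2) + 2) + 2) + 2) + (1 +
        ((n * ((m * (3 + 2) + 2) + 2) + 2) + (m * (2 + 2) + 2)))))) fun τ =>
      N.StoredIn τ ∧ ArcSetStoredIn (N.cheapestArcs y) τ := by
    refine (runs_initLabels hσ).seq fun σ₁ hf₁ hl₁ => ?_
    have hσ₁ := hσ.of_frame hf₁ (by decide) (by decide)
    refine (Runs.of_wp (B := 1) (Q := fun τ => τ.nat 9 0 0 = n) le_rfl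
      (by simp [update_apply, hσ₁.numNodes])).seq fun σ₂ hf₂ h9₂ => ?_
    have hσ₂ := hσ₁.of_frame hf₂ (by decide) (by decide)
    have hG : HoldsGraph N.toArcGraph N.cost 0 1 n σ₂ := ⟨hσ₂.numNodes, hσ₂.numArcs, h9₂,
      hσ₂.stored.tail, hσ₂.stored.head, hσ₂.stored.cost⟩
    refine (runs_bellmanFord N.conservative hG (F := fun v => 0 < N.b v) (D := fun v => -y v)
      (by rw [hf₂.nat 2 (by decide), hf₂.real 2 (by decide)]; exact hl₁.1)).seq
      fun σ₃ hf₃ hl₃ => ?_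
    have hσ₃ := hσ₂.of_frame hf₃ (by decide) (by decide)
    refine (Runs.of_wp (B := 1) (Q := fun τ => τ.nat 9 0 0 = n + 1) le_rfl
      (by simp [update_apply, hσ₃.numNodes])).seq fun σ₄ hf₄ h9₄ => ?_
    have hσ₄ := hσ₃.of_frame hf₄ (by decide) (by decide)
    have hG' : HoldsGraph N.toArcGraph.rev N.cost 1 0 (n + 1) σ₄ := ⟨hσ₄.numNodes, hσ₄.numArcs,
      h9₄, hσ₄.stored.head, hσ₄.stored.tail, hσ₄.stored.cost⟩
    -- The first pass wrote row `n` only, so row `n + 1` still holds its initial labels; the second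
    -- pass in turn leaves row `n` alone.
    refine (runs_bellmanFord N.conservative.rev hG' (F := fun v => N.b v < 0) (D := y)
      (by
        rw [hf₄.nat 2 (by decide), hf₄.real 2 (by decide), (hl₃.2 (n + 1) (by omega)).1,
          (hl₃.2 (n + 1) (by omega)).2, hf₂.nat 2 (by decide), hf₂.real 2 (by decide)]
        exact hl₁.2)).seq fun σ₅ hf₅ hl₅ => ?_
    have hσ₅ := hσ₄.of_frame hf₅ (by decide) (by decide)
    have hl₅' : ShortestFrom N.toArcGraph N.cost (fun v => 0 < N.b v) (fun v => -y v)
        (σ₅.nat 2 n) (σ₅.real 2 n) := by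
      rw [(hl₅.2 n (by omega)).1, (hl₅.2 n (by omega)).2, hf₄.nat 2 (by decide),
        hf₄.real 2 (by decide)]
      exact hl₃.1
    refine (Runs.forUpTo (B := 2) (fun j τ => ∀ a : Fin m, (a : ℕ) < j →
      τ.nat 3 a 0 = if a ∈ N.cheapestArcs y then 1 else 0) hσ₅.numArcs (by decide) (by decide)
      (by decide) (fun j τ c h => by rwa [τ.setVar_nat_of_ne c (by decide)])
      (fun a ha => absurd ha (Nat.not_lt_zero _)) ?_).mono le_rfl fun τ hτ h =>
      ⟨(hσ₅.of_frame hτ (by decide) (by decide)).stored, fun a => ?_⟩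
    · intro j hj τ hτ h11 h
      have hτ' := hσ₅.of_frame hτ (by decide) (by decide)
      refine (runs_markArc (a := ⟨j, hj⟩) hy hτ' h11
        (by rw [hτ.nat 2 (by decide), hτ.real 2 (by decide)]; exact hl₅')
        (by rw [hτ.nat 2 (by decide), hτ.real 2 (by decide)]; exact hl₅.1)).mono le_rfl
        fun υ _ hυ a ha => ?_
      rcases Nat.lt_succ_iff_lt_or_eq.1 ha with h' | h'
      · rw [hυ.2 a h'.ne]; exact h a h'
      · obtain rfl : a = ⟨j, hj⟩ := Fin.ext h'
        exact hυ.1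
    · convert h a a.2
  refine (Runs.cond (fun _ => hbf) fun hT => ?_).mono (le_of_eq (by ring)) fun _ _ h => h
  simp only [Test.Holds, NExpr.eval, hσ.stored.numArcs] at hT
  omega

theorem runs_computeCheapestArcs_of_isEmpty (hσ : N.StoredIn σ) (hm : m = 0) (y : Fin n → ℝ) :
    Runs computeCheapestArcs σ 2 fun τ =>
      N.StoredIn τ ∧ ArcSetStoredIn (N.cheapestArcs y) τ := by
  refine Runs.cond (B := 1) (fun hT => ?_) fun _ => ?_
  · simp only [Test.Holds, NExpr.eval, hσ.numArcs] at hT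
    omega
  · refine (Runs.of_wp (P := RealRAM.skip) (Q := fun _ => True) le_rfl trivial).mono le_rfl
      fun τ hf _ => ⟨hσ.of_eq (hf.nat 0 (by decide)) (hf.nat 1 (by decide))
        (hf.real 0 (by decide)) (hf.real 1 (by decide)), fun a => ?_⟩
    subst hm
    exact a.elim0

end Network

/-! ### Systems of difference constraints and flows with rounded supplies -/

namespace DiffSystem

/-- `y i - y j ≤ w i j` for all pairs of active indices in the relation `g`. -/
def Feasible (act : Finset ℕ) (g : ℕ → ℕ → Prop) (w : ℕ → ℕ → ℝ) (y : ℕ → ℝ) : Prop :=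
  ∀ i ∈ act, ∀ j ∈ act, g i j → y i - y j ≤ w i j

/-- The flow `x` only uses pairs whose constraint is tight. -/
def TightFlow (act : Finset ℕ) (g : ℕ → ℕ → Prop) (w : ℕ → ℕ → ℝ) (y : ℕ → ℝ)
    (x : ℕ → ℕ → ℕ) : Prop :=
  ∀ i ∈ act, ∀ j ∈ act, 0 < x i j → i ≠ j ∧ g i j ∧ y i - y j = w i j

/-- The net outflow of `x` at `i`. -/
def net (act : Finset ℕ) (x : ℕ → ℕ → ℕ) (i : ℕ) : ℝ :=
  ∑ j ∈ act, (x i j : ℝ) - ∑ j ∈ act, (x j i : ℝ)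

variable {act : Finset ℕ} {g : ℕ → ℕ → Prop} {w : ℕ → ℕ → ℝ} {y π β e : ℕ → ℝ}
  {x : ℕ → ℕ → ℕ} {Δ : ℝ}

theorem sum_net_mul (act : Finset ℕ) (x : ℕ → ℕ → ℕ) (z : ℕ → ℝ) :
    ∑ i ∈ act, net act x i * z i = ∑ i ∈ act, ∑ j ∈ act, (x i j : ℝ) * (z i - z j) := by
  simp only [net, sub_mul, mul_sub, Finset.sum_sub_distrib, Finset.sum_mul]
  congr 1
  exact Finset.sum_comm

/-- If a tight flow for rounded supplies has more flow on a pair than the total rounding error, then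
each feasible solution can be replaced by one that is at least as good and tight on this pair. -/
theorem exists_tight (hπ : Feasible act g w π) (hx : TightFlow act g w π x) (hΔ : 0 ≤ Δ)
    (hnet : ∀ i ∈ act, β i - e i = Δ * net act x i) {i₀ j₀ : ℕ} (hi₀ : i₀ ∈ act) (hj₀ : j₀ ∈ act)
    (hpos : 0 < x i₀ j₀) (he : ∑ i ∈ act, max (e i) 0 ≤ Δ * x i₀ j₀) (hy : Feasible act g w y) :
    ∃ y', Feasible act g w y' ∧ y' i₀ - y' j₀ = w i₀ j₀ ∧
      ∑ i ∈ act, β i * y i ≤ ∑ i ∈ act, β i * y' i := by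
  obtain ⟨-, hg, ht⟩ := hx i₀ hi₀ j₀ hj₀ hpos
  -- `ψ` is `z - z i₀` clamped to `[0, d]`, a monotone and 1-Lipschitz function of `z`. For each
  -- constraint, `y - ψ` is therefore bounded by what `y` allows or by what `π` allows. On `(i₀,
  -- j₀)` it has the difference of `π`, which is tight.
  set z : ℕ → ℝ := fun i => y i - π i with hz
  set d := z j₀ - z i₀ with hd
  have hd0 : 0 ≤ d := by
    have := hy i₀ hi₀ j₀ hj₀ hg
    simp only [hd, hz]; linarith
  set ψ : ℕ → ℝ := fun i => max 0 (min (z i - z i₀) d) with hψ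
  have hψ0 : ∀ i, 0 ≤ ψ i := fun i => le_max_left _ _
  have hψd : ∀ i, ψ i ≤ d := fun i => max_le hd0 (min_le_right _ _)
  have hmono : ∀ i j, z i ≤ z j → ψ i ≤ ψ j := fun i j h =>
    max_le_max le_rfl (min_le_min (by linarith) le_rfl)
  have hlip : ∀ i j, z i ≤ z j → ψ j - ψ i ≤ z j - z i := by
    intro i j h
    simp only [hψ]
    rcases le_total (z j - z i₀) d with h1 | h1 <;> rcases le_total (z i - z i₀) d with h2 | h2 <;>
    simp only [min_eq_left, min_eq_right, h1, h2] <;>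
    rcases le_total 0 (z j - z i₀) with h3 | h3 <;>
    rcases le_total 0 (z i - z i₀) with h4 | h4 <;>
    simp only [max_eq_left, max_eq_right, h3, h4, hd0] <;> linarith
  have hψi : ψ i₀ = 0 := by simp [hψ, hd0]
  have hψj : ψ j₀ = d := by simp [hψ, ← hd, hd0]
  refine ⟨fun i => y i - ψ i, fun i hi j hj hij => ?_, ?_, ?_⟩
  · rcases le_total (z j) (z i) with h | h
    · have := hmono _ _ h
      have := hy i hi j hj hij
      dsimp only
      linarith
    · have h1 := hlip _ _ h
      have h2 := hπ i hi j hj hij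
      simp only [hz] at h1
      dsimp only
      linarith
  · simp only [hψi, hψj, hd, hz]
    linarith
  -- The supplies split into rounding error and flow. The error contributes at most `d` times the
  -- total positive error. Each flow pair contributes at most zero, as `z` does not decrease along
  -- tight pairs, and `(i₀, j₀)` alone contributes `-Δ * x i₀ j₀ * d`.
  · have key : ∑ i ∈ act, β i * ψ i ≤ 0 := by
      have e1 : ∑ i ∈ act, β i * ψ i =
          ∑ i ∈ act, e i * ψ i + Δ * ∑ i ∈ act, net act x i * ψ i := by
        rw [Finset.mul_sum, ← Finset.sum_add_distrib]
        refine Finset.sum_congr rfl fun i hi => ?_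
        have := hnet i hi
        linear_combination ψ i * this
      have e2 : ∑ i ∈ act, e i * ψ i ≤ (∑ i ∈ act, max (e i) 0) * d := by
        rw [Finset.sum_mul]
        refine Finset.sum_le_sum fun i _ => ?_
        exact mul_le_mul (le_max_left _ _) (hψd i) (hψ0 i) (le_max_right _ _)
      have hneg : ∀ i ∈ act, ∀ j ∈ act, (x i j : ℝ) * (ψ i - ψ j) ≤ 0 := by
        intro i hi j hj
        rcases Nat.eq_zero_or_pos (x i j) with h | h
        · simp [h]
        · obtain ⟨-, h1, h2⟩ := hx i hi j hj h
          have h3 := hy i hi j hj h1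
          have h4 : ψ i ≤ ψ j := hmono _ _ (by simp only [hz]; linarith)
          exact mul_nonpos_of_nonneg_of_nonpos (Nat.cast_nonneg _) (by linarith)
      have e3 : ∑ i ∈ act, net act x i * ψ i ≤ -(x i₀ j₀ * d) := by
        rw [sum_net_mul]
        have h1 : ∑ i ∈ act, ∑ j ∈ act, (x i j : ℝ) * (ψ i - ψ j) ≤
            ∑ j ∈ act, (x i₀ j : ℝ) * (ψ i₀ - ψ j) := by
          rw [← Finset.add_sum_erase _ _ hi₀]
          have := Finset.sum_nonpos fun i (hi : i ∈ act.erase i₀) =>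
            Finset.sum_nonpos (hneg i (Finset.mem_of_mem_erase hi))
          linarith
        have h2 : ∑ j ∈ act, (x i₀ j : ℝ) * (ψ i₀ - ψ j) ≤ (x i₀ j₀ : ℝ) * (ψ i₀ - ψ j₀) := by
          rw [← Finset.add_sum_erase _ _ hj₀]
          have := Finset.sum_nonpos fun j (hj : j ∈ act.erase j₀) =>
            hneg i₀ hi₀ j (Finset.mem_of_mem_erase hj)
          linarith
        rw [hψi, hψj] at h2
        rw [hψi] at h1
        linarith
      have e4 := mul_le_mul_of_nonneg_right he hd0
      have e5 := mul_le_mul_of_nonneg_left e3 hΔ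
      linarith
    have : ∑ i ∈ act, β i * (y i - ψ i) = ∑ i ∈ act, β i * y i - ∑ i ∈ act, β i * ψ i := by
      rw [← Finset.sum_sub_distrib]
      exact Finset.sum_congr rfl fun i _ => by ring
    linarith

/-- A set without outgoing pairs has nonpositive total supply. -/
theorem sum_nonpos_of_closed (hπ : Feasible act g w π) {U : ℝ}
    (hU : ∀ z, Feasible act g w z → ∑ i ∈ act, β i * z i ≤ U) (p : ℕ → Prop) [DecidablePred p]
    (hp : ∀ i ∈ act, ∀ j ∈ act, p i → ¬ p j → ¬ g i j) : ∑ i ∈ act with p i, β i ≤ 0 := by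
  by_contra! hpos
  obtain ⟨l, hl⟩ := exists_nat_gt ((U - ∑ i ∈ act, β i * π i) / ∑ i ∈ act with p i, β i)
  rw [div_lt_iff₀ hpos] at hl
  -- Raising `π` on `p` can only violate constraints for pairs leaving `p`, and there are none; a
  -- positive supply would make the objective unbounded.
  have h1 := hU (fun i => π i + if p i then (l : ℝ) else 0) fun i hi j hj hij => ?_
  · have : ∑ i ∈ act, β i * (π i + if p i then (l : ℝ) else 0) =
        ∑ i ∈ act, β i * π i + l * ∑ i ∈ act with p i, β i := by
      rw [Finset.sum_filter, Finset.mul_sum, ← Finset.sum_add_distrib]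
      refine Finset.sum_congr rfl fun i _ => ?_
      split_ifs <;> ring
    linarith
  · have h2 := hπ i hi j hj hij
    have h3 : (0 : ℝ) ≤ l := Nat.cast_nonneg l
    by_cases hpi : p i <;> by_cases hpj : p j
    · simp only [hpi, hpj, if_true]; linarith
    · exact absurd hij (hp i hi j hj hpi hpj)
    · simp only [hpi, hpj, if_true, if_false]; linarith
    · simp only [hpi, hpj, if_false]; linarith

/-- Difference constraints are invariant under adding constants, so a nonzero total would make the
objective unbounded. -/
theorem sum_eq_zero_of_bounded (hπ : Feasible act g w π) {U : ℝ}
    (hU : ∀ z, Feasible act g w z → ∑ i ∈ act, β i * z i ≤ U) : ∑ i ∈ act, β i = 0 := by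
  refine le_antisymm ?_ ?_
  · have := sum_nonpos_of_closed hπ hU (fun _ => True) fun _ _ _ _ _ h => absurd trivial h
    simpa using this
  · by_contra! hneg
    obtain ⟨l, hl⟩ := exists_nat_gt ((U - ∑ i ∈ act, β i * π i) / -∑ i ∈ act, β i)
    rw [div_lt_iff₀ (by linarith)] at hl
    have h1 := hU (fun i => π i - l) fun i hi j hj hij => by
      have := hπ i hi j hj hij
      linarith
    have : ∑ i ∈ act, β i * (π i - l) = ∑ i ∈ act, β i * π i - l * ∑ i ∈ act, β i := by
      rw [Finset.mul_sum, ← Finset.sum_sub_distrib]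
      exact Finset.sum_congr rfl fun i _ => by ring
    linarith

/-- The bound on the total rounding error once no further augmentation is possible: the set `p` has
no outgoing residual pairs. -/
theorem sum_excess_le (hπ : Feasible act g w π) (hx : TightFlow act g w π x) (hΔ : 0 < Δ)
    (hnet : ∀ i ∈ act, β i - e i = Δ * net act x i) {U : ℝ}
    (hU : ∀ z, Feasible act g w z → ∑ i ∈ act, β i * z i ≤ U) (p : ℕ → Prop) [DecidablePred p]
    (hp : ∀ i ∈ act, ∀ j ∈ act, p i → ¬ p j → ¬ g i j ∧ x j i = 0)
    (h1 : ∀ i ∈ act, p i → -Δ < e i) (h2 : ∀ i ∈ act, ¬ p i → e i < Δ) :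
    ∑ i ∈ act, max (e i) 0 ≤ act.card * Δ := by
  have hβ := sum_nonpos_of_closed hπ hU p fun i hi j hj hpi hpj => (hp i hi j hj hpi hpj).1
  -- No flow leaves `p`, since flow needs a constraint pair, and none enters `p`, since it would
  -- give a residual pair leaving `p`. So the error in `p` sums to the supply of `p`, which is
  -- nonpositive.
  have hnet0 : ∑ i ∈ act with p i, net act x i = 0 := by
    have e1 := sum_net_mul act x fun i => if p i then 1 else 0
    simp only [mul_ite, mul_one, mul_zero] at e1
    rw [Finset.sum_filter, e1]
    refine Finset.sum_eq_zero fun i hi => Finset.sum_eq_zero fun j hj => ?_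
    by_cases hpi : p i <;> by_cases hpj : p j
    · simp [hpi, hpj]
    · have : x i j = 0 := by
        by_contra hne
        exact (hp i hi j hj hpi hpj).1 (hx i hi j hj (Nat.pos_of_ne_zero hne)).2.1
      simp [this]
    · simp [(hp j hj i hi hpj hpi).2]
    · simp [hpi, hpj]
  have he : ∑ i ∈ act with p i, e i ≤ 0 := by
    have e1 : ∑ i ∈ act with p i, e i =
        ∑ i ∈ act with p i, β i - Δ * ∑ i ∈ act with p i, net act x i := by
      rw [Finset.mul_sum, ← Finset.sum_sub_distrib]
      refine Finset.sum_congr rfl fun i hi => ?_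
      linarith [hnet i (Finset.mem_filter.1 hi).1]
    rw [e1, hnet0, mul_zero, sub_zero]
    exact hβ
  -- Inside `p` the errors exceed `-Δ`, so shifting by `Δ` dominates the positive part; outside `p`
  -- each positive part is at most `Δ`. Every index is charged one `Δ`.
  have h3 : ∑ i ∈ act with p i, max (e i) 0 ≤ ∑ i ∈ act with p i, (e i + Δ) := by
    refine Finset.sum_le_sum fun i hi => ?_
    have := h1 i (Finset.mem_filter.1 hi).1 (Finset.mem_filter.1 hi).2
    exact max_le (by linarith) (by linarith)
  have h4 : ∑ i ∈ act with ¬ p i, max (e i) 0 ≤ ∑ i ∈ act with ¬ p i, Δ := by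
    refine Finset.sum_le_sum fun i hi => ?_
    have := h2 i (Finset.mem_filter.1 hi).1 (Finset.mem_filter.1 hi).2
    exact max_le this.le hΔ.le
  rw [Finset.sum_add_distrib] at h3
  have h5 := Finset.sum_filter_add_sum_filter_not act p fun i => max (e i) 0
  have h6 := Finset.sum_filter_add_sum_filter_not act p fun _ => Δ
  have h7 : ∑ i ∈ act, Δ = act.card * Δ := by rw [Finset.sum_const, nsmul_eq_mul]
  linarith

/-- If some supply is large compared to the total rounding error, then some flow value is large. -/
theorem exists_large_flow {k : ℕ} (hk : act.card ≤ k) (hΔ : 0 < Δ)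
    (hnet : ∀ i ∈ act, β i - e i = Δ * net act x i) (hβ : ∑ i ∈ act, β i = 0)
    (he : ∑ i ∈ act, max (e i) 0 ≤ k * Δ) {v : ℕ} (hv : v ∈ act)
    (hβv : |β v| = (k * k + k) * Δ) : ∃ i ∈ act, ∃ j ∈ act, k ≤ x i j := by
  have hesum : ∑ i ∈ act, e i = 0 := by
    have e1 : ∑ i ∈ act, e i = ∑ i ∈ act, β i - Δ * ∑ i ∈ act, net act x i := by
      rw [Finset.mul_sum, ← Finset.sum_sub_distrib]
      exact Finset.sum_congr rfl fun i hi => by linarith [hnet i hi]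
    have e2 := sum_net_mul act x fun _ => 1
    simp only [mul_one, sub_self, mul_zero, Finset.sum_const_zero] at e2
    rw [e1, e2, hβ]
    ring
  -- The errors sum to zero, so the bound on the positive parts also bounds the negative parts and
  -- each `|e v|`. Of the supply `(k² + k) Δ` at `v`, at most `k Δ` is error, which leaves `k²`
  -- units of net flow.
  have heneg : ∑ i ∈ act, max (-e i) 0 = ∑ i ∈ act, max (e i) 0 := by
    have : ∀ i ∈ act, max (-e i) 0 = max (e i) 0 - e i := fun i _ => by
      rcases le_total 0 (e i) with h | h
      · rw [max_eq_left h, max_eq_right (by linarith)]; ring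
      · rw [max_eq_right h, max_eq_left (by linarith)]; ring
    rw [Finset.sum_congr rfl this, Finset.sum_sub_distrib, hesum, sub_zero]
  have hev : |e v| ≤ k * Δ := by
    have h1 := Finset.single_le_sum (f := fun i => max (e i) 0) (fun i _ => le_max_right _ _) hv
    have h2 := Finset.single_le_sum (f := fun i => max (-e i) 0) (fun i _ => le_max_right _ _) hv
    refine abs_le.2 ⟨?_, ?_⟩
    · have := le_max_left (-e v) 0
      linarith
    · have := le_max_left (e v) 0
      linarith
  have hnetv : (k * k : ℝ) ≤ |net act x v| := by
    have h1 : |β v| ≤ |e v| + Δ * |net act x v| := by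
      have e1 : Δ * |net act x v| = |β v - e v| := by rw [hnet v hv, abs_mul, abs_of_pos hΔ]
      rw [e1]
      have := abs_add_le (e v) (β v - e v)
      simpa using this
    rw [hβv] at h1
    have h2 : k * k * Δ ≤ |net act x v| * Δ := by linarith
    exact le_of_mul_le_mul_right h2 hΔ
  have hkpos : 0 < k := (Finset.card_pos.2 ⟨v, hv⟩).trans_le hk
  by_contra! hcon
  -- At most `k` entries, each below `k`, cannot add up to `k²`, neither out of `v` nor into `v`.
  have hb : ∀ (f : ℕ → ℕ), (∀ j ∈ act, f j < k) → ∑ j ∈ act, (f j : ℝ) < k * k := by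
    intro f hf
    have h1 : ∑ j ∈ act, f j < k * k := by
      calc ∑ j ∈ act, f j ≤ ∑ j ∈ act, (k - 1) :=
            Finset.sum_le_sum fun j hj => by have := hf j hj; omega
        _ = act.card * (k - 1) := by rw [Finset.sum_const, smul_eq_mul]
        _ ≤ k * (k - 1) := Nat.mul_le_mul_right _ hk
        _ < k * k := Nat.mul_lt_mul_of_pos_left (by omega) hkpos
    exact_mod_cast h1
  have h1 := hb (fun j => x v j) fun j hj => hcon v hv j hj
  have h2 := hb (fun j => x j v) fun j hj => hcon j hj v hv
  have h3 : (0 : ℝ) ≤ ∑ j ∈ act, (x v j : ℝ) := Finset.sum_nonneg fun _ _ => Nat.cast_nonneg _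
  have h4 : (0 : ℝ) ≤ ∑ j ∈ act, (x j v : ℝ) := Finset.sum_nonneg fun _ _ => Nat.cast_nonneg _
  have h5 : |net act x v| < k * k := abs_lt.2 ⟨by simp only [net]; linarith,
    by simp only [net]; linarith⟩
  linarith

/-! ### Raising potentials and augmenting flow -/

/-- There is residual capacity on the pair `(u, v)`, and its reduced cost is zero. -/
def TightResidual (g : ℕ → ℕ → Prop) (w : ℕ → ℕ → ℝ) (y : ℕ → ℝ) (x : ℕ → ℕ → ℕ) (u v : ℕ) : Prop :=
  0 < x v u ∨ (g u v ∧ y u - y v = w u v)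

/-- The reduced cost of the residual pair `(u, v)`. -/
noncomputable def slack (w : ℕ → ℕ → ℝ) (y : ℕ → ℝ) (x : ℕ → ℕ → ℕ) (u v : ℕ) : ℝ :=
  if 0 < x v u then 0 else w u v - y u + y v

/-- Raise the potentials in `p` by the minimum reduced cost of a residual pair leaving `p`. -/
theorem raise (hy : Feasible act g w y) (hx : TightFlow act g w y x) (p : ℕ → Prop)
    [DecidablePred p] {s : ℝ} {u v : ℕ} (hu : u ∈ act) (hv : v ∈ act) (hpu : p u) (hpv : ¬ p v)
    (huv : 0 < x v u ∨ g u v) (hs : s = slack w y x u v)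
    (hmin : ∀ i ∈ act, ∀ j ∈ act, p i → ¬ p j → 0 < x j i ∨ g i j → s ≤ slack w y x i j)
    {y' : ℕ → ℝ} (hy' : ∀ i ∈ act, y' i = if p i then y i + s else y i) :
    Feasible act g w y' ∧ TightFlow act g w y' x ∧ TightResidual g w y' x u v ∧
      ∀ i ∈ act, ∀ j ∈ act, p i → p j → TightResidual g w y x i j → TightResidual g w y' x i j := by
  have hsl : ∀ i ∈ act, ∀ j ∈ act, g i j → slack w y x i j ≤ w i j - y i + y j := by
    intro i hi j hj hij
    rw [slack]
    split_ifs
    · linarith [hy i hi j hj hij]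
    · exact le_rfl
  have hs0 : 0 ≤ s := by
    rw [hs, slack]
    split_ifs with h
    · exact le_rfl
    · linarith [hy u hu v hv (huv.resolve_left h)]
  refine ⟨fun i hi j hj hij => ?_, fun i hi j hj hij => ?_, ?_, fun i hi j hj hpi hpj h => ?_⟩
  · have h1 := hy i hi j hj hij
    rw [hy' i hi, hy' j hj]
    by_cases hpi : p i <;> by_cases hpj : p j
    · simp only [hpi, hpj, if_true]; linarith
    · have h2 := hmin i hi j hj hpi hpj (Or.inr hij)
      have h3 := hsl i hi j hj hij
      simp only [hpi, hpj, if_true, if_false]; linarith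
    · simp only [hpi, hpj, if_true, if_false]; linarith
    · simp only [hpi, hpj, if_false]; linarith
  · obtain ⟨h1, h2, h3⟩ := hx i hi j hj hij
    refine ⟨h1, h2, ?_⟩
    rw [hy' i hi, hy' j hj]
    by_cases hpi : p i <;> by_cases hpj : p j
    · simp only [hpi, hpj, if_true]; linarith
    · have h4 := hmin i hi j hj hpi hpj (Or.inr h2)
      have h5 := hsl i hi j hj h2
      simp only [hpi, hpj, if_true, if_false]; linarith
    -- Flow into `p` makes the opposite pair a residual pair leaving `p` with reduced cost zero, so
    -- nothing is raised in this case and tightness is kept.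
    · have h4 := hmin j hj i hi hpj hpi (Or.inl hij)
      rw [slack, if_pos hij] at h4
      simp only [hpi, hpj, if_true, if_false]; linarith
    · simp only [hpi, hpj, if_false]; linarith
  · rw [TightResidual, hy' u hu, hy' v hv, if_pos hpu, if_neg hpv]
    rcases Nat.eq_zero_or_pos (x v u) with h | h
    · rw [slack, if_neg (by omega)] at hs
      refine Or.inr ⟨huv.resolve_left (by omega), ?_⟩
      linarith
    · exact Or.inl h
  · rw [TightResidual, hy' i hi, hy' j hj, if_pos hpi, if_pos hpj]
    rcases h with h | ⟨h, h'⟩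
    · exact Or.inl h
    · exact Or.inr ⟨h, by linarith⟩

theorem net_update {x' : ℕ → ℕ → ℕ} {a b : ℕ} {δ : ℝ} (ha : a ∈ act) (hb : b ∈ act)
    (hx' : ∀ i ∈ act, ∀ j ∈ act, (x' i j : ℝ) = x i j + if i = a ∧ j = b then δ else 0) {i : ℕ}
    (hi : i ∈ act) :
    net act x' i = net act x i + (if i = a then δ else 0) - if i = b then δ else 0 := by
  have e1 : ∑ j ∈ act, (x' i j : ℝ) = ∑ j ∈ act, (x i j : ℝ) + if i = a then δ else 0 := by
    rw [Finset.sum_congr rfl fun j hj => hx' i hi j hj, Finset.sum_add_distrib]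
    congr 1
    by_cases h : i = a
    · simp [h, hb]
    · simp [h]
  have e2 : ∑ j ∈ act, (x' j i : ℝ) = ∑ j ∈ act, (x j i : ℝ) + if i = b then δ else 0 := by
    rw [Finset.sum_congr rfl fun j hj => hx' j hj i hi, Finset.sum_add_distrib]
    congr 1
    by_cases h : i = b
    · simp [h, ha]
    · simp [h]
  rw [net, net, e1, e2]
  ring

/-- Sending one unit of flow along a residual pair `(u, v)` with zero reduced cost. -/
theorem push (hx : TightFlow act g w y x) (hnet : ∀ i ∈ act, β i - e i = Δ * net act x i)
    {u v : ℕ} (hu : u ∈ act) (hv : v ∈ act) (huv : u ≠ v) (hres : TightResidual g w y x u v)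
    {x' : ℕ → ℕ → ℕ} {e' : ℕ → ℝ}
    (hx' : ∀ i ∈ act, ∀ j ∈ act, x' i j = if 0 < x v u then
      (if i = v ∧ j = u then x i j - 1 else x i j) else
      (if i = u ∧ j = v then x i j + 1 else x i j))
    (he' : ∀ i ∈ act, e' i = if i = v then e i + Δ else if i = u then e i - Δ else e i) :
    TightFlow act g w y x' ∧ (∀ i ∈ act, β i - e' i = Δ * net act x' i) := by
  by_cases hpos : 0 < x v u
  · simp only [hpos, if_true] at hx'
    refine ⟨fun i hi j hj hij => hx i hi j hj ?_, fun i hi => ?_⟩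
    · rw [hx' i hi j hj] at hij
      split_ifs at hij <;> omega
    · have h1 := net_update (x := x) (x' := x') (δ := -1) hv hu (fun i hi j hj => by
        rw [hx' i hi j hj]
        split_ifs with h
        · obtain ⟨rfl, rfl⟩ := h
          rw [Nat.cast_sub hpos]; simp; ring
        · simp) hi
      have h2 := hnet i hi
      rw [h1, he' i hi]
      by_cases hiv : i = v
      · have : i ≠ u := fun h => huv (h.symm.trans hiv)
        simp only [hiv, if_true] at h2 ⊢
        rw [if_neg (by rwa [hiv] at this)]
        linarith
      · by_cases hiu : i = u
        · subst hiu
          simp only [hiv, if_true, if_false]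
          linarith
        · simp only [hiv, hiu, if_false]
          linarith
  · simp only [hpos, if_false] at hx'
    obtain ⟨hg, ht⟩ := hres.resolve_left hpos
    refine ⟨fun i hi j hj hij => ?_, fun i hi => ?_⟩
    · rw [hx' i hi j hj] at hij
      split_ifs at hij with h
      · obtain ⟨rfl, rfl⟩ := h
        exact ⟨huv, hg, ht⟩
      · exact hx i hi j hj hij
    · have h1 := net_update (x := x) (x' := x') (δ := 1) hu hv (fun i hi j hj => by
        rw [hx' i hi j hj]
        split_ifs with h
        · push_cast; ring
        · simp) hi
      have h2 := hnet i hi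
      rw [h1, he' i hi]
      by_cases hiv : i = v
      · have : i ≠ u := fun h => huv (h.symm.trans hiv)
        simp only [hiv, if_true] at h2 ⊢
        rw [if_neg (by rwa [hiv] at this)]
        linarith
      · by_cases hiu : i = u
        · subst hiu
          simp only [hiv, if_true, if_false]
          linarith
        · simp only [hiv, hiu, if_false]
          linarith

/-- Augmenting from a node with large excess to a node with large deficit reduces the total
excess. -/
theorem sum_excess_augment {s t : ℕ} (hs : s ∈ act) (ht : t ∈ act) (hes : Δ ≤ e s) (het : e t ≤ -Δ)
    (hΔ : 0 < Δ) {e' : ℕ → ℝ}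
    (he' : ∀ i ∈ act, e' i = e i + (if i = t then Δ else 0) - if i = s then Δ else 0) :
    ∑ i ∈ act, max (e' i) 0 = ∑ i ∈ act, max (e i) 0 - Δ := by
  have hst : s ≠ t := by rintro rfl; linarith
  have : ∀ i ∈ act, max (e' i) 0 = max (e i) 0 - if i = s then Δ else 0 := by
    intro i hi
    rw [he' i hi]
    by_cases h1 : i = s
    · subst h1
      rw [if_neg hst, if_pos rfl, add_zero, max_eq_left (by linarith), max_eq_left (by linarith)]
    · rw [if_neg h1, sub_zero, sub_zero]
      by_cases h2 : i = t
      · subst h2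
        rw [if_pos rfl, max_eq_right (by linarith), max_eq_right (by linarith)]
      · rw [if_neg h2, add_zero]
  rw [Finset.sum_congr rfl this, Finset.sum_sub_distrib, Finset.sum_ite_eq' act s, if_pos hs]

end DiffSystem

namespace DiffSystem

/-! ### Eliminating variables from a system of difference constraints -/

theorem Feasible.congr {act : Finset ℕ} {g : ℕ → ℕ → Prop} {w : ℕ → ℕ → ℝ} {y y' : ℕ → ℝ}
    (h : Feasible act g w y) (e : ∀ i ∈ act, y i = y' i) : Feasible act g w y' := by
  intro i hi j hj hij
  rw [← e i hi, ← e j hj]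
  exact h i hi j hj hij

/-- Maximizing `∑ i < k, b i * y i` over the solutions of the system `g₀, w₀` reduces to maximizing
`∑ i ∈ act, β i * z i` over the solutions of the system `g, w` on the indices in `act`, via
`y i = z (rep i) + sh i`. -/
structure Reduction (k : ℕ) (g₀ : ℕ → ℕ → Prop) (w₀ : ℕ → ℕ → ℝ) (b : ℕ → ℝ) (act : Finset ℕ)
    (g : ℕ → ℕ → Prop) (w : ℕ → ℕ → ℝ) (β : ℕ → ℝ) (rep : ℕ → ℕ) (sh : ℕ → ℝ) : Prop where
  subset : act ⊆ Finset.range k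
  rep_mem : ∀ i < k, rep i ∈ act
  irrefl : ∀ i ∈ act, ¬ g i i
  feasible : ∀ z, Feasible act g w z → Feasible (Finset.range k) g₀ w₀ fun i => z (rep i) + sh i
  dominates : ∀ y, Feasible (Finset.range k) g₀ w₀ y → ∃ z, Feasible act g w z ∧
    ∑ i ∈ Finset.range k, b i * y i ≤ ∑ i ∈ Finset.range k, b i * (z (rep i) + sh i)
  value : ∃ κ, ∀ z : ℕ → ℝ,
    ∑ i ∈ Finset.range k, b i * (z (rep i) + sh i) = ∑ i ∈ act, β i * z i + κ

variable {k : ℕ} {g₀ : ℕ → ℕ → Prop} {w₀ : ℕ → ℕ → ℝ} {b : ℕ → ℝ} {act : Finset ℕ}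
  {g : ℕ → ℕ → Prop} {w : ℕ → ℕ → ℝ} {β π : ℕ → ℝ} {rep : ℕ → ℕ} {sh : ℕ → ℝ}

theorem Reduction.refl (hg : ∀ i < k, ¬ g₀ i i) (hβ : ∀ i < k, β i = b i)
    (hrep : ∀ i < k, rep i = i) (hsh : ∀ i < k, sh i = 0) :
    Reduction k g₀ w₀ b (Finset.range k) g₀ w₀ β rep sh where
  subset := Finset.Subset.refl _
  rep_mem i hi := by rw [hrep i hi]; exact Finset.mem_range.2 hi
  irrefl i hi := hg i (Finset.mem_range.1 hi)
  feasible z hz := hz.congr fun i hi => by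
    rw [hrep i (Finset.mem_range.1 hi), hsh i (Finset.mem_range.1 hi), add_zero]
  dominates y hy := ⟨y, hy, le_of_eq (Finset.sum_congr rfl fun i hi => by
    rw [hrep i (Finset.mem_range.1 hi), hsh i (Finset.mem_range.1 hi), add_zero])⟩
  value := ⟨0, fun z => by
    rw [add_zero]
    refine Finset.sum_congr rfl fun i hi => ?_
    rw [hrep i (Finset.mem_range.1 hi), hsh i (Finset.mem_range.1 hi), add_zero,
      hβ i (Finset.mem_range.1 hi)]⟩

theorem Reduction.bounded (h : Reduction k g₀ w₀ b act g w β rep sh) {U : ℝ}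
    (hU : ∀ y, Feasible (Finset.range k) g₀ w₀ y → ∑ i ∈ Finset.range k, b i * y i ≤ U) :
    ∃ U', ∀ z, Feasible act g w z → ∑ i ∈ act, β i * z i ≤ U' := by
  obtain ⟨κ, hκ⟩ := h.value
  refine ⟨U - κ, fun z hz => ?_⟩
  have := hU _ (h.feasible z hz)
  rw [hκ] at this
  linarith

/-- With all remaining supplies zero, the reduced objective is constant, so every `z` reaches the
value that dominates the original system. -/
theorem Reduction.optimal (h : Reduction k g₀ w₀ b act g w β rep sh) (hβ : ∀ i ∈ act, β i = 0)
    (z : ℕ → ℝ) {y : ℕ → ℝ} (hy : Feasible (Finset.range k) g₀ w₀ y) :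
    ∑ i ∈ Finset.range k, b i * y i ≤ ∑ i ∈ Finset.range k, b i * (z (rep i) + sh i) := by
  obtain ⟨κ, hκ⟩ := h.value
  obtain ⟨z', -, hle⟩ := h.dominates y hy
  have h0 : ∀ z : ℕ → ℝ, ∑ i ∈ act, β i * z i = 0 := fun z =>
    Finset.sum_eq_zero fun i hi => by rw [hβ i hi, zero_mul]
  rw [hκ, h0] at hle
  rwa [hκ, h0]

/-- Elimination of the index `i₀`, assuming the constraint for `(i₀, j₀)` to be tight. -/
theorem Reduction.contract (h : Reduction k g₀ w₀ b act g w β rep sh) (hπ : Feasible act g w π)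
    {i₀ j₀ : ℕ} (hi₀ : i₀ ∈ act) (hj₀ : j₀ ∈ act) (hne : i₀ ≠ j₀) (hg : g i₀ j₀)
    (ht : π i₀ - π j₀ = w i₀ j₀)
    (hdom : ∀ y, Feasible act g w y → ∃ y', Feasible act g w y' ∧ y' i₀ - y' j₀ = w i₀ j₀ ∧
      ∑ i ∈ act, β i * y i ≤ ∑ i ∈ act, β i * y' i)
    {g' : ℕ → ℕ → Prop} {w' : ℕ → ℕ → ℝ} {β' : ℕ → ℝ} {rep' : ℕ → ℕ} {sh' : ℕ → ℝ}
    (hirr : ∀ i ∈ act.erase i₀, ¬ g' i i)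
    (hw' : ∀ u ∈ act.erase i₀, ∀ v ∈ act.erase i₀, u ≠ v → ∀ d,
      (g' u v → d ≤ w' u v) ↔ ((g u v → d ≤ w u v) ∧ (u = j₀ → g i₀ v → d ≤ w i₀ v - w i₀ j₀) ∧
        (v = j₀ → g u i₀ → d ≤ w u i₀ + w i₀ j₀)))
    (hβ' : ∀ i ∈ act.erase i₀, β' i = if i = j₀ then β i + β i₀ else β i)
    (hrep' : ∀ i < k, rep' i = if rep i = i₀ then j₀ else rep i)
    (hsh' : ∀ i < k, sh' i = if rep i = i₀ then sh i + w i₀ j₀ else sh i) :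
    Reduction k g₀ w₀ b (act.erase i₀) g' w' β' rep' sh' ∧ Feasible (act.erase i₀) g' w' π := by
  have hj₀' : j₀ ∈ act.erase i₀ := Finset.mem_erase.2 ⟨hne.symm, hj₀⟩
  -- Among solutions with `(i₀, j₀)` tight, the constraints at `i₀` are constraints at `j₀` shifted
  -- by `w i₀ j₀`. Comparing admitted differences `d`, as `hw'` does, treats absent and parallel
  -- constraints alike.
  have hiff : ∀ y : ℕ → ℝ, y i₀ - y j₀ = w i₀ j₀ →
      (Feasible act g w y ↔ Feasible (act.erase i₀) g' w' y) := by
    intro y hy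
    constructor
    · intro hf u hu v hv
      by_cases huv : u = v
      · subst huv
        exact fun h => absurd h (hirr u hu)
      · have hu' := Finset.mem_of_mem_erase hu
        have hv' := Finset.mem_of_mem_erase hv
        refine (hw' u hu v hv huv (y u - y v)).2 ⟨hf u hu' v hv', ?_, ?_⟩
        · rintro rfl h1
          linarith [hf i₀ hi₀ v hv' h1]
        · rintro rfl h1
          linarith [hf u hu' i₀ hi₀ h1]
    · intro hf u hu v hv huv
      by_cases hui : u = i₀
      · subst hui
        by_cases hvj : v = j₀
        · subst hvj; exact hy.le
        · have hv' : v ∈ act.erase u :=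
            Finset.mem_erase.2 ⟨fun e => h.irrefl u hu (e ▸ huv), hv⟩
          have := ((hw' j₀ hj₀' v hv' (Ne.symm hvj) (y j₀ - y v)).1
            (hf j₀ hj₀' v hv')).2.1 rfl huv
          linarith
      · have hu' : u ∈ act.erase i₀ := Finset.mem_erase.2 ⟨hui, hu⟩
        by_cases hvi : v = i₀
        · subst hvi
          by_cases huj : u = j₀
          · subst huj
            -- A constraint for the opposite pair `(j₀, i₀)` is not moved. It holds because `π`
            -- satisfies it and tightness determines the difference.
            have := hπ u hu v hv huv
            linarith
          · have := ((hw' u hu' j₀ hj₀' huj (y u - y j₀)).1 (hf u hu' j₀ hj₀')).2.2 rfl huv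
            linarith
        · have hv' : v ∈ act.erase i₀ := Finset.mem_erase.2 ⟨hvi, hv⟩
          have hne' : u ≠ v := fun e => h.irrefl u hu (e ▸ huv)
          exact ((hw' u hu' v hv' hne' (y u - y v)).1 (hf u hu' v hv')).1 huv
  have hext : ∀ z : ℕ → ℝ, z i₀ - z j₀ = w i₀ j₀ → ∀ i < k,
      z (rep i) + sh i = z (rep' i) + sh' i := by
    intro z hz i hi
    rw [hrep' i hi, hsh' i hi]
    split_ifs with e
    · rw [e]; linarith
    · rfl
  let up : (ℕ → ℝ) → ℕ → ℝ := fun z => Function.update z i₀ (z j₀ + w i₀ j₀)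
  have hup : ∀ z, up z i₀ - up z j₀ = w i₀ j₀ := fun z => by
    simp [up, Function.update_of_ne hne.symm]
  have hup' : ∀ z, ∀ i, i ≠ i₀ → up z i = z i := fun z i hi => Function.update_of_ne hi _ _
  have hrep_ne : ∀ i < k, rep' i ≠ i₀ := fun i hi => by
    rw [hrep' i hi]
    split_ifs with e
    · exact hne.symm
    · exact e
  have hext' : ∀ z : ℕ → ℝ, ∀ i < k, up z (rep i) + sh i = z (rep' i) + sh' i := fun z i hi => by
    rw [hext _ (hup z) i hi, hup' z _ (hrep_ne i hi)]
  refine ⟨⟨(Finset.erase_subset _ _).trans h.subset, fun i hi => ?_, hirr, fun z hz => ?_,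
    fun y hy => ?_, ?_⟩, (hiff π ht).1 hπ⟩
  · refine Finset.mem_erase.2 ⟨hrep_ne i hi, ?_⟩
    rw [hrep' i hi]
    split_ifs
    · exact hj₀
    · exact h.rep_mem i hi
  · have h1 : Feasible act g w (up z) := (hiff _ (hup z)).2
      (hz.congr fun i hi => (hup' z i (Finset.ne_of_mem_erase hi)).symm)
    exact (h.feasible _ h1).congr fun i hi => hext' z i (Finset.mem_range.1 hi)
  · obtain ⟨κ, hκ⟩ := h.value
    obtain ⟨z, hz, hle⟩ := h.dominates y hy
    obtain ⟨z', hz', ht', hle'⟩ := hdom z hz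
    refine ⟨z', (hiff z' ht').1 hz', ?_⟩
    have e : ∑ i ∈ Finset.range k, b i * (z' (rep' i) + sh' i) =
        ∑ i ∈ Finset.range k, b i * (z' (rep i) + sh i) :=
      Finset.sum_congr rfl fun i hi => by rw [hext z' ht' i (Finset.mem_range.1 hi)]
    rw [e, hκ]
    rw [hκ] at hle
    linarith
  · obtain ⟨κ, hκ⟩ := h.value
    refine ⟨β i₀ * w i₀ j₀ + κ, fun z => ?_⟩
    have e : ∑ i ∈ Finset.range k, b i * (z (rep' i) + sh' i) =
        ∑ i ∈ Finset.range k, b i * (up z (rep i) + sh i) :=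
      Finset.sum_congr rfl fun i hi => by rw [hext' z i (Finset.mem_range.1 hi)]
    rw [e, hκ, ← Finset.add_sum_erase _ _ hi₀, ← Finset.add_sum_erase _ _ hj₀',
      ← Finset.add_sum_erase (act.erase i₀) _ hj₀', hβ' j₀ hj₀', if_pos rfl, hup' z j₀ hne.symm]
    have e2 : ∑ i ∈ (act.erase i₀).erase j₀, β' i * z i =
        ∑ i ∈ (act.erase i₀).erase j₀, β i * up z i :=
      Finset.sum_congr rfl fun i hi => by
        have h1 := Finset.mem_of_mem_erase hi
        rw [hβ' i h1, if_neg (Finset.ne_of_mem_erase hi), hup' z i (Finset.ne_of_mem_erase h1)]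
    have e3 : up z i₀ = z j₀ + w i₀ j₀ := Function.update_self _ _ _
    rw [e2, e3]
    ring

end DiffSystem

/-! ### The dual transportation problem as a system of difference constraints -/

namespace Network

open DiffSystem

variable {n m : ℕ} {N : Network (Fin n) (Fin m)}

/-- The system of difference constraints, indexed by the terminals, whose solutions are the
feasible dual solutions. -/
structure IsDualSystem (N : Network (Fin n) (Fin m)) {k : ℕ} (t : Fin k → Fin n)
    (g : ℕ → ℕ → Prop) (w : ℕ → ℕ → ℝ) (b : ℕ → ℝ) : Prop where
  inj : Function.Injective t
  surj : ∀ v, N.b v ≠ 0 → ∃ i, t i = v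
  b_eq : ∀ i : Fin k, b i = N.b (t i)
  rel_iff : ∀ i j : Fin k, g i j ↔ 0 < N.b (t i) ∧ N.b (t j) < 0 ∧ ∃ p, N.IsPath (t i) (t j) p
  cost : ∀ i j : Fin k, g i j → N.IsCheapestCost N.cost (t i) (t j) (w i j)

variable {k : ℕ} {t : Fin k → Fin n} {g : ℕ → ℕ → Prop} {w : ℕ → ℕ → ℝ} {b : ℕ → ℝ}

theorem IsDualSystem.sum_eq (h : N.IsDualSystem t g w b) {y : Fin n → ℝ} {z : ℕ → ℝ}
    (hyz : ∀ i : Fin k, z i = y (t i)) :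
    ∑ i ∈ Finset.range k, b i * z i = N.dualValue y := by
  classical
  rw [dualValue_eq_sum, Finset.sum_range, ← Finset.sum_subset (Finset.subset_univ
    (Finset.univ.image t)), Finset.sum_image fun i _ j _ e => h.inj e]
  · exact Finset.sum_congr rfl fun i _ => by rw [h.b_eq, hyz]
  · intro v _ hv
    have : N.b v = 0 := by
      by_contra hne
      obtain ⟨i, rfl⟩ := h.surj v hne
      exact hv (Finset.mem_image_of_mem t (Finset.mem_univ i))
    rw [this, zero_mul]

theorem IsDualSystem.feasible_iff (h : N.IsDualSystem t g w b) {y : Fin n → ℝ} {z : ℕ → ℝ}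
    (hyz : ∀ i : Fin k, z i = y (t i)) :
    DiffSystem.Feasible (Finset.range k) g w z ↔ N.IsDualFeasible y := by
  constructor
  · rintro hz s u x hs hu hx
    obtain ⟨i, rfl⟩ := h.surj s hs.ne'
    obtain ⟨j, rfl⟩ := h.surj u hu.ne
    have hg := (h.rel_iff i j).2 ⟨hs, hu, hx.choose, hx.choose_spec.1.1⟩
    have h1 := hz i (Finset.mem_range.2 i.2) j (Finset.mem_range.2 j.2) hg
    obtain ⟨p, hp, e⟩ := h.cost i j hg
    obtain ⟨q, hq, rfl⟩ := hx
    have h2 := hp.2 q hq.1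
    rw [hyz, hyz, ← e] at h1
    linarith
  · intro hy i hi j hj hij
    lift i to Fin k using Finset.mem_range.1 hi
    lift j to Fin k using Finset.mem_range.1 hj
    obtain ⟨h1, h2, -⟩ := (h.rel_iff i j).1 hij
    rw [hyz, hyz]
    exact hy _ _ _ h1 h2 (h.cost i j hij)

/-- By weak duality, the cost of any transshipment over time is an upper bound. -/
theorem IsDualSystem.bounded (h : N.IsDualSystem t g w b) {M : FlowModel} (hN : N.Feasible M) :
    ∃ U, ∀ z, DiffSystem.Feasible (Finset.range k) g w z → ∑ i ∈ Finset.range k, b i * z i ≤ U := by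
  obtain ⟨θ, f, hf⟩ := hN
  refine ⟨N.flowCost θ f, fun z hz => ?_⟩
  have hyz : ∀ i : Fin k, z i = Function.extend t (fun i : Fin k => z i) 0 (t i) := fun i =>
    (h.inj.extend_apply (fun i : Fin k => z i) 0 i).symm
  rw [h.sum_eq hyz]
  exact hf.dualValue_le ((h.feasible_iff hyz).1 hz)

theorem IsDualSystem.isOptimalDual (h : N.IsDualSystem t g w b) {y : Fin n → ℝ} {z : ℕ → ℝ}
    (hyz : ∀ i : Fin k, z i = y (t i)) (hz : DiffSystem.Feasible (Finset.range k) g w z)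
    (hopt : ∀ z', DiffSystem.Feasible (Finset.range k) g w z' →
      ∑ i ∈ Finset.range k, b i * z' i ≤ ∑ i ∈ Finset.range k, b i * z i) :
    N.IsOptimalDual y := by
  refine ⟨(h.feasible_iff hyz).1 hz, fun y' hy' => ?_⟩
  have hyz' : ∀ i : Fin k, Function.extend Fin.val (fun i => y' (t i)) 0 (i : ℕ) = y' (t i) :=
    fun i => Fin.val_injective.extend_apply _ _ i
  rw [← h.sum_eq hyz, ← h.sum_eq hyz']
  exact hopt _ ((h.feasible_iff hyz').2 hy')

end Network

namespace RealRAM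

/-- The scalar real variable number `x`. -/
@[simp] def RExpr.var (x : ℕ) : RExpr := .get x (.lit 0) (.lit 0)

/-- Set the scalar variable number `x`. -/
@[simp] def Program.assign (x : ℕ) (e : NExpr) : Program := .setNat x (.lit 0) (.lit 0) e

/-- Set the scalar real variable number `x`. -/
@[simp] def Program.assignReal (x : ℕ) (e : RExpr) : Program := .setReal x (.lit 0) (.lit 0) e

/-- Do nothing if the test fails. -/
@[simp] def Program.when (T : Test) (P : Program) : Program := .cond T P skip

/-! ### Step 2: the dual of the transportation problem

The terminals are indexed by `0, …, x₇ - 1`. The natural arrays hold the relation (22), the active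
indices (24), the representatives (25), the flow (28), and the labels (30) and predecessors (31) of
the search. The real arrays hold the supplies (20), the right-hand sides (22), the potentials
(23), the shifts of the representatives (25), and the excesses (29). The scalars are the
next label (32), the status of the search (33; one: augmenting path found, two: none exists), the end
of the augmenting path (34), the best pair found in a scan (35, 36, 37) and its reduced cost (real
33), the unit of flow (real 32), and the maximum supply (real 34). -/

/-- Compute whether `(x₄₁, x₄₂)` is a residual pair, and its reduced cost. -/
def inspectPair : Program :=
  .cond (.natLe (.lit 1) (.get 28 (.var 42) (.var 41)))
    (.seq (.assign 43 (.lit 1)) (.assignReal 36 (.lit 0)))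
    (.seq (.assign 43 (.get 22 (.var 41) (.var 42)))
      (.assignReal 36 (.add (.sub (.get 22 (.var 41) (.var 42)) (.get 23 (.var 41) (.lit 0)))
        (.get 23 (.var 42) (.lit 0)))))

/-- Compare the pair `(x₄₁, x₄₂)` with the best pair found so far. -/
def comparePair : Program :=
  .when (.and
      (.and (.and (.natLe (.lit 1) (.get 24 (.var 41) (.lit 0)))
          (.natLe (.lit 1) (.get 24 (.var 42) (.lit 0))))
        (.and (.natLe (.lit 1) (.get 30 (.var 41) (.lit 0)))
          (.natLe (.get 30 (.var 42) (.lit 0)) (.lit 0))))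
      (.and (.natLe (.lit 1) (.var 43))
        (.not (.and (.natLe (.lit 1) (.var 35)) (.realLe (.var 33) (.var 36))))))
    (.seq (.seq (.assign 35 (.lit 1)) (.assign 36 (.var 41)))
      (.seq (.assign 37 (.var 42)) (.assignReal 33 (.var 36))))

/-- Find a residual pair of minimum reduced cost that leaves the set of labelled indices. -/
def scan : Program :=
  .seq (.assign 35 (.lit 0)) (.forUpTo 41 7 (.forUpTo 42 7 (.seq inspectPair comparePair)))

/-- Raise the potentials of the labelled indices by `x₃₃`. -/
def raisePotentials : Program :=
  .forUpTo 41 7 (.when (.natLe (.lit 1) (.get 30 (.var 41) (.lit 0)))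
    (.setReal 23 (.var 41) (.lit 0) (.add (.get 23 (.var 41) (.lit 0)) (.var 33))))

/-- Label `x₃₇`, with predecessor `x₃₆`. -/
def storeLabel : Program :=
  .seq (.seq (.setNat 30 (.var 37) (.lit 0) (.var 32)) (.setNat 31 (.var 37) (.lit 0) (.var 36)))
    (.assign 32 (.add (.var 32) (.lit 1)))

/-- Label `x₃₇`, and check whether it has a large deficit. -/
def labelBest : Program :=
  .seq storeLabel
    (.when (.realLe (.get 29 (.var 37) (.lit 0)) (.sub (.lit 0) (.var 32)))
      (.seq (.assign 33 (.lit 1)) (.assign 34 (.var 37))))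

/-- Extend the search by one index, if possible. -/
def searchStep : Program :=
  .seq scan (.cond (.natLe (.var 35) (.lit 0)) (.assign 33 (.lit 2)) (.seq raisePotentials labelBest))

/-- Label the indices with large excess. -/
def startSearch : Program :=
  .seq
    (.forUpTo 41 7 (.cond (.and (.natLe (.lit 1) (.get 24 (.var 41) (.lit 0)))
        (.realLe (.var 32) (.get 29 (.var 41) (.lit 0))))
      (.setNat 30 (.var 41) (.lit 0) (.lit 1)) (.setNat 30 (.var 41) (.lit 0) (.lit 0))))
    (.seq (.assign 32 (.lit 2)) (.assign 33 (.lit 0)))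

/-- Search for an augmenting path. -/
def search : Program :=
  .seq startSearch (.loop (.natLe (.var 33) (.lit 0)) searchStep)

/-- Send one unit of flow along the last pair of the augmenting path. -/
def pushLast : Program :=
  .seq (.assign 38 (.get 31 (.var 34) (.lit 0)))
    (.seq
      (.cond (.natLe (.lit 1) (.get 28 (.var 34) (.var 38)))
        (.setNat 28 (.var 34) (.var 38) (.sub (.get 28 (.var 34) (.var 38)) (.lit 1)))
        (.setNat 28 (.var 38) (.var 34) (.add (.get 28 (.var 38) (.var 34)) (.lit 1))))
      (.seq
        (.seq (.setReal 29 (.var 38) (.lit 0) (.sub (.get 29 (.var 38) (.lit 0)) (.var 32)))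
          (.setReal 29 (.var 34) (.lit 0) (.add (.get 29 (.var 34) (.lit 0)) (.var 32))))
        (.assign 34 (.var 38))))

/-- Send one unit of flow along the augmenting path. -/
def augment : Program :=
  .loop (.natLe (.lit 2) (.get 30 (.var 34) (.lit 0))) pushLast

/-- Augment the flow until there is no augmenting path. -/
def augmentAll : Program :=
  .loop (.natLe (.var 33) (.lit 1)) (.seq search (.when (.natLe (.var 33) (.lit 1)) augment))

end RealRAM

/-! ### Analysis of the search for an augmenting path -/

namespace DiffSystem

open RealRAM

/-- The memory holds a system of difference constraints. -/
structure HoldsSystem (k : ℕ) (act : Finset ℕ) (g : ℕ → ℕ → Prop) (w : ℕ → ℕ → ℝ) (σ : Mem) :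
    Prop where
  size : σ.nat 7 0 0 = k
  subset : act ⊆ Finset.range k
  active : ∀ i < k, 1 ≤ σ.nat 24 i 0 ↔ i ∈ act
  rel : ∀ i ∈ act, ∀ j ∈ act, 1 ≤ σ.nat 22 i j ↔ g i j
  cost : σ.real 22 = w

variable {k : ℕ} {act : Finset ℕ} {g : ℕ → ℕ → Prop} {w : ℕ → ℕ → ℝ} {β : ℕ → ℝ} {Δ : ℝ}
  {σ τ : Mem}

theorem HoldsSystem.of_frame {P : Program} (h : HoldsSystem k act g w σ) (hf : Frame P σ τ)
    (hn : ∀ z ∈ [7, 22, 24], z ∉ P.natW) (hr : 22 ∉ P.realW) : HoldsSystem k act g w τ where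
  size := by rw [hf.nat 7 (hn 7 (by decide)), h.size]
  subset := h.subset
  active := by rw [hf.nat 24 (hn 24 (by decide))]; exact h.active
  rel := by rw [hf.nat 22 (hn 22 (by decide))]; exact h.rel
  cost := by rw [hf.real 22 hr, h.cost]

theorem HoldsSystem.lt (h : HoldsSystem k act g w σ) {i : ℕ} (hi : i ∈ act) : i < k :=
  Finset.mem_range.1 (h.subset hi)

/-- The potentials held in memory. -/
def potential (σ : Mem) : ℕ → ℝ := fun i => σ.real 23 i 0

/-- The excesses held in memory. -/
def excess (σ : Mem) : ℕ → ℝ := fun i => σ.real 29 i 0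

/-- `(u, v)` is a residual pair that leaves the set of labelled indices. -/
def IsLeaving (act : Finset ℕ) (g : ℕ → ℕ → Prop) (σ : Mem) (u v : ℕ) : Prop :=
  (u ∈ act ∧ v ∈ act) ∧ (1 ≤ σ.nat 30 u 0 ∧ σ.nat 30 v 0 = 0) ∧ (0 < σ.nat 28 v u ∨ g u v)

/-- The reduced costs held in memory. -/
noncomputable def slackOf (σ : Mem) : ℕ → ℕ → ℝ :=
  slack (σ.real 22) (potential σ) (σ.nat 28)

/-- The memory `τ` holds the best leaving pair among those in `S`. -/
def HoldsBest (act : Finset ℕ) (g : ℕ → ℕ → Prop) (σ : Mem) (S : Set (ℕ × ℕ)) (τ : Mem) : Prop :=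
  (τ.nat 35 0 0 = 0 ∧ ∀ z ∈ S, ¬ IsLeaving act g σ z.1 z.2) ∨
    (τ.nat 35 0 0 = 1 ∧ IsLeaving act g σ (τ.nat 36 0 0) (τ.nat 37 0 0) ∧
      τ.real 33 0 0 = slackOf σ (τ.nat 36 0 0) (τ.nat 37 0 0) ∧
      ∀ z ∈ S, IsLeaving act g σ z.1 z.2 → τ.real 33 0 0 ≤ slackOf σ z.1 z.2)

theorem runs_inspectPair (hσ : HoldsSystem k act g w σ) {u v : ℕ} (h41 : σ.nat 41 0 0 = u)
    (h42 : σ.nat 42 0 0 = v) :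
    Runs inspectPair σ 3 fun τ => τ.real 36 0 0 = slackOf σ u v ∧
      (u ∈ act → v ∈ act → (1 ≤ τ.nat 43 0 0 ↔ 0 < σ.nat 28 v u ∨ g u v)) := by
  refine Runs.of_wp le_rfl ?_
  simp only [inspectPair, Program.wp, Program.assign, Program.assignReal, Test.Holds, NExpr.eval,
    RExpr.eval, NExpr.var, h41, h42, Nat.one_le_iff_ne_zero]
  refine ⟨fun h => ?_, fun h => ?_⟩
  · have h' : 0 < σ.nat 28 v u := Nat.pos_of_ne_zero h
    simp [update_apply, slackOf, slack, h']
  · have h' : σ.nat 28 v u = 0 := not_not.1 h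
    refine ⟨by simp [update_apply, slackOf, slack, h', potential, h41, h42], fun hu hv => ?_⟩
    have := hσ.rel u hu v hv
    simp [update_apply, h', ← this, Nat.one_le_iff_ne_zero]

theorem runs_comparePair {u v : ℕ} (hu : u < k) (hv : v < k)
    {S : Set (ℕ × ℕ)} {τ : Mem} (hτ : HoldsSystem k act g w τ) (h41 : τ.nat 41 0 0 = u)
    (h42 : τ.nat 42 0 0 = v) (h30 : τ.nat 30 = σ.nat 30) (h36 : τ.real 36 0 0 = slackOf σ u v)
    (h43 : u ∈ act → v ∈ act → (1 ≤ τ.nat 43 0 0 ↔ 0 < σ.nat 28 v u ∨ g u v))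
    (hS : HoldsBest act g σ S τ) :
    Runs comparePair τ 5 (HoldsBest act g σ (insert (u, v) S)) := by
  refine Runs.of_wp le_rfl ?_
  have hiff : (((1 ≤ τ.nat 24 u 0 ∧ 1 ≤ τ.nat 24 v 0) ∧ 1 ≤ τ.nat 30 u 0 ∧ τ.nat 30 v 0 ≤ 0) ∧
      1 ≤ τ.nat 43 0 0) ↔ IsLeaving act g σ u v := by
    rw [hτ.active u hu, hτ.active v hv, h30, IsLeaving, Nat.le_zero, and_assoc]
    constructor
    · rintro ⟨h1, h2, h3⟩
      exact ⟨h1, h2, (h43 h1.1 h1.2).1 h3⟩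
    · rintro ⟨h1, h2, h3⟩
      exact ⟨h1, h2, (h43 h1.1 h1.2).2 h3⟩
  simp only [comparePair, Program.when, Program.wp, Program.assign, Program.assignReal, Test.Holds,
    NExpr.eval, RExpr.eval, NExpr.var, RExpr.var, h41, h42, h36, ← and_assoc]
  simp only [← and_assoc] at hiff
  rw [hiff]
  refine ⟨fun ⟨h1, h2⟩ => Or.inr ⟨by simp [update_apply], ?_, ?_, ?_⟩, fun h => ?_⟩
  · simpa [update_apply, h41, h42] using h1
  · simp [update_apply, h41, h42]
  · rintro z (rfl | hz) hlz
    · simp [update_apply]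
    · rcases hS with ⟨h3, h4⟩ | ⟨h3, -, -, h4⟩
      · exact absurd hlz (h4 z hz)
      · rw [not_and, not_le] at h2
        simpa [update_apply] using (h2 h3.ge).le.trans (h4 z hz hlz)
  · have hS' : HoldsBest act g σ (insert (u, v) S) τ := by
      rcases hS with ⟨h3, h4⟩ | ⟨h3, h4, h5, h6⟩
      · refine Or.inl ⟨h3, ?_⟩
        rintro z (rfl | hz)
        · exact fun h1 => h ⟨h1, fun h2 => by omega⟩
        · exact h4 z hz
      · refine Or.inr ⟨h3, h4, h5, ?_⟩
        rintro z (rfl | hz) hlz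
        · by_contra h7
          exact h ⟨hlz, fun h2 => h7 h2.2⟩
        · exact h6 z hz hlz
    simpa [HoldsBest, RealRAM.skip, update_apply] using hS'

theorem runs_scan (hσ : HoldsSystem k act g w σ) :
    Runs scan σ (k * ((k * (8 + 2) + 2) + 2) + 3)
      (HoldsBest act g σ {z | z.1 < k ∧ z.2 < k}) := by
  refine ((Runs.of_wp (B := 1) (Q := fun τ => τ.nat 35 0 0 = 0) le_rfl
    (by simp [update_apply])).seq fun τ hf hτ => Runs.forUpTo₂ (N := k) (B := 8)
      (HoldsBest act g σ) ?_ (by decide) (by decide) (by decide) (by decide) (by decide)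
      (by decide) ?_ ?_ (Or.inl ⟨hτ, fun z hz => absurd hz (Set.notMem_empty z)⟩) ?_).mono
    (by omega) fun _ _ h => h
  · rw [hf.nat 7 (by decide), hσ.size]
  · intro S υ c h
    rw [HoldsBest] at h ⊢
    rwa [υ.setVar_nat_of_ne c (by decide), υ.setVar_nat_of_ne c (by decide),
      υ.setVar_nat_of_ne c (by decide), υ.setVar_real]
  · intro S υ c h
    rw [HoldsBest] at h ⊢
    rwa [υ.setVar_nat_of_ne c (by decide), υ.setVar_nat_of_ne c (by decide),
      υ.setVar_nat_of_ne c (by decide), υ.setVar_real]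
  · intro u hu v hv S υ hυ h41 h42 hS
    have hυ' := (hσ.of_frame hf (by decide) (by decide)).of_frame hυ (by decide) (by decide)
    have e28 : υ.nat 28 = σ.nat 28 := (hυ.nat 28 (by decide)).trans (hf.nat 28 (by decide))
    have e30 : υ.nat 30 = σ.nat 30 := (hυ.nat 30 (by decide)).trans (hf.nat 30 (by decide))
    have e22 : υ.real 22 = σ.real 22 := (hυ.real 22 (by decide)).trans (hf.real 22 (by decide))
    have e23 : υ.real 23 = σ.real 23 := (hυ.real 23 (by decide)).trans (hf.real 23 (by decide))
    have es : slackOf υ = slackOf σ := by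
      unfold slackOf potential
      rw [e28, e22, e23]
    refine (runs_inspectPair hυ' h41 h42).seq (B' := 5) fun ω hω h => ?_
    rw [es, e28] at h
    refine runs_comparePair hu hv (hυ'.of_frame hω (by decide) (by decide))
      (by rw [hω.nat 41 (by decide), h41]) (by rw [hω.nat 42 (by decide), h42])
      (by rw [hω.nat 30 (by decide), e30]) h.1 h.2 ?_
    rw [HoldsBest] at hS ⊢
    rwa [hω.nat 35 (by decide), hω.nat 36 (by decide), hω.nat 37 (by decide),
      hω.real 33 (by decide)]

theorem runs_raisePotentials (hσ : HoldsSystem k act g w σ) {s : ℝ} (hs : σ.real 33 0 0 = s) :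
    Runs raisePotentials σ (k * (2 + 2) + 2) fun τ => ∀ i < k,
      potential τ i = if 1 ≤ σ.nat 30 i 0 then potential σ i + s else potential σ i := by
  refine (Runs.forUpTo (N := k) (B := 2) (fun j τ => ∀ i, potential τ i =
    if i < j ∧ 1 ≤ σ.nat 30 i 0 then potential σ i + s else potential σ i) hσ.size (by decide)
    (by decide) (by decide) (fun j τ c h => h) (fun i => by simp) ?_).mono le_rfl
    fun τ _ h i hi => ?_
  · intro j hj τ hτ h41 h
    refine Runs.of_wp le_rfl ?_
    have hj' : potential τ j = potential σ j := by rw [h j]; simp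
    have e33 : τ.real 33 0 0 = s := by rw [hτ.real 33 (by decide), hs]
    simp only [Program.when, Program.wp, Test.Holds, NExpr.eval, NExpr.var, RExpr.eval, RExpr.var,
      h41, hτ.nat 30 (by decide), e33]
    refine ⟨fun hL i => ?_, fun hL i => ?_⟩
    · by_cases hij : i = j
      · subst hij
        rw [if_pos ⟨Nat.lt_succ_self _, hL⟩, ← hj']
        simp [potential, update_apply]
      · rw [if_congr (show (i < j + 1 ∧ 1 ≤ σ.nat 30 i 0) ↔ (i < j ∧ 1 ≤ σ.nat 30 i 0) by omega)
          rfl rfl, ← h i]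
        simp [potential, update_apply, hij]
    · have : (i < j + 1 ∧ 1 ≤ σ.nat 30 i 0) ↔ (i < j ∧ 1 ≤ σ.nat 30 i 0) := by
        refine ⟨fun h' => ⟨?_, h'.2⟩, fun h' => ⟨by omega, h'.2⟩⟩
        by_contra hij
        obtain rfl : i = j := by omega
        exact hL h'.2
      rw [if_congr this rfl rfl, ← h i]
      rfl
  · rw [h i]
    simp [hi]

end DiffSystem

namespace DiffSystem

open RealRAM

variable {k : ℕ} {act : Finset ℕ} {g : ℕ → ℕ → Prop} {w : ℕ → ℕ → ℝ} {β : ℕ → ℝ} {Δ : ℝ}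
  {σ τ : Mem}

/-- The memory holds potentials and a tight flow, in units of `Δ`, with supplies `β` and the
excesses held in memory. -/
structure HoldsFlow (act : Finset ℕ) (g : ℕ → ℕ → Prop) (w : ℕ → ℕ → ℝ) (β : ℕ → ℝ) (Δ : ℝ)
    (σ : Mem) : Prop where
  unit : σ.real 32 0 0 = Δ
  feasible : Feasible act g w (potential σ)
  tight : TightFlow act g w (potential σ) (σ.nat 28)
  net_eq : ∀ i ∈ act, β i - excess σ i = Δ * net act (σ.nat 28) i

theorem HoldsFlow.of_frame {P : Program} (h : HoldsFlow act g w β Δ σ) (hf : Frame P σ τ)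
    (hn : 28 ∉ P.natW) (hr : ∀ z ∈ [23, 29, 32], z ∉ P.realW) : HoldsFlow act g w β Δ τ := by
  have e23 : potential τ = potential σ := by
    unfold potential; rw [hf.real 23 (hr 23 (by decide))]
  have e29 : excess τ = excess σ := by
    unfold excess; rw [hf.real 29 (hr 29 (by decide))]
  have e28 := hf.nat 28 hn
  constructor
  · rw [hf.real 32 (hr 32 (by decide)), h.unit]
  · rw [e23]; exact h.feasible
  · rw [e23, e28]; exact h.tight
  · rw [e29, e28]; exact h.net_eq

/-- Each index `i` with label at least two can be reached from its predecessor, which has a smaller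
label, by a tight residual pair. The indices with label one are those with large excess. -/
def HoldsLabels (act : Finset ℕ) (g : ℕ → ℕ → Prop) (w : ℕ → ℕ → ℝ) (Δ : ℝ) (σ : Mem) : Prop :=
  ∀ i ∈ act, (σ.nat 30 i 0 = 0 ∧ excess σ i < Δ) ∨ (σ.nat 30 i 0 = 1 ∧ Δ ≤ excess σ i) ∨
    (2 ≤ σ.nat 30 i 0 ∧ σ.nat 31 i 0 ∈ act ∧ 1 ≤ σ.nat 30 (σ.nat 31 i 0) 0 ∧
      σ.nat 30 (σ.nat 31 i 0) 0 < σ.nat 30 i 0 ∧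
      TightResidual g w (potential σ) (σ.nat 28) (σ.nat 31 i 0) i)

/-- The number of indices without label. -/
def numUnlabelled (act : Finset ℕ) (σ : Mem) : ℕ := (act.filter fun i => σ.nat 30 i 0 = 0).card

/-- The search is in progress. -/
structure Searching (k : ℕ) (act : Finset ℕ) (Δ : ℝ) (r : ℕ) (σ : Mem) : Prop where
  status : σ.nat 33 0 0 = 0
  excess_gt : ∀ i ∈ act, 1 ≤ σ.nat 30 i 0 → -Δ < excess σ i
  lt : numUnlabelled act σ < r
  two_le : 2 ≤ σ.nat 32 0 0
  label_lt : ∀ i ∈ act, σ.nat 30 i 0 < σ.nat 32 0 0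
  le : σ.nat 32 0 0 + numUnlabelled act σ ≤ k + 2

/-- The search has found an augmenting path. -/
structure FoundPath (k : ℕ) (act : Finset ℕ) (Δ : ℝ) (σ : Mem) : Prop where
  status : σ.nat 33 0 0 = 1
  mem : σ.nat 34 0 0 ∈ act
  two_le : 2 ≤ σ.nat 30 (σ.nat 34 0 0) 0
  le : σ.nat 30 (σ.nat 34 0 0) 0 ≤ k + 1
  excess_le : excess σ (σ.nat 34 0 0) ≤ -Δ

/-- There is no augmenting path. -/
structure NoPath (act : Finset ℕ) (g : ℕ → ℕ → Prop) (Δ : ℝ) (σ : Mem) : Prop where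
  status : σ.nat 33 0 0 = 2
  excess_gt : ∀ i ∈ act, 1 ≤ σ.nat 30 i 0 → -Δ < excess σ i
  closed : ∀ i j, ¬ IsLeaving act g σ i j

/-- The invariant of the search. -/
def SearchState (k : ℕ) (act : Finset ℕ) (g : ℕ → ℕ → Prop) (w : ℕ → ℕ → ℝ) (β : ℕ → ℝ) (Δ : ℝ)
    (r : ℕ) (σ : Mem) : Prop :=
  HoldsFlow act g w β Δ σ ∧ HoldsLabels act g w Δ σ ∧
    (Searching k act Δ r σ ∨ FoundPath k act Δ σ ∨ NoPath act g Δ σ)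

/-- The new label exceeds all earlier ones, so predecessors have smaller labels. Each labelling
trades one unlabelled index for an increment of the next label, so their sum is preserved; this
bounds labels by `k + 1` and the number of search steps. -/
theorem runs_labelBest {r : ℕ} {u v : ℕ} (hf : HoldsFlow act g w β Δ σ)
    (hl : HoldsLabels act g w Δ σ) (hs : Searching k act Δ r σ) (h36 : σ.nat 36 0 0 = u)
    (h37 : σ.nat 37 0 0 = v) (hu : u ∈ act) (hv : v ∈ act) (hLu : 1 ≤ σ.nat 30 u 0)
    (hLv : σ.nat 30 v 0 = 0) (ht : TightResidual g w (potential σ) (σ.nat 28) u v) :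
    Runs labelBest σ 6 fun τ => HoldsLabels act g w Δ τ ∧
      ((∃ r' < r, Searching k act Δ r' τ) ∨ FoundPath k act Δ τ) := by
  have huv : u ≠ v := by rintro rfl; omega
  have h1 : Runs storeLabel σ 3 fun τ => τ.nat 32 0 0 = σ.nat 32 0 0 + 1 ∧
      (∀ i, τ.nat 30 i 0 = if i = v then σ.nat 32 0 0 else σ.nat 30 i 0) ∧
      (∀ i, τ.nat 31 i 0 = if i = v then u else σ.nat 31 i 0) := by
    refine Runs.of_wp le_rfl ?_
    simp [storeLabel, update_apply, h36, h37]
  refine (h1.seq (B' := 3) fun τ hτ ⟨hq, hL, hP⟩ => ?_).mono le_rfl fun _ _ h => h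
  have hf' := hf.of_frame hτ (by decide) (by decide)
  have e23 : potential τ = potential σ := by unfold potential; rw [hτ.real 23 (by decide)]
  have e29 : excess τ = excess σ := by unfold excess; rw [hτ.real 29 (by decide)]
  have e28 := hτ.nat 28 (by decide)
  have e33 := hτ.nat 33 (by decide)
  have e37 : τ.nat 37 0 0 = v := by rw [hτ.nat 37 (by decide), h37]
  have hq2 := hs.two_le
  have hl' : HoldsLabels act g w Δ τ := by
    intro i hi
    rw [e23, e29, e28, hL i, hP i]
    by_cases hiv : i = v
    · subst hiv
      simp only [if_true]
      refine Or.inr (Or.inr ⟨hq2, hu, ?_, ?_, ht⟩) <;> rw [hL u, if_neg huv]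
      · exact hLu
      · exact hs.label_lt u hu
    · simp only [hiv, if_false]
      rcases hl i hi with h | h | ⟨h1, h2, h3, h4, h5⟩
      · exact Or.inl h
      · exact Or.inr (Or.inl h)
      · have hne : σ.nat 31 i 0 ≠ v := fun e => by rw [e] at h3; omega
        rw [hL, if_neg hne]
        exact Or.inr (Or.inr ⟨h1, h2, h3, h4, h5⟩)
  have hunl : numUnlabelled act τ + 1 = numUnlabelled act σ := by
    have : act.filter (fun i => τ.nat 30 i 0 = 0) =
        (act.filter fun i => σ.nat 30 i 0 = 0).erase v := by
      ext i
      simp only [Finset.mem_filter, Finset.mem_erase, hL i]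
      by_cases hiv : i = v
      · simp only [hiv, if_true]
        constructor
        · omega
        · tauto
      · simp [hiv]
    rw [numUnlabelled, this, Finset.card_erase_of_mem (Finset.mem_filter.2 ⟨hv, hLv⟩),
      numUnlabelled]
    have : 0 < (act.filter fun i => σ.nat 30 i 0 = 0).card :=
      Finset.card_pos.2 ⟨v, Finset.mem_filter.2 ⟨hv, hLv⟩⟩
    omega
  have hlt := hs.lt
  have hle := hs.le
  refine Runs.of_wp (by decide) ?_
  simp only [Program.when, Program.wp, Program.assign, Test.Holds, NExpr.eval, NExpr.var,
    RExpr.eval, RExpr.var, e37, hf'.unit, Rat.cast_zero, zero_sub]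
  have hev : τ.real 29 v 0 = excess σ v := by rw [← e29]; rfl
  rw [hev]
  have hmem : ∀ (nat : ℕ → ℕ → ℕ → ℕ), nat 30 = τ.nat 30 → nat 31 = τ.nat 31 →
      nat 28 = τ.nat 28 → HoldsLabels act g w Δ { τ with nat := nat } := by
    intro nat h30 h31 h28 i hi
    have := hl' i hi
    dsimp only
    rw [h30, h31, h28]
    exact this
  have hup : ∀ (f : ℕ → ℕ → ℕ → ℕ) (x c y : ℕ), y ≠ x → update f x 0 0 c y = f y := by
    intro f x c y h
    funext i j
    simp [update_apply, h]
  refine ⟨fun h => ⟨?_, Or.inr ?_⟩, fun h => ?_⟩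
  · refine hmem _ ?_ ?_ ?_ <;> rw [hup _ _ _ _ (by decide), hup _ _ _ _ (by decide)]
  · constructor
    · simp [update_apply]
    · simpa [update_apply, e37] using hv
    · simpa [update_apply, e37, hL v] using hq2
    · simp [update_apply, e37, hL v]
      omega
    · have h' : excess τ v ≤ -Δ := by rw [e29]; exact h
      simpa [update_apply, e37, DiffSystem.excess] using h'
  · refine ⟨?_, Or.inl ⟨r - 1, by omega, ?_⟩⟩
    · refine hmem _ ?_ ?_ ?_ <;> exact hup _ _ _ _ (by decide)
    · rw [not_le] at h
      constructor
      · simp [update_apply, e33, hs.status]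
      · intro i hi hLi
        have hLi' : 1 ≤ τ.nat 30 i 0 := by simpa [RealRAM.skip, update_apply] using hLi
        show -Δ < excess τ i
        rw [e29]
        by_cases hiv : i = v
        · rw [hiv]; exact h
        · rw [hL, if_neg hiv] at hLi'
          exact hs.excess_gt i hi hLi'
      · show numUnlabelled act τ < r - 1
        omega
      · simp [update_apply, hq]
        omega
      · intro i hi
        simp only [NExpr.eval, update_apply]
        simp only [show ¬ (30 = 99) by decide, show ¬ (32 = 99) by decide, false_and, if_false,
          hL i, hq]
        split_ifs
        · omega
        · exact (hs.label_lt i hi).trans (Nat.lt_succ_self _)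
      · show _ + numUnlabelled act τ ≤ _
        simp [update_apply, hq]
        omega

/-- A primal-dual step: raising all labelled potentials by the least reduced cost makes the selected
pair tight. It keeps the flow tight, and it keeps the predecessor pairs tight because both of their
ends are labelled. -/
theorem runs_searchStep {r : ℕ} (hσ : HoldsSystem k act g w σ) (hf : HoldsFlow act g w β Δ σ)
    (hl : HoldsLabels act g w Δ σ) (hs : Searching k act Δ r σ) :
    Runs searchStep σ (k * (k * 10 + 8) + 12) fun τ =>
      ∃ r' < r, SearchState k act g w β Δ r' τ := by
  refine ((runs_scan hσ).seq (B' := k * 4 + 9) fun τ hτ hb => ?_).mono (by ring_nf; omega)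
    fun _ _ h => h
  have hτ' := hσ.of_frame hτ (by decide) (by decide)
  have hf' := hf.of_frame hτ (by decide) (by decide)
  have e23 : potential τ = potential σ := by unfold potential; rw [hτ.real 23 (by decide)]
  have e29 : excess τ = excess σ := by unfold excess; rw [hτ.real 29 (by decide)]
  have e28 := hτ.nat 28 (by decide)
  have e30 := hτ.nat 30 (by decide)
  have e31 := hτ.nat 31 (by decide)
  have e32 := hτ.nat 32 (by decide)
  have hl' : HoldsLabels act g w Δ τ := by
    rw [HoldsLabels, e29, e30, e31, e23, e28]; exact hl
  have hs' : Searching k act Δ r τ := by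
    constructor
    · rw [hτ.nat 33 (by decide), hs.status]
    · rw [e30, e29]; exact hs.excess_gt
    · rw [numUnlabelled, e30]; exact hs.lt
    · rw [e32]; exact hs.two_le
    · rw [e30, e32]; exact hs.label_lt
    · rw [numUnlabelled, e30, e32]; exact hs.le
  refine Runs.cond (B := k * 4 + 8) (fun hT => ?_) fun hT => ?_
  · refine Runs.of_wp (Nat.le_add_left 1 _) ⟨r - 1, by have := hs.lt; omega, ?_, ?_, Or.inr (Or.inr ?_)⟩
    · exact ⟨hf'.unit, hf'.feasible, hf'.tight, hf'.net_eq⟩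
    · exact hl'
    · simp only [Test.Holds, NExpr.var, NExpr.eval, Nat.le_zero] at hT
      rcases hb with ⟨-, hb⟩ | ⟨h1, -⟩
      · refine ⟨by simp [update_apply], hs'.excess_gt, fun i j hij => ?_⟩
        have hij' : IsLeaving act g σ i j := by
          unfold IsLeaving at hij ⊢
          rw [← e30, ← e28]
          exact hij
        exact hb (i, j) ⟨hσ.lt hij'.1.1, hσ.lt hij'.1.2⟩ hij'
      · omega
  · simp only [Test.Holds, NExpr.var, NExpr.eval, Nat.le_zero] at hT
    rcases hb with ⟨h1, -⟩ | ⟨-, hlv, hsl, hmin⟩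
    · exact absurd h1 hT
    refine ((runs_raisePotentials hτ' rfl).seq (B' := 6) fun υ hυ hp => ?_).mono le_rfl
      fun _ _ h => h
    have e23' : ∀ i ∈ act, potential υ i =
        if 1 ≤ σ.nat 30 i 0 then potential σ i + τ.real 33 0 0 else potential σ i := by
      intro i hi
      rw [hp i (hσ.lt hi), e23, e30]
    have e29' : excess υ = excess τ := by unfold excess; rw [hυ.real 29 (by decide)]
    have e28' := (hυ.nat 28 (by decide)).trans e28
    have e30' := (hυ.nat 30 (by decide)).trans e30
    have e31' := (hυ.nat 31 (by decide)).trans e31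
    have e32' := (hυ.nat 32 (by decide)).trans e32
    have hslack : slackOf σ = slack w (potential σ) (σ.nat 28) := by rw [slackOf, hσ.cost]
    rw [hslack] at hsl hmin
    obtain ⟨h1, h2, h3, h4⟩ := raise hf.feasible hf.tight (fun i => 1 ≤ σ.nat 30 i 0)
      hlv.1.1 hlv.1.2 hlv.2.1.1 (by rw [hlv.2.1.2]; decide) hlv.2.2 hsl
      (fun i hi j hj hpi hpj hij => hmin (i, j) ⟨hσ.lt hi, hσ.lt hj⟩
        ⟨⟨hi, hj⟩, ⟨hpi, Nat.lt_one_iff.1 (not_le.1 hpj)⟩, hij⟩) e23'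
    have hfυ : HoldsFlow act g w β Δ υ := by
      constructor
      · rw [hυ.real 32 (by decide), hf'.unit]
      · exact h1
      · rw [e28']; exact h2
      · rw [e29', hυ.nat 28 (by decide)]; exact hf'.net_eq
    have hlυ : HoldsLabels act g w Δ υ := by
      intro i hi
      rw [e29', e29, e30', e31', e28']
      rcases hl i hi with h | h | ⟨h5, h6, h7, h8, h9⟩
      · exact Or.inl h
      · exact Or.inr (Or.inl h)
      · exact Or.inr (Or.inr ⟨h5, h6, h7, h8, h4 _ h6 i hi h7 (by omega) h9⟩)
    have hsυ : Searching k act Δ r υ := by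
      constructor
      · rw [hυ.nat 33 (by decide), hs'.status]
      · rw [e30', e29', e29]; exact hs.excess_gt
      · rw [numUnlabelled, e30']; exact hs.lt
      · rw [e32']; exact hs.two_le
      · rw [e30', e32']; exact hs.label_lt
      · rw [numUnlabelled, e30', e32']; exact hs.le
    refine (runs_labelBest hfυ hlυ hsυ (hυ.nat 36 (by decide) ▸ rfl) (hυ.nat 37 (by decide) ▸ rfl)
      hlv.1.1 hlv.1.2 (by rw [e30']; exact hlv.2.1.1) (by rw [e30']; exact hlv.2.1.2)
      (by rw [e28']; exact h3)).mono le_rfl fun ω hω ⟨h5, h6⟩ => ?_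
    have hfω := hfυ.of_frame hω (by decide) (by decide)
    rcases h6 with ⟨r', hr', h6⟩ | h6
    · exact ⟨r', hr', hfω, h5, Or.inl h6⟩
    · exact ⟨r - 1, by have := hs.lt; omega, hfω, h5, Or.inr (Or.inl h6)⟩

/-- Label one is reserved for the indices of large excess, so further labels start at two. The
variant is `k + 1` since it must strictly exceed the number of unlabelled indices. -/
theorem runs_startSearch (hσ : HoldsSystem k act g w σ) (hf : HoldsFlow act g w β Δ σ)
    (hΔ : 0 < Δ) : Runs startSearch σ (k * 4 + 4) fun τ =>
      HoldsLabels act g w Δ τ ∧ Searching k act Δ (k + 1) τ := by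
  refine ((Runs.forUpTo (N := k) (B := 2) (fun j τ => ∀ i ∈ act, i < j →
    (τ.nat 30 i 0 = 0 ∧ excess σ i < Δ) ∨ (τ.nat 30 i 0 = 1 ∧ Δ ≤ excess σ i)) hσ.size (by decide)
    (by decide) (by decide) (fun j τ c h => by rwa [τ.setVar_nat_of_ne c (by decide)])
    (fun i _ hi => absurd hi (Nat.not_lt_zero _)) ?_).seq (B' := 2) fun τ hτ h => ?_).mono
    (by omega) fun _ _ h => h
  · intro j hj τ hτ h41 h
    have ha : 1 ≤ τ.nat 24 j 0 ↔ j ∈ act := by rw [hτ.nat 24 (by decide)]; exact hσ.active j hj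
    have he : τ.real 29 j 0 = excess σ j := by rw [hτ.real 29 (by decide)]; rfl
    have hu : τ.real 32 0 0 = Δ := by rw [hτ.real 32 (by decide)]; exact hf.unit
    refine Runs.of_wp le_rfl ?_
    simp only [Program.wp, Test.Holds, NExpr.eval, NExpr.var, RExpr.eval, RExpr.var, h41, ha, he, hu]
    refine ⟨fun h1 i hi hij => ?_, fun h1 i hi hij => ?_⟩ <;>
    rcases Nat.lt_succ_iff_lt_or_eq.1 hij with h' | rfl
    · simpa [update_apply, h'.ne] using h i hi h'
    · exact Or.inr ⟨by simp [update_apply], h1.2⟩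
    · simpa [update_apply, h'.ne] using h i hi h'
    · exact Or.inl ⟨by simp [update_apply], not_le.1 fun h2 => h1 ⟨hi, h2⟩⟩
  · have e29 : excess τ = excess σ := by unfold excess; rw [hτ.real 29 (by decide)]
    have hL : ∀ i ∈ act, (τ.nat 30 i 0 = 0 ∧ excess τ i < Δ) ∨
        (τ.nat 30 i 0 = 1 ∧ Δ ≤ excess τ i) := fun i hi => by
      rw [e29]; exact h i hi (hσ.lt hi)
    have hcard : numUnlabelled act τ ≤ k := by
      refine (Finset.card_filter_le _ _).trans ?_
      simpa using Finset.card_le_card hσ.subset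
    have hend : Runs (Program.seq (.assign 32 (.lit 2)) (.assign 33 (.lit 0))) τ 2
        fun υ => υ.nat 32 0 0 = 2 ∧ υ.nat 33 0 0 = 0 :=
      Runs.of_wp le_rfl (by simp [update_apply])
    refine hend.mono le_rfl fun υ hυ ⟨h32, h33⟩ => ?_
    have e29' : excess υ = excess τ := by unfold excess; rw [hυ.real 29 (by decide)]
    have e30 := hυ.nat 30 (by decide)
    refine ⟨fun i hi => ?_, h33, fun i hi h1 => ?_, ?_, h32.ge, fun i hi => ?_, ?_⟩
    · rw [e30, e29']
      rcases hL i hi with h1 | h1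
      · exact Or.inl h1
      · exact Or.inr (Or.inl h1)
    · rw [e30] at h1
      rw [e29']
      rcases hL i hi with h2 | h2
      · omega
      · linarith
    · rw [numUnlabelled, e30]
      exact Nat.lt_succ_of_le hcard
    · rw [e30, h32]
      rcases hL i hi with h2 | h2 <;> omega
    · rw [numUnlabelled, e30, h32]
      unfold numUnlabelled at hcard
      omega

theorem runs_search (hσ : HoldsSystem k act g w σ) (hf : HoldsFlow act g w β Δ σ) (hΔ : 0 < Δ) :
    Runs search σ (20 * (k + 1) ^ 3) fun τ => HoldsFlow act g w β Δ τ ∧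
      HoldsLabels act g w Δ τ ∧ (FoundPath k act Δ τ ∨ NoPath act g Δ τ) := by
  refine ((runs_startSearch hσ hf hΔ).seq fun τ hτ h =>
    Runs.loop (fun r υ => SearchState k act g w β Δ r υ) (r := k + 1) (B := k * (k * 10 + 8) + 12)
      ⟨hf.of_frame hτ (by decide) (by decide), h.1, Or.inl h.2⟩
    fun r υ hυ hI hT => ?_).mono ?_ ?_
  · have hσ' := (hσ.of_frame hτ (by decide) (by decide)).of_frame hυ (by decide) (by decide)
    simp only [Test.Holds, NExpr.var, NExpr.eval, Nat.le_zero] at hT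
    rcases hI with ⟨h1, h2, h3 | h3 | h3⟩
    · exact runs_searchStep hσ' h1 h2 h3
    · rw [h3.status] at hT; omega
    · rw [h3.status] at hT; omega
  · ring_nf; omega
  · rintro τ - ⟨⟨r, -, h1, h2, h3 | h3 | h3⟩, hT⟩
    · exact absurd h3.status.le hT
    · exact ⟨h1, h2, Or.inl h3⟩
    · exact ⟨h1, h2, Or.inr h3⟩

end DiffSystem

/-! ### Augmentation of the flow -/

namespace DiffSystem

open RealRAM

variable {k : ℕ} {act : Finset ℕ} {g : ℕ → ℕ → Prop} {w : ℕ → ℕ → ℝ} {β : ℕ → ℝ} {Δ : ℝ}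
  {σ τ : Mem}

/-- The last clause protects the rest of the augmenting path: flow is decreased in row `v` only, and
`v` is not the end of an earlier pair of the path. -/
theorem runs_pushLast {u v : ℕ} (hf : HoldsFlow act g w β Δ σ) (hcur : σ.nat 34 0 0 = v)
    (hpred : σ.nat 31 v 0 = u) (hu : u ∈ act) (hv : v ∈ act) (huv : u ≠ v)
    (ht : TightResidual g w (potential σ) (σ.nat 28) u v) :
    Runs pushLast σ 6 fun τ => HoldsFlow act g w β Δ τ ∧ τ.nat 34 0 0 = u ∧
      (∀ i, excess τ i = if i = v then excess σ i + Δ else if i = u then excess σ i - Δ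
        else excess σ i) ∧
      ∀ i j, i ≠ v → σ.nat 28 i j ≤ τ.nat 28 i j := by
  have key : Runs pushLast σ 6 fun τ => τ.nat 34 0 0 = u ∧
      (∀ i, excess τ i = if i = v then excess σ i + Δ else if i = u then excess σ i - Δ
        else excess σ i) ∧
      ∀ i j, τ.nat 28 i j = if 0 < σ.nat 28 v u then
        (if i = v ∧ j = u then σ.nat 28 i j - 1 else σ.nat 28 i j) else
        (if i = u ∧ j = v then σ.nat 28 i j + 1 else σ.nat 28 i j) := by
    refine Runs.of_wp (by decide) ?_
    have hΔ := hf.unit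
    simp only [pushLast, Program.wp, Program.assign, Test.Holds, NExpr.eval, NExpr.var, RExpr.eval,
      RExpr.var]
    refine ⟨fun h => ?_, fun h => ?_⟩
    · have h' : 0 < σ.nat 28 v u := Nat.lt_of_succ_le (by simpa [update_apply, hcur, hpred] using h)
      refine ⟨by simp [update_apply, hcur, hpred], fun i => ?_, fun i j => ?_⟩
      · by_cases h1 : i = v
        · subst h1; simp [DiffSystem.excess, update_apply, hcur, hpred, huv.symm, hΔ]
        · by_cases h2 : i = u
          · subst h2; simp [DiffSystem.excess, update_apply, hcur, hpred, h1, hΔ]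
          · simp [DiffSystem.excess, update_apply, hcur, hpred, h1, h2]
      · rw [if_pos h']
        by_cases h1 : i = v ∧ j = u
        · obtain ⟨rfl, rfl⟩ := h1; simp [update_apply, hcur, hpred]
        · simp [update_apply, hcur, hpred, h1]
    · have h' : ¬ 0 < σ.nat 28 v u := by simpa [update_apply, hcur, hpred] using h
      refine ⟨by simp [update_apply, hcur, hpred], fun i => ?_, fun i j => ?_⟩
      · by_cases h1 : i = v
        · subst h1; simp [DiffSystem.excess, update_apply, hcur, hpred, huv.symm, hΔ]
        · by_cases h2 : i = u
          · subst h2; simp [DiffSystem.excess, update_apply, hcur, hpred, h1, hΔ]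
          · simp [DiffSystem.excess, update_apply, hcur, hpred, h1, h2]
      · rw [if_neg h']
        by_cases h1 : i = u ∧ j = v
        · obtain ⟨rfl, rfl⟩ := h1; simp [update_apply, hcur, hpred]
        · simp [update_apply, hcur, hpred, h1]
  refine key.mono le_rfl fun τ hτ ⟨h1, h2, h3⟩ => ?_
  have e23 : potential τ = potential σ := by unfold potential; rw [hτ.real 23 (by decide)]
  obtain ⟨h4, h5⟩ := push hf.tight hf.net_eq hu hv huv ht (fun i _ j _ => h3 i j) fun i _ => h2 i
  refine ⟨⟨?_, ?_, ?_, h5⟩, h1, h2, fun i j hi => ?_⟩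
  · rw [hτ.real 32 (by decide), hf.unit]
  · rw [e23]; exact hf.feasible
  · rw [e23]; exact h4
  · rw [h3]
    split_ifs with h6 h7 h7
    · exact absurd h7.1 hi
    · exact le_rfl
    · omega
    · exact le_rfl

/-- The path is traversed backwards along predecessors. Labels decrease, which gives termination and
shows that no row is changed before it is used. At each moment the excess has changed only at the
end of the path and at the current index. -/
theorem runs_augment (hf : HoldsFlow act g w β Δ σ) (hΔ : 0 < Δ) (hl : HoldsLabels act g w Δ σ)
    (hp : FoundPath k act Δ σ) :
    Runs augment σ ((k + 1) * 7 + 1) fun τ => HoldsFlow act g w β Δ τ ∧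
      ∑ i ∈ act, max (excess τ i) 0 = ∑ i ∈ act, max (excess σ i) 0 - Δ := by
  set t := σ.nat 34 0 0 with ht
  have h2t : 2 ≤ σ.nat 30 t 0 := hp.two_le
  refine (Runs.loop (B := 6) (fun r τ => HoldsFlow act g w β Δ τ ∧ τ.nat 34 0 0 ∈ act ∧
    σ.nat 30 (τ.nat 34 0 0) 0 = r ∧ 1 ≤ r ∧
    (∀ i, excess τ i = excess σ i + (if i = t then Δ else 0) -
      if i = τ.nat 34 0 0 then Δ else 0) ∧
    ∀ i ∈ act, σ.nat 30 i 0 ≤ r → ∀ j, σ.nat 28 i j ≤ τ.nat 28 i j ∨ r < σ.nat 30 i 0)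
    (r := σ.nat 30 t 0)
    ⟨hf, hp.mem, rfl, by omega, fun i => by ring, fun i _ _ j => Or.inl le_rfl⟩
    ?_).mono (by have := hp.le; gcongr) ?_
  · rintro r τ hτ ⟨h1, h2, h3, h4, h5, h6⟩ hT
    set v := τ.nat 34 0 0 with hv
    have e30 := hτ.nat 30 (by decide)
    have e31 := hτ.nat 31 (by decide)
    have e23 : potential τ = potential σ := by unfold potential; rw [hτ.real 23 (by decide)]
    simp only [Test.Holds, NExpr.var, NExpr.eval, ← hv, e30, h3] at hT
    obtain ⟨-, h7, h8, h9, h10⟩ := ((hl v h2).resolve_left (by omega)).resolve_left (by omega)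
    set u := σ.nat 31 v 0 with hu
    have huv : u ≠ v := by rintro e; rw [e] at h9; omega
    have hres : TightResidual g w (potential τ) (τ.nat 28) u v := by
      rw [e23]
      rcases h10 with h | h
      · exact Or.inl (h.trans_le ((h6 v h2 h3.le u).resolve_right (by omega)))
      · exact Or.inr h
    refine (runs_pushLast h1 hv.symm (by rw [e31]) h7 h2 huv hres).mono le_rfl
      fun υ hυ ⟨g1, g2, g3, g4⟩ => ⟨σ.nat 30 u 0, by omega, g1, by rwa [g2], by rw [g2], h8, ?_, ?_⟩
    · intro i
      rw [g2, g3 i, h5 i]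
      by_cases hiv : i = v
      · subst hiv
        rw [if_pos rfl, if_pos rfl, if_neg huv.symm]; ring
      · rw [if_neg hiv, if_neg hiv]
        split_ifs <;> ring
    · intro i hi hir j
      have hiv : i ≠ v := by rintro rfl; omega
      exact Or.inl (((h6 i hi (by omega) j).resolve_right (by omega)).trans (g4 i j hiv))
  · rintro τ hτ ⟨⟨r, -, h1, h2, h3, h4, h5, -⟩, hT⟩
    refine ⟨h1, ?_⟩
    have e30 := hτ.nat 30 (by decide)
    simp only [Test.Holds, NExpr.var, NExpr.eval, e30, h3] at hT
    have hes := ((hl _ h2).resolve_left (by omega)).resolve_right (by omega)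
    exact sum_excess_augment h2 hp.mem hes.2 hp.excess_le hΔ fun i _ => h5 i

theorem sum_excess_le_of_noPath {U : ℝ} (hσ : HoldsSystem k act g w σ)
    (hf : HoldsFlow act g w β Δ σ) (hΔ : 0 < Δ) (hl : HoldsLabels act g w Δ σ)
    (hU : ∀ z, Feasible act g w z → ∑ i ∈ act, β i * z i ≤ U) (hp : NoPath act g Δ σ) :
    ∑ i ∈ act, max (excess σ i) 0 ≤ k * Δ := by
  have h1 := sum_excess_le hf.feasible hf.tight hΔ hf.net_eq hU (fun i => 1 ≤ σ.nat 30 i 0)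
    (fun i hi j hj hpi hpj => ?_) hp.excess_gt fun i hi hpi => ?_
  · have h2 : (act.card : ℝ) ≤ k := by
      exact_mod_cast (Finset.card_le_card hσ.subset).trans_eq (Finset.card_range k)
    exact h1.trans (mul_le_mul_of_nonneg_right h2 hΔ.le)
  · have h2 := hp.closed i j
    have h3 : σ.nat 30 j 0 = 0 := Nat.lt_one_iff.1 (not_le.1 hpj)
    refine ⟨fun h => h2 ⟨⟨hi, hj⟩, ⟨hpi, h3⟩, Or.inr h⟩, ?_⟩
    by_contra h
    exact h2 ⟨⟨hi, hj⟩, ⟨hpi, h3⟩, Or.inl (Nat.pos_of_ne_zero h)⟩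
  · rcases hl i hi with h | h | h
    · exact h.2
    · omega
    · omega

/-- Each augmentation lowers the total positive excess by exactly `Δ`, so `r` bounds their number;
one further search detects that no path is left, and then `sum_excess_le` applies to the labelled
set. -/
theorem runs_augmentAll {U : ℝ} (hσ : HoldsSystem k act g w σ) (hf : HoldsFlow act g w β Δ σ)
    (hΔ : 0 < Δ) (hU : ∀ z, Feasible act g w z → ∑ i ∈ act, β i * z i ≤ U)
    (h33 : σ.nat 33 0 0 = 1) {r : ℕ} (hr : ∑ i ∈ act, max (excess σ i) 0 ≤ r * Δ) :
    Runs augmentAll σ ((r + 1) * (31 * (k + 1) ^ 3) + 1) fun τ => HoldsFlow act g w β Δ τ ∧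
      ∑ i ∈ act, max (excess τ i) 0 ≤ k * Δ := by
  refine (Runs.loop (B := 20 * (k + 1) ^ 3 + ((k + 1) * 7 + 1 + 1)) (fun r τ =>
    HoldsFlow act g w β Δ τ ∧ (τ.nat 33 0 0 = 1 ∧ ∑ i ∈ act, max (excess τ i) 0 + Δ ≤ r * Δ ∨
      τ.nat 33 0 0 = 2 ∧ ∑ i ∈ act, max (excess τ i) 0 ≤ k * Δ)) (r := r + 1)
    ⟨hf, Or.inl ⟨h33, by push_cast; linarith⟩⟩ ?_).mono ?_ ?_
  · rintro r τ hτ ⟨h1, h2⟩ hT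
    have hτ' := hσ.of_frame hτ (by decide) (by decide)
    simp only [Test.Holds, NExpr.var, NExpr.eval] at hT
    obtain ⟨h3, h4⟩ := h2.resolve_right (by omega)
    have hpos : 0 < r := by
      by_contra h
      have h5 : ∑ i ∈ act, max (excess τ i) 0 ≥ 0 := Finset.sum_nonneg fun _ _ => le_max_right _ _
      rw [show r = 0 by omega, Nat.cast_zero, zero_mul] at h4
      linarith
    have hcast : ((r - 1 : ℕ) : ℝ) = r - 1 := by rw [Nat.cast_sub hpos, Nat.cast_one]
    refine (runs_search hτ' h1 hΔ).seq fun υ hυ ⟨g1, g2, g3⟩ => ?_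
    have e29 : excess υ = excess τ := by unfold DiffSystem.excess; rw [hυ.real 29 (by decide)]
    refine Runs.cond (fun hT' => ?_) fun hT' => ?_
    · simp only [Test.Holds, NExpr.var, NExpr.eval] at hT'
      have g4 := g3.resolve_right fun h => by rw [h.status] at hT'; omega
      refine (runs_augment g1 hΔ g2 g4).mono le_rfl fun ω hω ⟨h5, h6⟩ =>
        ⟨r - 1, by omega, h5, Or.inl ⟨?_, ?_⟩⟩
      · rw [hω.nat 33 (by decide), g4.status]
      · rw [h6, e29, hcast]
        linarith
    · simp only [Test.Holds, NExpr.var, NExpr.eval] at hT'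
      have g4 := g3.resolve_left fun h => hT' h.status.le
      have hυ' := hτ'.of_frame hυ (by decide) (by decide)
      have g5 := sum_excess_le_of_noPath hυ' g1 hΔ g2 hU g4
      refine (Runs.of_wp (P := RealRAM.skip) (Q := fun _ => True) (Nat.le_add_left 1 _)
        trivial).mono le_rfl fun ω hω _ => ⟨r - 1, by omega,
        g1.of_frame hω (by decide) (by decide), Or.inr ⟨?_, ?_⟩⟩
      · rw [hω.nat 33 (by decide), g4.status]
      · have : excess ω = excess υ := by unfold DiffSystem.excess; rw [hω.real 29 (by decide)]
        rw [this]
        exact g5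
  · gcongr
    ring_nf
    omega
  · rintro τ - ⟨⟨r, -, h1, h2⟩, hT⟩
    simp only [Test.Holds, NExpr.var, NExpr.eval] at hT
    exact ⟨h1, (h2.resolve_left (by omega)).2⟩

end DiffSystem

/-! ### Eliminating one index per phase -/

namespace RealRAM

/-- The test whether two indices are equal. -/
@[simp] def Test.natEq (d e : NExpr) : Test := .and (.natLe d e) (.natLe e d)

/-- Initialize a phase: zero flow in units of a fraction of the maximum supply. -/
def startPhase : Program :=
  .seq (.assignReal 32 (.div (.var 34) (.var 35)))
    (.seq (.forUpTo 41 7 (.forUpTo 42 7 (.setNat 28 (.var 41) (.var 42) (.lit 0))))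
      (.seq (.forUpTo 41 7 (.setReal 29 (.var 41) (.lit 0) (.get 20 (.var 41) (.lit 0))))
        (.assign 33 (.lit 1))))

/-- Find a pair with large flow. -/
def findLarge : Program :=
  .forUpTo 41 7 (.forUpTo 42 7 (.when
    (.and (.and (.natLe (.lit 1) (.get 24 (.var 41) (.lit 0)))
        (.natLe (.lit 1) (.get 24 (.var 42) (.lit 0))))
      (.natLe (.var 7) (.get 28 (.var 41) (.var 42))))
    (.seq (.assign 39 (.var 41)) (.assign 40 (.var 42)))))

/-- Add the constraint with right-hand side `e` for the pair `(x, y)`, if there is one for the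
pair `(s, t)`. -/
def tighten (x y s t : ℕ) (e : RExpr) : Program :=
  .when (.natLe (.lit 1) (.get 22 (.var s) (.var t)))
    (.cond (.and (.natLe (.lit 1) (.get 22 (.var x) (.var y))) (.realLe (.get 22 (.var x) (.var y)) e))
      skip (.seq (.setReal 22 (.var x) (.var y) e) (.setNat 22 (.var x) (.var y) (.lit 1))))

/-- Replace the constraints between `x₃₉` and `x₄₁` by constraints between `x₄₀` and `x₄₁`. -/
def moveConstraints : Program :=
  .when (.and (.not (.natEq (.var 41) (.var 39))) (.not (.natEq (.var 41) (.var 40))))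
    (.seq (tighten 40 41 39 41 (.sub (.get 22 (.var 39) (.var 41)) (.get 22 (.var 39) (.var 40))))
      (tighten 41 40 41 39 (.add (.get 22 (.var 41) (.var 39)) (.get 22 (.var 39) (.var 40)))))

/-- Replace the representative `x₃₉` by `x₄₀`. -/
def moveRepresentatives : Program :=
  .forUpTo 41 7 (.when (.natEq (.get 25 (.var 41) (.lit 0)) (.var 39))
    (.seq (.setReal 25 (.var 41) (.lit 0)
        (.add (.get 25 (.var 41) (.lit 0)) (.get 22 (.var 39) (.var 40))))
      (.setNat 25 (.var 41) (.lit 0) (.var 40))))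

/-- Eliminate the index `x₃₉`. -/
def contract : Program :=
  .seq (.forUpTo 41 7 moveConstraints)
    (.seq moveRepresentatives
      (.seq (.setReal 20 (.var 40) (.lit 0)
          (.add (.get 20 (.var 40) (.lit 0)) (.get 20 (.var 39) (.lit 0))))
        (.setNat 24 (.var 39) (.lit 0) (.lit 0))))

/-- Compute the maximum absolute value of the supplies of active indices. -/
def maxSupply : Program :=
  .seq (.assignReal 34 (.lit 0))
    (.forUpTo 41 7 (.when (.natLe (.lit 1) (.get 24 (.var 41) (.lit 0)))
      (.seq (.when (.realLe (.var 34) (.get 20 (.var 41) (.lit 0)))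
          (.assignReal 34 (.get 20 (.var 41) (.lit 0))))
        (.when (.realLe (.var 34) (.sub (.lit 0) (.get 20 (.var 41) (.lit 0))))
          (.assignReal 34 (.sub (.lit 0) (.get 20 (.var 41) (.lit 0))))))))

/-- Eliminate one index. -/
def phase : Program :=
  .seq startPhase (.seq augmentAll (.seq findLarge (.seq contract maxSupply)))

/-- Eliminate indices until all supplies are zero. -/
def eliminateAll : Program := .loop (.not (.realLe (.var 34) (.lit 0))) phase

end RealRAM

namespace DiffSystem

open RealRAM

variable {k : ℕ} {act : Finset ℕ} {g : ℕ → ℕ → Prop} {w : ℕ → ℕ → ℝ} {β : ℕ → ℝ} {Δ : ℝ}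
  {σ τ : Mem}

/-- The supplies held in memory. -/
def supply (σ : Mem) : ℕ → ℝ := fun i => σ.real 20 i 0

/-- The relation held in memory. -/
def relation (σ : Mem) : ℕ → ℕ → Prop := fun i j => 1 ≤ σ.nat 22 i j

/-- The representatives held in memory. -/
def representative (σ : Mem) : ℕ → ℕ := fun i => σ.nat 25 i 0

/-- The shifts held in memory. -/
def shift (σ : Mem) : ℕ → ℝ := fun i => σ.real 25 i 0

theorem runs_startPhase (hσ : HoldsSystem k act g w σ) (hf : Feasible act g w (potential σ))
    (hΔ : σ.real 34 0 0 / σ.real 35 0 0 = Δ) :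
    Runs startPhase σ (k * (k * 3 + 4) + k * 3 + 6) fun τ =>
      HoldsFlow act g w (supply σ) Δ τ ∧ (∀ i < k, excess τ i = supply σ i) ∧
        τ.nat 33 0 0 = 1 := by
  have h1 : Runs (.assignReal 32 (.div (.var 34) (.var 35))) σ 1 fun τ => τ.real 32 0 0 = Δ :=
    Runs.of_wp le_rfl (by simp [update_apply, hΔ])
  refine (h1.seq (B' := k * (k * 3 + 4) + k * 3 + 5) fun τ hτ hu => ?_).mono (by omega)
    fun _ _ h => h
  have hτ7 : τ.nat 7 0 0 = k := by rw [hτ.nat 7 (by decide), hσ.size]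
  refine ((Runs.forUpTo₂ (N := k) (B := 1) (fun S υ => ∀ z ∈ S, υ.nat 28 z.1 z.2 = 0) hτ7
    (by decide) (by decide) (by decide) (by decide) (by decide) (by decide)
    (fun S υ c h => by rwa [υ.setVar_nat_of_ne c (by decide)])
    (fun S υ c h => by rwa [υ.setVar_nat_of_ne c (by decide)])
    (fun z hz => absurd hz (Set.notMem_empty z)) ?_).seq (B' := k * 3 + 3)
    fun υ hυ h28 => ?_).mono (by ring_nf; omega) fun _ _ h => h
  · intro i _ j _ S υ hυ h41 h42 h
    refine Runs.of_wp le_rfl ?_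
    rintro z (rfl | hz)
    · simp [update_apply, h41, h42]
    · have := h z hz
      simp [update_apply, this]
  have hυ7 : υ.nat 7 0 0 = k := by rw [hυ.nat 7 (by decide), hτ7]
  refine ((Runs.forUpTo (N := k) (B := 1) (fun j ω => ∀ i < j, ω.real 29 i 0 = supply σ i) hυ7
    (by decide) (by decide) (by decide) (fun j ω c h => h)
    (fun i hi => absurd hi (Nat.not_lt_zero _)) ?_).seq (B' := 1) fun ω hω h29 => ?_).mono
    (by omega) fun _ _ h => h
  · intro j _ ω hω h41 h
    have e20 : ω.real 20 = σ.real 20 := by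
      rw [hω.real 20 (by decide), hυ.real 20 (by decide), hτ.real 20 (by decide)]
    refine Runs.of_wp le_rfl fun i hi => ?_
    rcases Nat.lt_succ_iff_lt_or_eq.1 hi with h' | rfl
    · simpa [update_apply, h41, h'.ne] using h i h'
    · simp [update_apply, h41, e20, supply]
  · have hend : Runs (.assign 33 (.lit 1)) ω 1 fun ρ => ρ.nat 33 0 0 = 1 :=
      Runs.of_wp le_rfl (by simp [update_apply])
    refine hend.mono le_rfl fun ρ hρ h33 => ?_
    have e23 : potential ρ = potential σ := by
      unfold potential
      rw [hρ.real 23 (by decide), hω.real 23 (by decide), hυ.real 23 (by decide),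
        hτ.real 23 (by decide)]
    have e29 : ∀ i < k, excess ρ i = supply σ i := by
      unfold DiffSystem.excess
      rw [hρ.real 29 (by decide)]
      exact h29
    have e28 : ∀ i ∈ act, ∀ j ∈ act, ρ.nat 28 i j = 0 := fun i hi j hj => by
      rw [hρ.nat 28 (by decide), hω.nat 28 (by decide)]
      exact h28 (i, j) ⟨hσ.lt hi, hσ.lt hj⟩
    refine ⟨⟨?_, ?_, ?_, ?_⟩, e29, h33⟩
    · rw [hρ.real 32 (by decide), hω.real 32 (by decide), hυ.real 32 (by decide), hu]
    · rw [e23]; exact hf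
    · intro i hi j hj hij
      rw [e28 i hi j hj] at hij
      omega
    · intro i hi
      rw [e29 i (hσ.lt hi), sub_self, net, Finset.sum_eq_zero fun j hj => by
        rw [e28 i hi j hj, Nat.cast_zero], Finset.sum_eq_zero fun j hj => by
        rw [e28 j hj i hi, Nat.cast_zero], sub_zero, mul_zero]

theorem runs_findLarge (hσ : HoldsSystem k act g w σ)
    (h : ∃ i ∈ act, ∃ j ∈ act, k ≤ σ.nat 28 i j) :
    Runs findLarge σ (k * (k * 5 + 4) + 2) fun τ => ∃ i ∈ act, ∃ j ∈ act, k ≤ σ.nat 28 i j ∧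
      τ.nat 39 0 0 = i ∧ τ.nat 40 0 0 = j := by
  obtain ⟨i₀, hi₀, j₀, hj₀, hx₀⟩ := h
  -- The invariant promises a result only once a pair known to be large has been visited; later hits
  -- may overwrite it by another large pair.
  refine (Runs.forUpTo₂ (N := k) (B := 3) (fun S τ => (i₀, j₀) ∈ S → ∃ i ∈ act, ∃ j ∈ act,
    k ≤ σ.nat 28 i j ∧ τ.nat 39 0 0 = i ∧ τ.nat 40 0 0 = j) hσ.size
    (by decide) (by decide) (by decide) (by decide) (by decide) (by decide)
    (fun S υ c h => by rwa [υ.setVar_nat_of_ne c (by decide), υ.setVar_nat_of_ne c (by decide)])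
    (fun S υ c h => by rwa [υ.setVar_nat_of_ne c (by decide), υ.setVar_nat_of_ne c (by decide)])
    (fun h => absurd h (Set.notMem_empty _)) ?_).mono (by ring_nf; omega)
    fun τ _ h => h ⟨hσ.lt hi₀, hσ.lt hj₀⟩
  intro i hi j hj S τ hτ h41 h42 h
  have hτ' := hσ.of_frame hτ (by decide) (by decide)
  refine Runs.of_wp le_rfl ?_
  simp only [Program.when, Program.wp, Program.assign, Test.Holds, NExpr.eval, NExpr.var, h41, h42,
    hτ'.size, hτ'.active i hi, hτ'.active j hj, hτ.nat 28 (by decide)]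
  refine ⟨fun h1 _ => ⟨i, h1.1.1, j, h1.1.2, h1.2, by simp [update_apply],
    by simp [update_apply, h42]⟩, ?_⟩
  rintro h1 (h2 | h2)
  · obtain ⟨rfl, rfl⟩ := Prod.mk.injEq _ _ _ _ ▸ h2
    exact absurd ⟨⟨hi₀, hj₀⟩, hx₀⟩ h1
  · simpa [RealRAM.skip, update_apply] using h h2

end DiffSystem

/-! ### Contraction in memory -/

namespace DiffSystem

open RealRAM

variable {k : ℕ} {act : Finset ℕ} {σ τ : Mem}

/-- The constraint for the pair `(u, v)` that is held in memory admits the value `d`. -/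
def Allows (σ : Mem) (u v : ℕ) (d : ℝ) : Prop := relation σ u v → d ≤ σ.real 22 u v

/-- The constraints for the pair `(u, v)` in the two memories are the same. -/
def SameConstraint (σ τ : Mem) (u v : ℕ) : Prop :=
  τ.nat 22 u v = σ.nat 22 u v ∧ τ.real 22 u v = σ.real 22 u v

theorem SameConstraint.allows_iff {u v : ℕ} (h : SameConstraint σ τ u v) (d : ℝ) :
    Allows τ u v d ↔ Allows σ u v d := by
  rw [Allows, Allows, relation, relation, h.1, h.2]

theorem SameConstraint.relation_iff {u v : ℕ} (h : SameConstraint σ τ u v) :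
    relation τ u v ↔ relation σ u v := by
  rw [relation, relation, h.1]

/-- Describing a constraint by the values it admits covers inserting it, lowering its right-hand
side and leaving it alone in one formula, the one required by `Reduction.contract`. -/
theorem runs_tighten {x y s t u v p q : ℕ} {e : RExpr} {c : ℝ} (hx : σ.nat x 0 0 = u)
    (hy : σ.nat y 0 0 = v) (hs : σ.nat s 0 0 = p) (ht : σ.nat t 0 0 = q) (he : e.eval σ = c) :
    Runs (tighten x y s t e) σ 4 fun τ =>
      (∀ i j, ¬ (i = u ∧ j = v) → SameConstraint σ τ i j) ∧
      ∀ d, Allows τ u v d ↔ Allows σ u v d ∧ (relation σ p q → d ≤ c) := by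
  refine Runs.of_wp le_rfl ?_
  simp only [tighten, Program.when, Program.wp, Test.Holds, NExpr.eval, NExpr.var, RExpr.eval,
    hx, hy, hs, ht, he]
  refine ⟨fun h1 => ⟨fun h2 => ⟨fun i j _ => ?_, fun d => ?_⟩,
    fun h2 => ⟨fun i j hij => ?_, fun d => ?_⟩⟩, fun h1 => ⟨fun i j _ => ?_, fun d => ?_⟩⟩
  · simp [SameConstraint, update_apply]
  · simp only [Allows, relation, update_apply]
    exact ⟨fun h => ⟨h, fun _ => (h h2.1).trans h2.2⟩, fun h => h.1⟩
  · simp [SameConstraint, update_apply, hij]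
  · simp only [Allows, relation, update_apply, and_self, if_true]
    refine ⟨fun h => ⟨fun h3 => ?_, fun _ => h le_rfl⟩, fun h _ => h.2 h1⟩
    by_contra h4
    rw [not_le] at h4
    exact h2 ⟨h3, (h4.le.trans (h le_rfl))⟩
  · simp [SameConstraint, update_apply]
  · simp only [Allows, relation, update_apply]
    exact ⟨fun h => ⟨h, fun h3 => absurd h3 h1⟩, fun h => h.1⟩

theorem runs_moveConstraints {l p q : ℕ} (h41 : σ.nat 41 0 0 = l) (h39 : σ.nat 39 0 0 = p)
    (h40 : σ.nat 40 0 0 = q) :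
    Runs moveConstraints σ 9 fun τ =>
      (∀ i j, ¬ (l ≠ p ∧ l ≠ q ∧ (i = q ∧ j = l ∨ i = l ∧ j = q)) → SameConstraint σ τ i j) ∧
      (l ≠ p → l ≠ q →
        (∀ d, Allows τ q l d ↔ Allows σ q l d ∧
          (relation σ p l → d ≤ σ.real 22 p l - σ.real 22 p q)) ∧
        ∀ d, Allows τ l q d ↔ Allows σ l q d ∧
          (relation σ l p → d ≤ σ.real 22 l p + σ.real 22 p q)) := by
  refine Runs.cond (B := 8) (fun hT => ?_) fun hT => ?_
  · simp only [Test.natEq, Test.Holds, NExpr.var, NExpr.eval, h41, h39, h40] at hT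
    have hlp : l ≠ p := fun h => hT.1 ⟨h.le, h.ge⟩
    have hlq : l ≠ q := fun h => hT.2 ⟨h.le, h.ge⟩
    refine (runs_tighten h40 h41 h39 h41 (c := σ.real 22 p l - σ.real 22 p q)
      (by simp [h39, h40, h41])).seq (B' := 4) fun τ hτ ⟨h1, h2⟩ => ?_
    have e41 : τ.nat 41 0 0 = l := by rw [hτ.nat 41 (by decide), h41]
    have e40 : τ.nat 40 0 0 = q := by rw [hτ.nat 40 (by decide), h40]
    have e39 : τ.nat 39 0 0 = p := by rw [hτ.nat 39 (by decide), h39]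
    have hlp' := h1 l p fun h => hlq h.1
    have hpq' := h1 p q fun h => hlq h.2.symm
    refine (runs_tighten e41 e40 e41 e39 (c := σ.real 22 l p + σ.real 22 p q)
      (by simp [e39, e40, e41, hlp'.2, hpq'.2])).mono le_rfl fun υ _ ⟨h3, h4⟩ => ⟨?_, ?_⟩
    · intro i j hij
      have h5 := h1 i j fun h => hij ⟨hlp, hlq, Or.inl h⟩
      have h6 := h3 i j fun h => hij ⟨hlp, hlq, Or.inr h⟩
      exact ⟨h6.1.trans h5.1, h6.2.trans h5.2⟩
    · refine fun _ _ => ⟨fun d => ?_, fun d => ?_⟩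
      · rw [(h3 q l fun h => hlq h.2).allows_iff, h2]
      · rw [h4, (h1 l q fun h => hlq h.1).allows_iff, hlp'.relation_iff]
  · simp only [Test.natEq, Test.Holds, NExpr.var, NExpr.eval, h41, h39, h40] at hT
    refine Runs.of_wp (by decide) ⟨fun i j _ => ?_, fun h1 h2 => absurd ⟨?_, ?_⟩ hT⟩
    · simp [SameConstraint, update_apply]
    · exact fun h => h1 (le_antisymm h.1 h.2)
    · exact fun h => h2 (le_antisymm h.1 h.2)

/-- No entry in row or column `p` is written, so all constraints being moved are read in their
original form. -/
theorem runs_forUpTo_moveConstraints {p q : ℕ} (h7 : σ.nat 7 0 0 = k) (h39 : σ.nat 39 0 0 = p)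
    (h40 : σ.nat 40 0 0 = q) :
    Runs (.forUpTo 41 7 moveConstraints) σ (k * 11 + 2) fun τ =>
      (∀ i j, ¬ ((i = q ∧ j ≠ p ∧ j ≠ q) ∨ (i ≠ p ∧ i ≠ q ∧ j = q)) → SameConstraint σ τ i j) ∧
      ∀ l < k, l ≠ p → l ≠ q →
        (∀ d, Allows τ q l d ↔ Allows σ q l d ∧
          (relation σ p l → d ≤ σ.real 22 p l - σ.real 22 p q)) ∧
        ∀ d, Allows τ l q d ↔ Allows σ l q d ∧
          (relation σ l p → d ≤ σ.real 22 l p + σ.real 22 p q) := by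
  refine (Runs.forUpTo (N := k) (B := 9) (fun j τ =>
    (∀ u v, ¬ ((u = q ∧ v < j ∧ v ≠ p ∧ v ≠ q) ∨ (u < j ∧ u ≠ p ∧ u ≠ q ∧ v = q)) →
      SameConstraint σ τ u v) ∧
    ∀ l < j, l ≠ p → l ≠ q →
        (∀ d, Allows τ q l d ↔ Allows σ q l d ∧
          (relation σ p l → d ≤ σ.real 22 p l - σ.real 22 p q)) ∧
        ∀ d, Allows τ l q d ↔ Allows σ l q d ∧
          (relation σ l p → d ≤ σ.real 22 l p + σ.real 22 p q))
    h7 (by decide) (by decide) (by decide) (fun j τ c h => ?_)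
    ⟨fun u v _ => ⟨rfl, rfl⟩, fun l hl => absurd hl (Nat.not_lt_zero _)⟩ ?_).mono le_rfl
    fun τ _ h => ⟨fun i j hij => h.1 i j (by omega), h.2⟩
  · simp only [SameConstraint, Allows, relation] at h ⊢
    rwa [τ.setVar_nat_of_ne c (by decide), τ.setVar_real]
  · rintro j hj τ hτ h41 ⟨h1, h2⟩
    refine (runs_moveConstraints (p := p) (q := q) h41 (by rw [hτ.nat 39 (by decide), h39])
      (by rw [hτ.nat 40 (by decide), h40])).mono le_rfl fun υ _ ⟨h3, h4⟩ =>
      ⟨fun u v huv => ?_, fun l hl hlp hlq => ?_⟩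
    · have h5 := h1 u v (by omega)
      have h6 := h3 u v (by omega)
      exact ⟨h6.1.trans h5.1, h6.2.trans h5.2⟩
    · rcases Nat.lt_succ_iff_lt_or_eq.1 hl with h' | rfl
      · obtain ⟨h5, h6⟩ := h2 l h' hlp hlq
        refine ⟨fun d => ?_, fun d => ?_⟩
        · rw [(h3 q l (by omega)).allows_iff, h5]
        · rw [(h3 l q (by omega)).allows_iff, h6]
      · obtain ⟨h5, h6⟩ := h4 hlp hlq
        have e1 := h1 q l (by omega)
        have e2 := h1 l q (by omega)
        have e3 := h1 p l (by omega)
        have e4 := h1 l p (by omega)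
        have e5 := h1 p q (by omega)
        refine ⟨fun d => ?_, fun d => ?_⟩
        · rw [h5, e1.allows_iff, e3.relation_iff, e3.2, e5.2]
        · rw [h6, e2.allows_iff, e4.relation_iff, e4.2, e5.2]

theorem runs_moveRepresentatives {p q : ℕ} (h7 : σ.nat 7 0 0 = k) (h39 : σ.nat 39 0 0 = p)
    (h40 : σ.nat 40 0 0 = q) :
    Runs moveRepresentatives σ (k * 5 + 2) fun τ => ∀ i < k,
      representative τ i = (if representative σ i = p then q else representative σ i) ∧
      shift τ i = if representative σ i = p then shift σ i + σ.real 22 p q else shift σ i := by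
  refine (Runs.forUpTo (N := k) (B := 3) (fun j τ =>
    (∀ i < j, representative τ i = (if representative σ i = p then q else representative σ i) ∧
      shift τ i = if representative σ i = p then shift σ i + σ.real 22 p q else shift σ i) ∧
    ∀ i, j ≤ i → representative τ i = representative σ i ∧ shift τ i = shift σ i)
    h7 (by decide) (by decide) (by decide) (fun j τ c h => ?_)
    ⟨fun i hi => absurd hi (Nat.not_lt_zero _), fun i _ => ⟨rfl, rfl⟩⟩ ?_).mono le_rfl
    fun τ _ h => h.1
  · simp only [representative, shift] at h ⊢
    rwa [τ.setVar_nat_of_ne c (by decide), τ.setVar_real]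
  · rintro j hj τ hτ h41 ⟨h1, h2⟩
    have e39 : τ.nat 39 0 0 = p := by rw [hτ.nat 39 (by decide), h39]
    have e40 : τ.nat 40 0 0 = q := by rw [hτ.nat 40 (by decide), h40]
    have e22 := hτ.real 22 (by decide)
    obtain ⟨h3, h4⟩ := h2 j le_rfl
    have h3' : τ.nat 25 j 0 = representative σ j := h3
    have h4' : τ.real 25 j 0 = shift σ j := h4
    refine Runs.of_wp le_rfl ?_
    simp only [Program.when, Program.wp, Test.natEq, Test.Holds, NExpr.eval, NExpr.var, RExpr.eval,
      h41, h3', h4', e39, e40, e22, ← le_antisymm_iff]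
    refine ⟨fun h => ⟨fun i hi => ?_, fun i hi => ?_⟩, fun h => ⟨fun i hi => ?_, fun i hi => ?_⟩⟩
    · rcases Nat.lt_succ_iff_lt_or_eq.1 hi with h' | rfl
      · simpa [representative, shift, update_apply, h'.ne] using h1 i h'
      · simp [h]
        simp [representative, shift, update_apply]
    · have hne : i ≠ j := by omega
      simpa [representative, shift, update_apply, hne] using h2 i (by omega)
    · rcases Nat.lt_succ_iff_lt_or_eq.1 hi with h' | rfl
      · exact h1 i h'
      · simp only [h, if_false]
        exact h2 i le_rfl
    · exact h2 i (by omega)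

end DiffSystem

namespace DiffSystem

open RealRAM

variable {k : ℕ} {act : Finset ℕ} {g₀ : ℕ → ℕ → Prop} {w₀ : ℕ → ℕ → ℝ} {b : ℕ → ℝ}
  {σ τ : Mem}

/-- The memory holds a reduction of the system `g₀, w₀` with objective function `b` to a system on
the active indices, and a feasible solution of that system. -/
structure HoldsReduction (k : ℕ) (g₀ : ℕ → ℕ → Prop) (w₀ : ℕ → ℕ → ℝ) (b : ℕ → ℝ) (act : Finset ℕ)
    (σ : Mem) : Prop where
  system : HoldsSystem k act (relation σ) (σ.real 22) σ
  reduction : Reduction k g₀ w₀ b act (relation σ) (σ.real 22) (supply σ) (representative σ)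
    (shift σ)
  feasible : Feasible act (relation σ) (σ.real 22) (potential σ)
  count : σ.real 35 0 0 = k * k + k

theorem HoldsReduction.of_frame {P : Program} (h : HoldsReduction k g₀ w₀ b act σ)
    (hf : Frame P σ τ) (hn : ∀ z ∈ [7, 22, 24, 25], z ∉ P.natW)
    (hr : ∀ z ∈ [20, 22, 25, 35], z ∉ P.realW)
    (hp : Feasible act (relation σ) (σ.real 22) (potential τ)) :
    HoldsReduction k g₀ w₀ b act τ := by
  have e1 : relation τ = relation σ := by
    unfold relation; rw [hf.nat 22 (hn 22 (by decide))]
  have e2 : supply τ = supply σ := by unfold supply; rw [hf.real 20 (hr 20 (by decide))]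
  have e3 : representative τ = representative σ := by
    unfold representative; rw [hf.nat 25 (hn 25 (by decide))]
  have e4 : shift τ = shift σ := by unfold shift; rw [hf.real 25 (hr 25 (by decide))]
  have e6 := hf.real 22 (hr 22 (by decide))
  constructor
  · rw [e1, e6]
    exact h.system.of_frame hf (fun z hz => hn z (by fin_cases hz <;> decide)) (hr 22 (by decide))
  · rw [e1, e2, e3, e4, e6]; exact h.reduction
  · rw [e1, e6]; exact hp
  · rw [hf.real 35 (hr 35 (by decide)), h.count]

/-- The memory holds the maximum absolute value of the supplies of active indices. -/
structure HoldsMax (act : Finset ℕ) (σ : Mem) : Prop where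
  nonneg : 0 ≤ σ.real 34 0 0
  le : ∀ i ∈ act, |supply σ i| ≤ σ.real 34 0 0
  exists_eq : 0 < σ.real 34 0 0 → ∃ v ∈ act, |supply σ v| = σ.real 34 0 0

/-- This carries out `Reduction.contract`. Entries for `p` stay in memory, but the invariant only
refers to pairs of active indices. -/
theorem runs_contract {p q : ℕ} (hσ : HoldsReduction k g₀ w₀ b act σ) (h39 : σ.nat 39 0 0 = p)
    (h40 : σ.nat 40 0 0 = q) (hp : p ∈ act) (hq : q ∈ act) (hpq : p ≠ q) (hg : relation σ p q)
    (ht : potential σ p - potential σ q = σ.real 22 p q)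
    (hdom : ∀ y, Feasible act (relation σ) (σ.real 22) y →
      ∃ y', Feasible act (relation σ) (σ.real 22) y' ∧ y' p - y' q = σ.real 22 p q ∧
        ∑ i ∈ act, supply σ i * y i ≤ ∑ i ∈ act, supply σ i * y' i) :
    Runs contract σ (k * 16 + 6) (HoldsReduction k g₀ w₀ b (act.erase p)) := by
  refine ((runs_forUpTo_moveConstraints hσ.system.size h39 h40).seq (B' := k * 5 + 4)
    fun τ hτ ⟨h1, h2⟩ => ?_).mono (by omega) fun _ _ h => h
  have e22 : τ.real 22 p q = σ.real 22 p q := (h1 p q (by omega)).2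
  have erep : representative τ = representative σ := by
    unfold representative; rw [hτ.nat 25 (by decide)]
  have eshift : shift τ = shift σ := by unfold shift; rw [hτ.real 25 (by decide)]
  refine ((runs_moveRepresentatives (k := k) (p := p) (q := q)
    (by rw [hτ.nat 7 (by decide), hσ.system.size]) (by rw [hτ.nat 39 (by decide), h39])
    (by rw [hτ.nat 40 (by decide), h40])).seq (B' := 2) fun υ hυ h3 => ?_).mono (by omega)
    fun _ _ h => h
  rw [erep, eshift, e22] at h3
  have hend : Runs (Program.seq (.setReal 20 (.var 40) (.lit 0)
      (.add (.get 20 (.var 40) (.lit 0)) (.get 20 (.var 39) (.lit 0))))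
      (.setNat 24 (.var 39) (.lit 0) (.lit 0))) υ 2 fun ρ =>
      (∀ i, supply ρ i = if i = q then supply σ i + supply σ p else supply σ i) ∧
      ∀ i, ρ.nat 24 i 0 = if i = p then 0 else σ.nat 24 i 0 := by
    refine Runs.of_wp le_rfl ?_
    have e39 : υ.nat 39 0 0 = p := by rw [hυ.nat 39 (by decide), hτ.nat 39 (by decide), h39]
    have e40 : υ.nat 40 0 0 = q := by rw [hυ.nat 40 (by decide), hτ.nat 40 (by decide), h40]
    have e20 : υ.real 20 = σ.real 20 := by rw [hυ.real 20 (by decide), hτ.real 20 (by decide)]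
    have e24 : υ.nat 24 = σ.nat 24 := by rw [hυ.nat 24 (by decide), hτ.nat 24 (by decide)]
    simp only [Program.wp, NExpr.eval, NExpr.var, RExpr.eval, e39, e40, supply, update_apply, e20,
      e24]
    refine ⟨fun i => ?_, fun i => by simp⟩
    by_cases h : i = q
    · subst h; simp
    · simp [h]
  refine hend.mono le_rfl fun ρ hρ ⟨h4, h5⟩ => ?_
  have e7 : ρ.nat 7 = σ.nat 7 := by
    rw [hρ.nat 7 (by decide), hυ.nat 7 (by decide), hτ.nat 7 (by decide)]
  have e35 : ρ.real 35 = σ.real 35 := by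
    rw [hρ.real 35 (by decide), hυ.real 35 (by decide), hτ.real 35 (by decide)]
  have epot : potential ρ = potential σ := by
    unfold potential
    rw [hρ.real 23 (by decide), hυ.real 23 (by decide), hτ.real 23 (by decide)]
  have erel : relation ρ = relation τ := by
    unfold relation; rw [hρ.nat 22 (by decide), hυ.nat 22 (by decide)]
  have e22' : ρ.real 22 = τ.real 22 := by rw [hρ.real 22 (by decide), hυ.real 22 (by decide)]
  have erep' : representative ρ = representative υ := by
    unfold representative; rw [hρ.nat 25 (by decide)]
  have eshift' : shift ρ = shift υ := by unfold shift; rw [hρ.real 25 (by decide)]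
  obtain ⟨hred, hfeas⟩ := hσ.reduction.contract hσ.feasible hp hq hpq hg ht hdom
    (g' := relation τ) (w' := τ.real 22) (β' := supply ρ) (rep' := representative υ)
    (sh' := shift υ)
    (fun i hi => by
      rw [(h1 i i (by omega)).relation_iff]
      exact hσ.reduction.irrefl i (Finset.mem_of_mem_erase hi))
    (fun u hu v hv huv d => by
      have hup := Finset.ne_of_mem_erase hu
      have hvp := Finset.ne_of_mem_erase hv
      have huk := hσ.system.lt (Finset.mem_of_mem_erase hu)
      have hvk := hσ.system.lt (Finset.mem_of_mem_erase hv)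
      change Allows τ u v d ↔ Allows σ u v d ∧ _
      by_cases huq : u = q
      · subst huq
        have := (h2 v hvk hvp (Ne.symm huv)).1 d
        rw [this]
        simp [Ne.symm huv]
      · by_cases hvq : v = q
        · subst hvq
          have := (h2 u huk hup huv).2 d
          rw [this]
          simp [huv]
        · rw [(h1 u v (by omega)).allows_iff]
          simp [huq, hvq])
    (fun i _ => h4 i) (fun i hi => (h3 i hi).1) (fun i hi => (h3 i hi).2)
  constructor
  · constructor
    · rw [e7, hσ.system.size]
    · exact hred.subset
    · intro i hi
      rw [h5, Finset.mem_erase]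
      split_ifs with h
      · simp [h]
      · rw [hσ.system.active i hi]; simp [h]
    · exact fun _ _ _ _ => Iff.rfl
    · rfl
  · rw [erel, e22', erep', eshift']; exact hred
  · rw [erel, e22', epot]; exact hfeas
  · rw [e35, hσ.count]

theorem runs_maxSupply (hσ : HoldsReduction k g₀ w₀ b act σ) :
    Runs maxSupply σ (k * 7 + 3) fun τ => HoldsReduction k g₀ w₀ b act τ ∧ HoldsMax act τ := by
  suffices hmax : Runs maxSupply σ (k * 7 + 3) fun τ => 0 ≤ τ.real 34 0 0 ∧
      (∀ i ∈ act, |supply σ i| ≤ τ.real 34 0 0) ∧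
      (0 < τ.real 34 0 0 → ∃ v ∈ act, |supply σ v| = τ.real 34 0 0) by
    refine hmax.mono le_rfl fun τ hτ ⟨h1, h2, h3⟩ => ?_
    have e2 : supply τ = supply σ := by unfold supply; rw [hτ.real 20 (by decide)]
    have e5 : potential τ = potential σ := by unfold potential; rw [hτ.real 23 (by decide)]
    exact ⟨hσ.of_frame hτ (by decide) (by decide) (by rw [e5]; exact hσ.feasible),
      h1, by rw [e2]; exact h2, by rw [e2]; exact h3⟩
  have h1 : Runs (.assignReal 34 (.lit 0)) σ 1 fun τ => τ.real 34 0 0 = 0 :=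
    Runs.of_wp le_rfl (by simp [update_apply])
  refine (h1.seq fun τ hτ h34 => (Runs.forUpTo (N := k) (B := 5) (fun j υ => 0 ≤ υ.real 34 0 0 ∧
    (∀ i ∈ act, i < j → |supply σ i| ≤ υ.real 34 0 0) ∧
    (0 < υ.real 34 0 0 → ∃ v ∈ act, |supply σ v| = υ.real 34 0 0))
    (by rw [hτ.nat 7 (by decide), hσ.system.size]) (by decide) (by decide) (by decide)
    (fun j υ c h => h) ⟨h34.ge, fun i _ hi => absurd hi (Nat.not_lt_zero _), fun h => by
      rw [h34] at h; exact absurd h (lt_irrefl _)⟩ ?_).mono le_rfl fun υ _ h => ⟨h.1,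
      fun i hi => h.2.1 i hi (hσ.system.lt hi), h.2.2⟩).mono (by omega) fun _ _ h => h
  rintro j hj υ hυ h41 ⟨g1, g2, g3⟩
  have ha : 1 ≤ υ.nat 24 j 0 ↔ j ∈ act := by
    rw [hυ.nat 24 (by decide), hτ.nat 24 (by decide)]; exact hσ.system.active j hj
  have hs : υ.real 20 j 0 = supply σ j := by
    rw [hυ.real 20 (by decide), hτ.real 20 (by decide)]; rfl
  refine Runs.of_wp (by decide) ?_
  have h0 := le_abs_self (supply σ j)
  have h0' := neg_le_abs (supply σ j)
  -- In every branch the new value is the old one or the absolute value of the current supply, and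
  -- it is an upper bound for both if the index is active.
  have key : ∀ r : ℝ, υ.real 34 0 0 ≤ r → (j ∈ act → |supply σ j| ≤ r) →
      (r = υ.real 34 0 0 ∨ j ∈ act ∧ |supply σ j| = r) → 0 ≤ r ∧
      (∀ i ∈ act, i < j + 1 → |supply σ i| ≤ r) ∧ (0 < r → ∃ v ∈ act, |supply σ v| = r) := by
    refine fun r hr hj hr' => ⟨g1.trans hr, fun i hi hij => ?_, fun hpos => ?_⟩
    · rcases Nat.lt_succ_iff_lt_or_eq.1 hij with h' | rfl
      · exact (g2 i hi h').trans hr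
      · exact hj hi
    · rcases hr' with rfl | h
      · exact g3 hpos
      · exact ⟨j, h⟩
  simp only [Program.when, Program.assignReal, Program.wp, Test.Holds, NExpr.eval, NExpr.var,
    RExpr.eval, RExpr.var, h41, ha, hs, Rat.cast_zero, zero_sub]
  refine ⟨fun hj => ⟨fun h2 => ⟨fun h3 => ?_, fun h3 => ?_⟩,
    fun h2 => ⟨fun h3 => ?_, fun h3 => ?_⟩⟩, fun hj => ?_⟩
  · simp only [update_apply, hs] at h3
    have h3' : supply σ j ≤ -supply σ j := by simpa using h3
    have := key (-supply σ j) (by linarith) (fun _ => abs_le.2 ⟨by linarith, by linarith⟩)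
      (Or.inr ⟨hj, abs_of_nonpos (by linarith)⟩)
    simpa [update_apply, hs] using this
  · simp only [update_apply, hs] at h3
    have h3' : -supply σ j < supply σ j := by simpa using h3
    have := key (supply σ j) h2 (fun _ => abs_le.2 ⟨by linarith, le_rfl⟩)
      (Or.inr ⟨hj, abs_of_nonneg (by linarith)⟩)
    simpa [update_apply, RealRAM.skip] using this
  · have h3' : υ.real 34 0 0 ≤ -supply σ j := by simpa [update_apply, RealRAM.skip, h41, hs] using h3
    have := key (-supply σ j) h3' (fun _ => abs_le.2 ⟨by linarith, by linarith⟩)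
      (Or.inr ⟨hj, abs_of_nonpos (by linarith)⟩)
    simpa [update_apply, RealRAM.skip, h41, hs] using this
  · have h3' : -supply σ j < υ.real 34 0 0 := by simpa [update_apply, RealRAM.skip, h41, hs] using h3
    exact key _ le_rfl (fun _ => abs_le.2 ⟨by linarith, by linarith⟩) (Or.inl rfl)
  · exact key _ le_rfl (fun h => absurd h hj) (Or.inl rfl)

end DiffSystem

/-! ### Running all phases -/

namespace DiffSystem

open RealRAM

variable {k : ℕ} {act : Finset ℕ} {g₀ : ℕ → ℕ → Prop} {w₀ : ℕ → ℕ → ℝ} {b : ℕ → ℝ}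
  {σ τ : Mem}

/-- The maximum supply is `(k² + k) Δ`. The initial error is thus at most `k (k² + k) Δ`, which
bounds the augmentations by `O(k³)`, at `O(k³)` steps each. The final error is at most `k Δ`, so
`exists_large_flow` yields a pair with `k` units, exactly what `exists_tight` needs. -/
theorem runs_phase {U : ℝ} (hσ : HoldsReduction k g₀ w₀ b act σ) (hmax : HoldsMax act σ)
    (hpos : 0 < σ.real 34 0 0)
    (hU : ∀ y, Feasible (Finset.range k) g₀ w₀ y → ∑ i ∈ Finset.range k, b i * y i ≤ U) :
    Runs phase σ (60 * (k + 1) ^ 6) fun τ =>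
      ∃ p ∈ act, HoldsReduction k g₀ w₀ b (act.erase p) τ ∧ HoldsMax (act.erase p) τ := by
  obtain ⟨v, hv, hβv⟩ := hmax.exists_eq hpos
  have hk : 0 < k := (Nat.zero_le v).trans_lt (hσ.system.lt hv)
  have hcard : act.card ≤ k := by
    simpa using Finset.card_le_card hσ.system.subset
  have hkk : (0 : ℝ) < k * k + k := by positivity
  set Δ : ℝ := σ.real 34 0 0 / (k * k + k) with hΔ
  have hΔpos : 0 < Δ := div_pos hpos hkk
  have hB : σ.real 34 0 0 = (k * k + k) * Δ := by rw [hΔ]; field_simp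
  obtain ⟨U', hU'⟩ := hσ.reduction.bounded hU
  have hsum : ∑ i ∈ act, supply σ i = 0 := sum_eq_zero_of_bounded hσ.feasible hU'
  refine ((runs_startPhase (Δ := Δ) hσ.system hσ.feasible (by rw [hσ.count])).seq
    (B' := ((k * (k * k + k) + 1) * (31 * (k + 1) ^ 3) + 1) +
      ((k * (k * 5 + 4) + 2) + ((k * 16 + 6) + (k * 7 + 3)))) fun τ hτ ⟨h1, h2, h3⟩ => ?_).mono ?_
    fun _ _ h => h
  swap
  · have e1 : k * (k * k + k) + 1 ≤ (k + 1) ^ 3 := by ring_nf; omega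
    have e2 : (k * (k * k + k) + 1) * (31 * (k + 1) ^ 3) ≤ 31 * (k + 1) ^ 6 := by
      calc (k * (k * k + k) + 1) * (31 * (k + 1) ^ 3) ≤ (k + 1) ^ 3 * (31 * (k + 1) ^ 3) :=
            Nat.mul_le_mul_right _ e1
        _ = 31 * (k + 1) ^ 6 := by ring
    have e3 : (k + 1) ^ 2 ≤ (k + 1) ^ 6 := Nat.pow_le_pow_right (by omega) (by decide)
    have e4 : (k + 1) ^ 2 = k * k + 2 * k + 1 := by ring
    have e5 : k * (k * 3 + 4) = 3 * (k * k) + 4 * k := by ring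
    have e6 : k * (k * 5 + 4) = 5 * (k * k) + 4 * k := by ring
    omega
  have hτs := hσ.system.of_frame hτ (by decide) (by decide)
  have hexc : ∑ i ∈ act, max (excess τ i) 0 ≤ ((k * (k * k + k) : ℕ) : ℝ) * Δ := by
    calc ∑ i ∈ act, max (excess τ i) 0 ≤ ∑ i ∈ act, (k * k + k) * Δ := by
          refine Finset.sum_le_sum fun i hi => ?_
          rw [h2 i (hσ.system.lt hi), ← hB]
          exact max_le ((le_abs_self _).trans (hmax.le i hi)) hpos.le
      _ = act.card * ((k * k + k) * Δ) := by rw [Finset.sum_const, nsmul_eq_mul]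
      _ ≤ k * ((k * k + k) * Δ) := by
          refine mul_le_mul_of_nonneg_right (by exact_mod_cast hcard) ?_
          positivity
      _ = _ := by push_cast; ring
  refine (runs_augmentAll hτs h1 hΔpos hU' h3 hexc).seq fun υ hυ ⟨g1, g2⟩ => ?_
  have hυs := hτs.of_frame hυ (by decide) (by decide)
  have hlarge := exists_large_flow hcard hΔpos g1.net_eq hsum g2 hv (by rw [hβv, hB])
  refine (runs_findLarge hυs hlarge).seq fun ω hω ⟨p, hp, q, hq, hx, h39, h40⟩ => ?_
  have epot : potential ω = potential υ := by unfold potential; rw [hω.real 23 (by decide)]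
  obtain ⟨hpq, hrel, htight⟩ := g1.tight p hp q hq (hk.trans_le hx)
  have hτυ : Frame (.seq startPhase (.seq augmentAll findLarge)) σ ω :=
    (hτ.mono (by decide) (by decide)).trans ((hυ.mono (by decide) (by decide)).trans
      (hω.mono (by decide) (by decide)))
  have hωr := hσ.of_frame hτυ (by decide) (by decide) (by rw [epot]; exact g1.feasible)
  have erel : relation ω = relation σ := by unfold relation; rw [hτυ.nat 22 (by decide)]
  have e22 : ω.real 22 = σ.real 22 := hτυ.real 22 (by decide)
  have esup : supply ω = supply σ := by unfold supply; rw [hτυ.real 20 (by decide)]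
  refine (runs_contract hωr h39 h40 hp hq hpq (by rw [erel]; exact hrel)
    (by rw [epot, e22]; exact htight) ?_).seq fun ρ _ hρ => ?_
  · rw [erel, e22, esup]
    intro y hy
    refine exists_tight g1.feasible g1.tight hΔpos.le g1.net_eq hp hq (hk.trans_le hx) ?_ hy
    refine g2.trans ?_
    rw [mul_comm]
    exact mul_le_mul_of_nonneg_left (by exact_mod_cast hx) hΔpos.le
  · exact (runs_maxSupply hρ).mono le_rfl fun _ _ h => ⟨p, hp, h⟩

/-- The variant is the number of active indices. At the end all supplies vanish, so any feasible
potentials, in particular the current ones, are optimal. -/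
theorem runs_eliminateAll {U : ℝ} (hσ : HoldsReduction k g₀ w₀ b act σ) (hmax : HoldsMax act σ)
    (hU : ∀ y, Feasible (Finset.range k) g₀ w₀ y → ∑ i ∈ Finset.range k, b i * y i ≤ U) :
    Runs eliminateAll σ (k * (60 * (k + 1) ^ 6 + 1) + 1) fun τ =>
      Feasible (Finset.range k) g₀ w₀ (fun i => potential τ (representative τ i) + shift τ i) ∧
      ∀ y, Feasible (Finset.range k) g₀ w₀ y → ∑ i ∈ Finset.range k, b i * y i ≤
        ∑ i ∈ Finset.range k, b i * (potential τ (representative τ i) + shift τ i) := by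
  have hcard : act.card ≤ k := by
    simpa using Finset.card_le_card hσ.system.subset
  refine (Runs.loop (B := 60 * (k + 1) ^ 6) (fun r τ => ∃ act : Finset ℕ, act.card = r ∧
    HoldsReduction k g₀ w₀ b act τ ∧ HoldsMax act τ) ⟨act, rfl, hσ, hmax⟩ ?_).mono (by gcongr) ?_
  · rintro r τ - ⟨act, rfl, h1, h2⟩ hT
    simp only [Test.Holds, RExpr.var, RExpr.eval, NExpr.eval, Rat.cast_zero, not_le] at hT
    refine (runs_phase h1 h2 hT hU).mono le_rfl fun υ _ ⟨p, hp, h3, h4⟩ =>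
      ⟨(act.erase p).card, Finset.card_erase_lt_of_mem hp, act.erase p, rfl, h3, h4⟩
  · rintro τ - ⟨⟨r, -, act, -, h1, h2⟩, hT⟩
    simp only [Test.Holds, RExpr.var, RExpr.eval, NExpr.eval, Rat.cast_zero, not_not] at hT
    refine ⟨h1.reduction.feasible _ h1.feasible, fun y hy =>
      h1.reduction.optimal (fun i hi => ?_) _ hy⟩
    exact abs_nonpos_iff.1 ((h2.le i hi).trans hT)

end DiffSystem

/-! ### Setting up the dual system and writing its solution -/

namespace RealRAM

/-- Collect the constraint for the terminals with indices `x₄₁` and `x₄₂`. -/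
def initConstraint : Program :=
  .cond (.and (.and (.not (.realLe (.get 1 (.get 8 (.var 41) (.lit 0)) (.lit 0)) (.lit 0)))
        (.not (.realLe (.lit 0) (.get 1 (.get 8 (.var 42) (.lit 0)) (.lit 0)))))
      (.natLe (.lit 1) (.get 2 (.get 8 (.var 41) (.lit 0)) (.get 8 (.var 42) (.lit 0)))))
    (.seq (.setNat 22 (.var 41) (.var 42) (.lit 1))
      (.setReal 22 (.var 41) (.var 42)
        (.get 2 (.get 8 (.var 41) (.lit 0)) (.get 8 (.var 42) (.lit 0)))))
    (.setNat 22 (.var 41) (.var 42) (.lit 0))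

/-- Initialize the data for the terminal with index `x₄₁`. -/
def initTerminal : Program :=
  .seq (.seq (.setReal 20 (.var 41) (.lit 0) (.get 1 (.get 8 (.var 41) (.lit 0)) (.lit 0)))
      (.seq (.setReal 23 (.var 41) (.lit 0) (.lit 0)) (.setReal 25 (.var 41) (.lit 0) (.lit 0))))
    (.seq (.setNat 24 (.var 41) (.lit 0) (.lit 1))
      (.seq (.setNat 25 (.var 41) (.lit 0) (.var 41))
        (.assignReal 35 (.add (.var 35) (.lit 1)))))

/-- Lower the potential of `x₄₁` if it violates the constraint for `(x₄₁, x₄₂)`. -/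
def lowerPotential : Program :=
  .when (.and (.natLe (.lit 1) (.get 22 (.var 41) (.var 42)))
      (.realLe (.get 22 (.var 41) (.var 42)) (.get 23 (.var 41) (.lit 0))))
    (.setReal 23 (.var 41) (.lit 0) (.get 22 (.var 41) (.var 42)))

/-- Set up the system of difference constraints. -/
def initSystem : Program :=
  .seq (.forUpTo 41 7 (.forUpTo 42 7 initConstraint))
    (.seq (.seq (.assignReal 35 (.lit 0)) (.seq (.forUpTo 41 7 initTerminal)
        (.assignReal 35 (.add (.mul (.var 35) (.var 35)) (.var 35)))))
      (.forUpTo 41 7 (.forUpTo 42 7 lowerPotential)))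

/-- Write the solution to the output array. -/
def writeDual : Program :=
  .forUpTo 41 7 (.setReal 3 (.get 8 (.var 41) (.lit 0)) (.lit 0)
    (.add (.get 23 (.get 25 (.var 41) (.lit 0)) (.lit 0)) (.get 25 (.var 41) (.lit 0))))

/-- Step 2 of the algorithm. -/
def computeDual : Program :=
  .cond (.natLe (.lit 1) (.get 0 (.lit 0) (.lit 1)))
    (.seq initSystem (.seq maxSupply (.seq eliminateAll writeDual))) skip

end RealRAM

namespace DiffSystem

open RealRAM

variable {k : ℕ} {g₀ : ℕ → ℕ → Prop} {w₀ : ℕ → ℕ → ℝ} {b : ℕ → ℝ} {σ τ : Mem}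

theorem runs_initConstraints (h7 : σ.nat 7 0 0 = k) :
    Runs (.forUpTo 41 7 (.forUpTo 42 7 initConstraint)) σ (k * (k * 5 + 4) + 2) fun τ =>
      ∀ i < k, ∀ j < k, (relation τ i j ↔ 0 < σ.real 1 (σ.nat 8 i 0) 0 ∧
          σ.real 1 (σ.nat 8 j 0) 0 < 0 ∧ 1 ≤ σ.nat 2 (σ.nat 8 i 0) (σ.nat 8 j 0)) ∧
        (relation τ i j → τ.real 22 i j = σ.real 2 (σ.nat 8 i 0) (σ.nat 8 j 0)) := by
  refine (Runs.forUpTo₂ (N := k) (B := 3) (fun S τ => ∀ z ∈ S,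
      (relation τ z.1 z.2 ↔ 0 < σ.real 1 (σ.nat 8 z.1 0) 0 ∧
          σ.real 1 (σ.nat 8 z.2 0) 0 < 0 ∧ 1 ≤ σ.nat 2 (σ.nat 8 z.1 0) (σ.nat 8 z.2 0)) ∧
        (relation τ z.1 z.2 → τ.real 22 z.1 z.2 = σ.real 2 (σ.nat 8 z.1 0) (σ.nat 8 z.2 0))) h7
    (by decide) (by decide) (by decide) (by decide) (by decide) (by decide)
    (fun S υ c h => ?_) (fun S υ c h => ?_)
    (fun z hz => absurd hz (Set.notMem_empty z)) ?_).mono (by ring_nf; omega)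
    fun τ _ h i hi j hj => h (i, j) ⟨hi, hj⟩
  · unfold relation at h ⊢
    rwa [υ.setVar_nat_of_ne c (by decide), υ.setVar_real]
  · unfold relation at h ⊢
    rwa [υ.setVar_nat_of_ne c (by decide), υ.setVar_real]
  · intro i _ j _ S τ hτ h41 h42 h
    have e1 := hτ.real 1 (by decide)
    have e2 := hτ.real 2 (by decide)
    have e8 := hτ.nat 8 (by decide)
    have e2' := hτ.nat 2 (by decide)
    refine Runs.of_wp (by decide) ?_
    simp only [initConstraint, Program.wp, Test.Holds, NExpr.eval, NExpr.var, RExpr.eval, h41, h42,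
      e1, e2, e8, e2', Rat.cast_zero, not_le, and_assoc]
    refine ⟨fun hT z hz => ?_, fun hT z hz => ?_⟩ <;> by_cases hzij : z.1 = i ∧ z.2 = j
    · obtain ⟨rfl, rfl⟩ := hzij
      simp [relation, update_apply, hT, h41, h42, e8]
    · have hz' : z ∈ S := hz.resolve_left fun e => hzij (by rw [e]; exact ⟨rfl, rfl⟩)
      simpa [relation, update_apply, hzij, h41, h42] using h z hz'
    · obtain ⟨rfl, rfl⟩ := hzij
      rw [iff_false_right hT]
      simp [relation, update_apply]
    · have hz' : z ∈ S := hz.resolve_left fun e => hzij (by rw [e]; exact ⟨rfl, rfl⟩)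
      simpa [relation, update_apply, hzij, h41, h42] using h z hz'

/-- The machine cannot convert indices into reals, so the terminals are counted in a real variable
to obtain the divisor `k² + k`. -/
theorem runs_initTerminals (h7 : σ.nat 7 0 0 = k) :
    Runs (.seq (.assignReal 35 (.lit 0)) (.seq (.forUpTo 41 7 initTerminal)
        (.assignReal 35 (.add (.mul (.var 35) (.var 35)) (.var 35))))) σ (k * 8 + 4) fun τ =>
      (∀ i < k, supply τ i = σ.real 1 (σ.nat 8 i 0) 0 ∧ potential τ i = 0 ∧ shift τ i = 0 ∧
        τ.nat 24 i 0 = 1 ∧ representative τ i = i) ∧ τ.real 35 0 0 = k * k + k := by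
  have h1 : Runs (.assignReal 35 (.lit 0)) σ 1 fun τ => τ.real 35 0 0 = 0 :=
    Runs.of_wp le_rfl (by simp [update_apply])
  refine (h1.seq (B' := k * 8 + 3) fun τ hτ h35 => ?_).mono (by omega) fun _ _ h => h
  refine ((Runs.forUpTo (N := k) (B := 6) (fun j υ => (∀ i < j,
      υ.real 20 i 0 = σ.real 1 (σ.nat 8 i 0) 0 ∧ υ.real 23 i 0 = 0 ∧ υ.real 25 i 0 = 0 ∧
        υ.nat 24 i 0 = 1 ∧ υ.nat 25 i 0 = i) ∧ υ.real 35 0 0 = j)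
    (by rw [hτ.nat 7 (by decide), h7]) (by decide) (by decide) (by decide) (fun j υ c h => ?_)
    ⟨fun i hi => absurd hi (Nat.not_lt_zero _), by rw [h35, Nat.cast_zero]⟩ ?_).seq (B' := 1)
    fun υ hυ ⟨h2, h3⟩ => ?_).mono (by omega) fun _ _ h => h
  · rwa [υ.setVar_nat_of_ne c (by decide), υ.setVar_nat_of_ne c (by decide), υ.setVar_real]
  · rintro j hj υ hυ h41 ⟨h2, h3⟩
    have e1 : υ.real 1 = σ.real 1 := by rw [hυ.real 1 (by decide), hτ.real 1 (by decide)]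
    have e8 : υ.nat 8 = σ.nat 8 := by rw [hυ.nat 8 (by decide), hτ.nat 8 (by decide)]
    refine Runs.of_wp (by decide) ⟨fun i hi => ?_, ?_⟩
    · rcases Nat.lt_succ_iff_lt_or_eq.1 hi with h' | rfl
      · simpa [update_apply, h41, h'.ne] using h2 i h'
      · simp [update_apply, h41, e1, e8]
    · simp [update_apply, h3]
  · have hend : Runs (.assignReal 35 (.add (.mul (.var 35) (.var 35)) (.var 35))) υ 1
        fun ρ => ρ.real 35 0 0 = k * k + k := Runs.of_wp le_rfl (by simp [update_apply, h3])
    refine hend.mono le_rfl fun ρ hρ h4 => ⟨fun i hi => ?_, h4⟩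
    unfold supply potential shift representative
    rw [hρ.real 20 (by decide), hρ.real 23 (by decide), hρ.real 25 (by decide),
      hρ.nat 24 (by decide), hρ.nat 25 (by decide)]
    exact h2 i hi

/-- The second index of a constraint is never the first index of another, so its potential stays
zero, and it suffices to lower each first index to the least right-hand side. -/
theorem runs_lowerPotentials (h7 : σ.nat 7 0 0 = k) (hp : ∀ i < k, potential σ i = 0)
    (hdir : ∀ i < k, ∀ j < k, ∀ l < k, relation σ i j → ¬ relation σ j l) :
    Runs (.forUpTo 41 7 (.forUpTo 42 7 lowerPotential)) σ (k * (k * 4 + 4) + 2) fun τ =>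
      Feasible (Finset.range k) (relation σ) (σ.real 22) (potential τ) := by
  refine (Runs.forUpTo₂ (N := k) (B := 2) (fun S τ =>
      (∀ i < k, ∀ j, (i, j) ∈ S → relation σ i j → potential τ i ≤ σ.real 22 i j) ∧
      ∀ i < k, (∀ j < k, ¬ relation σ i j) → potential τ i = 0) h7
    (by decide) (by decide) (by decide) (by decide) (by decide) (by decide)
    (fun S υ c h => h) (fun S υ c h => h)
    ⟨fun i _ j h => absurd h (Set.notMem_empty _), fun i hi _ => hp i hi⟩ ?_).mono
    (by ring_nf; omega) fun τ _ h i hi j hj hij => ?_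
  · rintro i hi j hj S τ hτ h41 h42 ⟨h1, h2⟩
    have e22 := hτ.real 22 (by decide)
    have e22' := hτ.nat 22 (by decide)
    refine Runs.of_wp (by decide) ?_
    simp only [lowerPotential, Program.when, Program.wp, Test.Holds, NExpr.eval, NExpr.var,
      RExpr.eval, h41, h42, e22, e22']
    change ((relation σ i j ∧ σ.real 22 i j ≤ potential τ i) → _) ∧
      (¬ (relation σ i j ∧ σ.real 22 i j ≤ potential τ i) → _)
    have hpot : ∀ l, DiffSystem.potential { τ with real := update τ.real 23 i 0 (σ.real 22 i j) } l =
        if l = i then σ.real 22 i j else potential τ l := by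
      intro l
      by_cases hl : l = i
      · simp [potential, update_apply, hl]
      · simp [potential, update_apply, hl]
    refine ⟨fun hT => ⟨fun i' hi' j' hS hrel => ?_, fun i' hi' hno => ?_⟩,
      fun hT => ⟨fun i' hi' j' hS hrel => ?_, h2⟩⟩
    · rw [hpot]
      split_ifs with h
      · subst h
        rcases hS with hS | hS
        · rw [(Prod.mk.inj hS).2]
        · exact hT.2.trans (h1 i' hi' j' hS hrel)
      · exact h1 i' hi' j' (hS.resolve_left fun e => h (Prod.mk.inj e).1) hrel
    · rw [hpot, if_neg]
      · exact h2 i' hi' hno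
      · rintro rfl
        exact hno j hj hT.1
    · rcases hS with hS | hS
      · obtain ⟨rfl, rfl⟩ := Prod.mk.inj hS
        exact (not_le.1 fun h => hT ⟨hrel, h⟩).le
      · exact h1 i' hi' j' hS hrel
  · rw [Finset.mem_range] at hi hj
    have h1 := h.1 i hi j ⟨hi, hj⟩ hij
    have h2 := h.2 j hj fun l hl => hdir i hi j hj l hl hij
    rw [h2, sub_zero]
    exact h1

theorem runs_initSystem (h7 : σ.nat 7 0 0 = k) :
    Runs initSystem σ (20 * (k + 1) ^ 2) fun τ =>
      HoldsReduction k (relation τ) (τ.real 22) (supply τ) (Finset.range k) τ ∧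
      (∀ i < k, supply τ i = σ.real 1 (σ.nat 8 i 0) 0) ∧
      ∀ i < k, ∀ j < k, (relation τ i j ↔ 0 < σ.real 1 (σ.nat 8 i 0) 0 ∧
          σ.real 1 (σ.nat 8 j 0) 0 < 0 ∧ 1 ≤ σ.nat 2 (σ.nat 8 i 0) (σ.nat 8 j 0)) ∧
        (relation τ i j → τ.real 22 i j = σ.real 2 (σ.nat 8 i 0) (σ.nat 8 j 0)) := by
  refine ((runs_initConstraints h7).seq (B' := (k * 8 + 4) + (k * (k * 4 + 4) + 2))
    fun τ hτ h1 => ?_).mono (by ring_nf; omega) fun _ _ h => h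
  have hτ7 : τ.nat 7 0 0 = k := by rw [hτ.nat 7 (by decide), h7]
  refine (runs_initTerminals hτ7).seq fun υ hυ ⟨h2, h3⟩ => ?_
  have hυ7 : υ.nat 7 0 0 = k := by rw [hυ.nat 7 (by decide), hτ7]
  have erel : relation υ = relation τ := by unfold relation; rw [hυ.nat 22 (by decide)]
  have e22 := hυ.real 22 (by decide)
  have hdir : ∀ i < k, ∀ j < k, ∀ l < k, relation υ i j → ¬ relation υ j l := by
    rw [erel]
    intro i hi j hj l hl hij hjl
    have h4 := (h1 i hi j hj).1.1 hij
    have h5 := (h1 j hj l hl).1.1 hjl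
    exact lt_asymm h4.2.1 h5.1
  refine (runs_lowerPotentials hυ7 (fun i hi => (h2 i hi).2.1) hdir).mono le_rfl
    fun ω hω hfeas => ?_
  have erel' : relation ω = relation υ := by unfold relation; rw [hω.nat 22 (by decide)]
  have e22' := hω.real 22 (by decide)
  have esup : supply ω = supply υ := by unfold supply; rw [hω.real 20 (by decide)]
  have erep : representative ω = representative υ := by
    unfold representative; rw [hω.nat 25 (by decide)]
  have eshift : shift ω = shift υ := by unfold shift; rw [hω.real 25 (by decide)]
  refine ⟨⟨⟨?_, Finset.Subset.refl _, fun i hi => ?_, fun _ _ _ _ => Iff.rfl, rfl⟩, ?_, ?_, ?_⟩,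
    fun i hi => ?_, ?_⟩
  · rw [hω.nat 7 (by decide), hυ7]
  · rw [hω.nat 24 (by decide), (h2 i hi).2.2.2.1]
    simpa using hi
  · refine Reduction.refl (fun i hi h => ?_) (fun _ _ => rfl) (fun i hi => ?_) fun i hi => ?_
    · rw [erel'] at h
      exact hdir i hi i hi i hi h h
    · rw [erep, (h2 i hi).2.2.2.2]
    · rw [eshift, (h2 i hi).2.2.1]
  · rw [erel', e22']; exact hfeas
  · rw [hω.real 35 (by decide), h3]
  · rw [esup, (h2 i hi).1, hτ.real 1 (by decide), hτ.nat 8 (by decide)]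
  · rw [erel', erel, e22', e22]
    exact h1

/-- Distinct indices belong to distinct nodes, so no output is overwritten. Entries of other nodes
are arbitrary and do not matter for optimality. -/
theorem runs_writeDual (h7 : σ.nat 7 0 0 = k)
    (hinj : ∀ i < k, ∀ j < k, σ.nat 8 i 0 = σ.nat 8 j 0 → i = j) :
    Runs writeDual σ (k * 3 + 2) fun τ => ∀ i < k,
      τ.real 3 (σ.nat 8 i 0) 0 = potential σ (representative σ i) + shift σ i := by
  refine (Runs.forUpTo (N := k) (B := 1) (fun j τ => ∀ i < j,
    τ.real 3 (σ.nat 8 i 0) 0 = potential σ (representative σ i) + shift σ i) h7 (by decide)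
    (by decide) (by decide) (fun j τ c h => h) (fun i hi => absurd hi (Nat.not_lt_zero _)) ?_)
  intro j hj τ hτ h41 h
  refine Runs.of_wp le_rfl fun i hi => ?_
  simp only [NExpr.eval, NExpr.var, RExpr.eval, h41, hτ.nat 8 (by decide), hτ.nat 25 (by decide),
    hτ.real 23 (by decide), hτ.real 25 (by decide), update_apply]
  rcases Nat.lt_succ_iff_lt_or_eq.1 hi with h' | rfl
  · have hne : σ.nat 8 i 0 ≠ σ.nat 8 j 0 := fun e => h'.ne (hinj i (h'.trans hj) j hj e)
    simpa [hne] using h i h'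
  · simp [potential, representative, shift]

end DiffSystem

/-! ### Step 2 as a whole, and the total number of steps -/

namespace Network

open RealRAM DiffSystem

variable {n m : ℕ} {N : Network (Fin n) (Fin m)} {σ τ : Mem}

theorem exists_isDualSystem (hσ : N.HoldsTerminals σ) (hc : ∀ s, 0 < N.b s → N.HoldsCostsFrom s σ)
    {g : ℕ → ℕ → Prop} {w : ℕ → ℕ → ℝ} {b : ℕ → ℝ}
    (hb : ∀ i < N.numTerminals, b i = σ.real 1 (σ.nat 8 i 0) 0)
    (hg : ∀ i < N.numTerminals, ∀ j < N.numTerminals,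
      (g i j ↔ 0 < σ.real 1 (σ.nat 8 i 0) 0 ∧ σ.real 1 (σ.nat 8 j 0) 0 < 0 ∧
        1 ≤ σ.nat 2 (σ.nat 8 i 0) (σ.nat 8 j 0)) ∧
      (g i j → w i j = σ.real 2 (σ.nat 8 i 0) (σ.nat 8 j 0))) :
    ∃ t : Fin N.numTerminals → Fin n, (∀ i : Fin N.numTerminals, σ.nat 8 i 0 = t i) ∧ N.IsDualSystem t g w b := by
  have hT := hσ.terminals
  rw [hT.numTerminals_eq] at hT
  choose t ht using fun i : Fin N.numTerminals => hT.exists_eq i i.2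
  have ht' : ∀ i : Fin N.numTerminals, σ.nat 8 i 0 = t i := fun i => (ht i).1
  have hrel : ∀ i j : Fin N.numTerminals,
      g i j ↔ 0 < N.b (t i) ∧ N.b (t j) < 0 ∧ ∃ p, N.IsPath (t i) (t j) p := by
    intro i j
    rw [(hg i i.2 j j.2).1, ht', ht', hσ.stored.b, hσ.stored.b]
    refine and_congr_right fun hs => and_congr_right fun _ => ?_
    have h := (hc _ hs).pathCosts (t := t j)
    constructor
    · intro h1
      by_contra h2
      rw [h.2 h2] at h1
      omega
    · exact fun h1 => (h.1 h1).1.ge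
  refine ⟨t, ht', fun i j e => ?_, fun v hv => ?_, fun i => ?_, hrel, fun i j hij => ?_⟩
  · exact Fin.ext (hT.inj i i.2 j j.2 (by rw [ht', ht', e]))
  · obtain ⟨i, hi, e⟩ := hT.surj v v.2 hv
    exact ⟨⟨i, hi⟩, Fin.ext (by rw [← ht', e])⟩
  · rw [hb i i.2, ht', hσ.stored.b]
  · obtain ⟨hs, -, hp⟩ := (hrel i j).1 hij
    rw [(hg i i.2 j j.2).2 hij, ht', ht']
    exact (((hc _ hs).pathCosts).1 hp).2

/-- Feasibility of the network enters through boundedness of the dual, which keeps total supplies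
zero and ends each phase with a small error. -/
theorem runs_computeDual {M : FlowModel} (hN : N.Feasible M) (hσ : N.HoldsTerminals σ)
    (hc : ∀ s, 0 < N.b s → N.HoldsCostsFrom s σ) (hm : 1 ≤ m) :
    Runs computeDual σ (120 * (N.numTerminals + 1) ^ 7) fun τ =>
      N.HoldsTerminals τ ∧ N.IsOptimalDual (storedVector n τ) := by
  set k := N.numTerminals with hk
  have h7 : σ.nat 7 0 0 = k := hσ.terminals.numTerminals_eq
  suffices h : Runs (.seq initSystem (.seq maxSupply (.seq eliminateAll writeDual))) σ
      (20 * (k + 1) ^ 2 + ((k * 7 + 3) + ((k * (60 * (k + 1) ^ 6 + 1) + 1) + (k * 3 + 2))))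
      fun τ => N.IsOptimalDual (storedVector n τ) by
    refine (Runs.cond (fun _ => h) fun hT => ?_).mono ?_ fun τ hτ h =>
      ⟨hσ.of_frame hτ (by decide) (by decide), h⟩
    · simp only [Test.Holds, NExpr.eval, hσ.stored.numArcs] at hT
      omega
    · have e1 : k * (60 * (k + 1) ^ 6 + 1) + 60 * (k + 1) ^ 6 = 60 * (k + 1) ^ 7 + k := by ring
      have e2 : (k + 1) ^ 2 ≤ (k + 1) ^ 7 := Nat.pow_le_pow_right (by omega) (by decide)
      have e3 : k + 1 ≤ (k + 1) ^ 7 := Nat.le_self_pow (by decide) _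
      omega
  refine (runs_initSystem h7).seq fun τ₁ hf₁ ⟨h1, h2, h3⟩ => ?_
  obtain ⟨t, ht, hsys⟩ := exists_isDualSystem hσ hc h2 h3
  obtain ⟨U, hU⟩ := hsys.bounded hN
  refine (runs_maxSupply h1).seq fun τ₂ hf₂ ⟨h4, h5⟩ => ?_
  refine (runs_eliminateAll h4 h5 hU).seq fun τ₃ hf₃ ⟨h6, h8⟩ => ?_
  have hσ₃ := ((hσ.of_frame hf₁ (by decide) (by decide)).of_frame hf₂ (by decide)
    (by decide)).of_frame hf₃ (by decide) (by decide)
  have h7₃ : τ₃.nat 7 0 0 = k := hσ₃.terminals.numTerminals_eq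
  have e8 : τ₃.nat 8 = σ.nat 8 := by
    rw [hf₃.nat 8 (by decide), hf₂.nat 8 (by decide), hf₁.nat 8 (by decide)]
  refine (runs_writeDual h7₃ fun i hi j hj e => hσ₃.terminals.inj i (by rwa [h7₃]) j
    (by rwa [h7₃]) e).mono le_rfl fun τ₄ _ h9 => ?_
  refine hsys.isOptimalDual (fun i => ?_) h6 h8
  rw [storedVector, ← ht, ← e8, h9 i i.2]

theorem runs_computeDual_of_isEmpty (hσ : N.StoredIn σ) (hm : m = 0) :
    Runs computeDual σ 2 fun τ => N.StoredIn τ := by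
  refine Runs.cond (B := 1) (fun hT => ?_) fun _ => ?_
  · simp only [Test.Holds, NExpr.eval, hσ.numArcs] at hT
    omega
  · refine (Runs.of_wp (P := RealRAM.skip) (Q := fun _ => True) le_rfl trivial).mono le_rfl
      fun τ hf _ => ?_
    exact hσ.of_eq (hf.nat 0 (by decide)) (hf.nat 1 (by decide))
      (hf.real 0 (by decide)) (hf.real 1 (by decide))

theorem Feasible.b_eq_zero_of_isEmpty {M : FlowModel} (hN : N.Feasible M) (hm : m = 0)
    (v : Fin n) : N.b v = 0 := by
  have hk : N.numTerminals = 0 := by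
    have := hN.numTerminals_le
    rw [Fintype.card_fin] at this
    omega
  by_contra hv
  have h : {v | N.b v ≠ 0} = ∅ := (Set.ncard_eq_zero (Set.toFinite _)).1 hk
  exact Set.notMem_empty v (h ▸ hv)

theorem isOptimalDual_of_b_eq_zero (hb : ∀ v, N.b v = 0) (y : Fin n → ℝ) : N.IsOptimalDual y := by
  refine ⟨fun s t x hs => ?_, fun y' _ => ?_⟩
  · rw [hb s] at hs
    exact absurd hs (lt_irrefl _)
  · rw [dualValue_eq_sum, dualValue_eq_sum]
    simp [hb]

/-- For `k ≥ 1`, `(k + 1)⁷ ≤ 128 k² k⁵ ≤ 512 m² k⁵`, and the constant is `61440 = 120 * 512`. The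
Bellman-Ford terms are at most constant multiples of `m² n ≤ m³ n`. -/
theorem steps_le {k : ℕ} (hn : 1 ≤ n) (hm : 1 ≤ m) (hk : k ≤ 2 * m) :
    (n * 5 + k * (n * (m * 5 + 8) + 10) + 8) + 120 * (k + 1) ^ 7 +
      (n * (m * 10 + 16) + m * 4 + 11) ≤ 61440 * (quickestTransshipmentBound n m k + 1) := by
  have h1 : (k + 1) ^ 7 ≤ 512 * (m ^ 2 * k ^ 5) + 1 := by
    rcases Nat.eq_zero_or_pos k with rfl | hpos
    · simp
    · calc (k + 1) ^ 7 ≤ (2 * k) ^ 7 := Nat.pow_le_pow_left (by omega) 7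
        _ = 128 * k ^ 2 * k ^ 5 := by ring
        _ ≤ 128 * (2 * m) ^ 2 * k ^ 5 := by gcongr
        _ = 512 * (m ^ 2 * k ^ 5) := by ring
        _ ≤ _ := Nat.le_succ _
  have h2 : m * n ≤ m ^ 3 * n := Nat.mul_le_mul_right _ (Nat.le_self_pow (by decide) m)
  have h3 : n ≤ m * n := Nat.le_mul_of_pos_left n hm
  have h4 : m ≤ m * n := Nat.le_mul_of_pos_right m hn
  have h5 : m ^ 2 * n ≤ m ^ 3 * n :=
    Nat.mul_le_mul_right _ (Nat.pow_le_pow_right hm (by decide))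
  have h6 : k * (n * (m * 5 + 8) + 10) ≤ 10 * (m ^ 2 * n) + 16 * (m * n) + 20 * m := by
    calc k * (n * (m * 5 + 8) + 10) ≤ 2 * m * (n * (m * 5 + 8) + 10) := Nat.mul_le_mul_right _ hk
      _ = _ := by ring
  have h7 : n * (m * 10 + 16) = 10 * (m * n) + 16 * n := by ring
  rw [quickestTransshipmentBound]
  have h8 : 0 ≤ m ^ 3 * k ^ 3 := Nat.zero_le _
  omega

end Network

/-! ### The main theorem -/

theorem mainTheorem1 :
    -- Correctness: for each choice of the optimal dual solution `y`, a quickest transshipment in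
    -- the subnetwork of cheapest arcs is a quickest minimum cost transshipment.
    (∀ {V A : Type*} [Fintype V] [Fintype A] (N : Network V A) (M : FlowModel),
      N.Feasible M → ∀ y : V → ℝ, N.IsOptimalDual y →
        (N.restrict (N.cheapestArcs y)).Feasible M ∧
        (∀ θ f, (N.restrict (N.cheapestArcs y)).IsTransshipment M θ f →
          N.IsMinCost M θ (Network.extendFlow (N.cheapestArcs y) f)) ∧
        (∀ θ f, N.IsMinCost M θ f →
          ∃ f', (N.restrict (N.cheapestArcs y)).IsTransshipment M θ f') ∧
        (∀ θ f, (N.restrict (N.cheapestArcs y)).IsQuickest M θ f →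
          N.IsQuickestMinCost M θ (Network.extendFlow (N.cheapestArcs y) f))) ∧
    -- Running time: the first three steps of the algorithm are carried out by fixed programs
    -- whose total number of steps is dominated by the quickest transshipment computation.
    (∃ (C : ℕ) (step₁ step₂ step₃ : RealRAM.Program),
      ∀ (n m : ℕ) (N : Network (Fin n) (Fin m)) (M : FlowModel), N.Feasible M →
        ∀ σ₀ : RealRAM.Mem, N.StoredIn σ₀ →
          ∃ (σ₁ σ₂ σ₃ : RealRAM.Mem) (t₁ t₂ t₃ : ℕ),
            RealRAM.Exec step₁ σ₀ σ₁ t₁ ∧ N.PathCostsStoredIn σ₁ ∧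
            RealRAM.Exec step₂ σ₁ σ₂ t₂ ∧ N.IsOptimalDual (Network.storedVector n σ₂) ∧
            RealRAM.Exec step₃ σ₂ σ₃ t₃ ∧ N.StoredIn σ₃ ∧
            Network.ArcSetStoredIn (N.cheapestArcs (Network.storedVector n σ₂)) σ₃ ∧
            t₁ + t₂ + t₃ ≤ C * (quickestTransshipmentBound n m N.numTerminals + 1)) := by
  refine ⟨fun {V A} _ _ N M _ y hy => ⟨hy.feasible_restrict, fun θ f hf =>
    hy.isMinCost_extendFlow hf, fun θ f hf => hy.exists_restrict hf,
    fun θ f hf => hy.isQuickestMinCost hf⟩, 61440, RealRAM.computePathCosts, RealRAM.computeDual,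
    RealRAM.computeCheapestArcs, fun n m N M hN σ₀ hσ₀ => ?_⟩
  -- Without arcs, feasibility rules out terminals. All outputs are then correct whatever the memory
  -- holds, and the three programs stop after constantly many steps.
  rcases Nat.eq_zero_or_pos m with hm | hm
  · have hb := hN.b_eq_zero_of_isEmpty hm
    obtain ⟨σ₁, t₁, e₁, h₁, hσ₁⟩ := Network.runs_computePathCosts_of_isEmpty hσ₀ hm
    obtain ⟨σ₂, t₂, e₂, h₂, hσ₂⟩ := Network.runs_computeDual_of_isEmpty hσ₁ hm
    obtain ⟨σ₃, t₃, e₃, h₃, hσ₃, hA⟩ := Network.runs_computeCheapestArcs_of_isEmpty hσ₂ hm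
      (Network.storedVector n σ₂)
    exact ⟨σ₁, σ₂, σ₃, t₁, t₂, t₃, e₁, fun s _ hs => absurd (hb s) hs.ne',
      e₂, Network.isOptimalDual_of_b_eq_zero hb _, e₃, hσ₃, hA,
      by omega⟩
  · have hn : 1 ≤ n := (Nat.zero_le _).trans_lt (N.tail ⟨0, hm⟩).2
    have hk : N.numTerminals ≤ 2 * m := by simpa using hN.numTerminals_le
    obtain ⟨σ₁, t₁, e₁, h₁, hσ₁, hc⟩ := Network.runs_computePathCosts hσ₀ hm
    obtain ⟨σ₂, t₂, e₂, h₂, hσ₂, hy⟩ := Network.runs_computeDual hN hσ₁ hc hm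
    obtain ⟨σ₃, t₃, e₃, h₃, hσ₃, hA⟩ := Network.runs_computeCheapestArcs hσ₂ hm hy
    exact ⟨σ₁, σ₂, σ₃, t₁, t₂, t₃, e₁, fun s t hs _ => (hc s hs).pathCosts, e₂, hy, e₃, hσ₃, hA,
      (add_le_add (add_le_add h₁ h₂) h₃).trans (Network.steps_le hn hm hk)⟩
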